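/- Let $R$ be a discrete valuation domain of characteristic $0$ whose maximal ideal is $pR$ for a prime number $p$, and let $G$ be a finite cyclic $p$-group. An $R$-lattice is a finitely generated projective $R$-module. A cohomological $G$-Mackey functor $\mathbf X$ with values in $R$-modules is a family of $R$-modules $(\mathbf X_U)_{U\le G}$ with $R$-linear maps $i_{U,V}\colon\mathbf X_U\to\mathbf X_V$, $t_{V,U}\colon\mathbf X_V\to\mathbf X_U$ ($V\le U\le G$) and $c_{g,U}\colon\mathbf X_U\to\mathbf X_{{}^gU}$ ($g\in G$, ${}^gU=gUg^{-1}$) such that $i_{U,U}$, $t_{U,U}$ and $c_{u,U}$ ($u\in U$) are identities; $i$, $t$ and $c$ are transitive; $i$ and $t$ commute with conjugation; $i_{U,W}\circ t_{V,U}=\sum_{g\in W\backslash U/V}t_{{}^gV\cap W,W}\circ c_{g,V\cap W^g}\circ i_{V,V\cap W^g}$ for $V,W\le U$ (with $W^g=g^{-1}Wg$); and $t_{V,U}\circ i_{U,V}=|U:V|\cdot\mathrm{id}$. It is finitely generated (respectively, an $R$-lattice functor) if every $\mathbf X_U$ is a finitely generated $R$-module (respectively, an $R$-lattice); it is $i$-injective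 if all $i_{U,V}$ are injective; it is of type $H^0$ if it is $i$-injective and $i_{U,V}(\mathbf X_U)=(\mathbf X_V)^U$ whenever $V\trianglelefteq U\le G$. The projective dimension of an object is the least $d\in\mathbb N_0\cup\{\infty\}$ for which it has a projective resolution $(\mathbf P_k)_{k\ge 0}$ with $\mathbf P_k=0$ for $k>d$. Let $\mathbf X$ be a finitely generated cohomological $G$-Mackey functor, and let $$\mathbf P_2\xrightarrow{\partial_2}\mathbf P_1\xrightarrow{\partial_1}\mathbf P_0\xrightarrow{\varepsilon}\mathbf X\to 0$$ be a partial projective resolution (exact sequence) of $\mathbf X$ by projective $R$-lattice functors (in (b) only $\mathbf P_1,\mathbf P_0$ and in (c) only $\mathbf P_0$ are needed). (a) $\ker(\partial_2)$ is a projective $R$-lattice functor, and $\mathbf X$ has projective dimension $\le 3$. (b) If $\mathbf X$ is $i$-injective, then $\ker(\partial_1)$ is a projective $R$-lattice functor, and $\mathbf X$ has projective dimension $\le 2$. (c) If $\mathbf X$ is of type $H^0$, then $\ker(\varepsilon)$ is a projective $R$-lattice functor, and $\mathbf X$ has projective dimension $\le 1$. Moreover, let $\mathcal M_R(G)$ be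 the $R$-linear category whose objects are the subgroups of $G$, with $\operatorname{Hom}(U,V)=\operatorname{Hom}_{R[G]}(R[G/U],R[G/V])$. If $G$ is non-trivial, then the global $R$-lattice dimension of $\mathcal M_R(G)$, i.e. the supremum of the projective dimensions of all $R$-linear functors $\mathcal M_R(G)^{\rm op}\to{}_R\mathrm{Mod}$ whose values are $R$-lattices, equals $2$, and the global dimension of $\mathcal M_R(G)$, i.e. the supremum of the projective dimensions of all $R$-linear functors $\mathcal M_R(G)^{\rm op}\to{}_R\mathrm{Mod}$, equals $3$. -/

import Mathlib

open CategoryTheory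

universe w v u

/-! ### Cohomological Mackey functors -/

/-- The conjugate subgroup `ᵍU = g U g⁻¹`. -/
def conjSubgroup {G : Type v} [Group G] (g : G) (U : Subgroup G) : Subgroup G :=
  U.map (MulAut.conj g).toMonoidHom

theorem mem_conjSubgroup {G : Type v} [Group G] {g : G} {U : Subgroup G} {x : G} :
    x ∈ conjSubgroup g U ↔ g⁻¹ * x * g ∈ U := by
  constructor
  · rintro ⟨y, hy, rfl⟩
    simpa [mul_assoc] using hy
  · intro h
    exact ⟨_, h, by simp [mul_assoc]⟩

/-- `ᵍV ∩ W = ᵍ(V ∩ Wᵍ)` where `Wᵍ = g⁻¹ W g`. -/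
theorem conj_inf_eq {G : Type v} [Group G] (g : G) (V W : Subgroup G) :
    conjSubgroup g V ⊓ W = conjSubgroup g (V ⊓ conjSubgroup g⁻¹ W) := by
  ext x
  simp [Subgroup.mem_inf, mem_conjSubgroup, mul_assoc]

/-- `S` is a system of representatives of the double cosets `W \ U / V`. -/
def IsDoubleCosetSystem {G : Type v} [Group G] (W U V : Subgroup G) (S : Finset G) : Prop :=
  (∀ s ∈ S, s ∈ U) ∧
    ∀ x ∈ U, ∃! s, s ∈ S ∧ x ∈ DoubleCoset.doubleCoset s (W : Set G) (V : Set G)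

/-- A cohomological `G`-Mackey functor with values in `R`-modules: a family of `R`-modules
indexed by the subgroups of `G`, with restriction maps `res` (written `i_{U,V}`), transfer maps
`tr` (written `t_{V,U}`) and conjugation maps `conj` (written `c_{g,U}`). The conjugation map
`c_{g,U} : X_U → X_{ᵍU}` is given for every subgroup `U'` together with an equality
`U' = ᵍU`, which avoids transporting along equalities of subgroups. -/
structure CohMackey (R : Type u) (G : Type v) [CommRing R] [Group G] where
  obj : Subgroup G → Type w
  [addCommGroup : ∀ U, AddCommGroup (obj U)]
  [module : ∀ U, Module R (obj U)]
  res : ∀ {U V : Subgroup G}, V ≤ U → obj U →ₗ[R] obj V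
  tr : ∀ {V U : Subgroup G}, V ≤ U → obj V →ₗ[R] obj U
  conj : ∀ (g : G) (U U' : Subgroup G), U' = conjSubgroup g U → obj U →ₗ[R] obj U'
  res_self : ∀ (U : Subgroup G) (h : U ≤ U), res h = LinearMap.id
  tr_self : ∀ (U : Subgroup G) (h : U ≤ U), tr h = LinearMap.id
  conj_self : ∀ (U : Subgroup G) (x : G) (_ : x ∈ U) (h : U = conjSubgroup x U),
    conj x U U h = LinearMap.id
  res_res : ∀ {U V W : Subgroup G} (hWV : W ≤ V) (hVU : V ≤ U),
    res hWV ∘ₗ res hVU = res (hWV.trans hVU)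
  tr_tr : ∀ {U V W : Subgroup G} (hWV : W ≤ V) (hVU : V ≤ U),
    tr hVU ∘ₗ tr hWV = tr (hWV.trans hVU)
  conj_conj : ∀ (g h : G) (U U' U'' : Subgroup G) (h₁ : U' = conjSubgroup g U)
    (h₂ : U'' = conjSubgroup h U') (h₃ : U'' = conjSubgroup (h * g) U),
    conj h U' U'' h₂ ∘ₗ conj g U U' h₁ = conj (h * g) U U'' h₃
  res_conj : ∀ (g : G) (U V U' V' : Subgroup G) (hVU : V ≤ U) (hVU' : V' ≤ U')
    (hU : U' = conjSubgroup g U) (hV : V' = conjSubgroup g V),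
    res hVU' ∘ₗ conj g U U' hU = conj g V V' hV ∘ₗ res hVU
  tr_conj : ∀ (g : G) (U V U' V' : Subgroup G) (hVU : V ≤ U) (hVU' : V' ≤ U')
    (hU : U' = conjSubgroup g U) (hV : V' = conjSubgroup g V),
    tr hVU' ∘ₗ conj g V V' hV = conj g U U' hU ∘ₗ tr hVU
  mackey : ∀ (U V W : Subgroup G) (hV : V ≤ U) (hW : W ≤ U) (S : Finset G),
    IsDoubleCosetSystem W U V S →
    res hW ∘ₗ tr hV = ∑ g ∈ S,
      tr (inf_le_right : conjSubgroup g V ⊓ W ≤ W) ∘ₗ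
        conj g (V ⊓ conjSubgroup g⁻¹ W) (conjSubgroup g V ⊓ W) (conj_inf_eq g V W) ∘ₗ
          res (inf_le_left : V ⊓ conjSubgroup g⁻¹ W ≤ V)
  cohomological : ∀ {U V : Subgroup G} (hV : V ≤ U),
    tr hV ∘ₗ res hV = V.relIndex U • LinearMap.id

attribute [instance] CohMackey.addCommGroup CohMackey.module

namespace CohMackey

variable {R : Type u} {G : Type v} [CommRing R] [Group G]

/-- A homomorphism of cohomological Mackey functors. -/
@[ext]
structure Hom (X Y : CohMackey.{w} R G) where
  app : ∀ U : Subgroup G, X.obj U →ₗ[R] Y.obj U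
  app_res : ∀ {U V : Subgroup G} (h : V ≤ U), app V ∘ₗ X.res h = Y.res h ∘ₗ app U
  app_tr : ∀ {U V : Subgroup G} (h : V ≤ U), app U ∘ₗ X.tr h = Y.tr h ∘ₗ app V
  app_conj : ∀ (g : G) (U U' : Subgroup G) (h : U' = conjSubgroup g U),
    app U' ∘ₗ X.conj g U U' h = Y.conj g U U' h ∘ₗ app U

/-- The category of cohomological `G`-Mackey functors with values in `R`-modules. -/
instance : Category (CohMackey.{w} R G) where
  Hom X Y := Hom X Y
  id X :=
    { app := fun _ => LinearMap.id
      app_res := fun _ => rfl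
      app_tr := fun _ => rfl
      app_conj := fun _ _ _ _ => rfl }
  comp f g :=
    { app := fun U => g.app U ∘ₗ f.app U
      app_res := fun h => by
        rw [LinearMap.comp_assoc, f.app_res, ← LinearMap.comp_assoc, g.app_res,
          LinearMap.comp_assoc]
      app_tr := fun h => by
        rw [LinearMap.comp_assoc, f.app_tr, ← LinearMap.comp_assoc, g.app_tr,
          LinearMap.comp_assoc]
      app_conj := fun x U U' h => by
        rw [LinearMap.comp_assoc, f.app_conj, ← LinearMap.comp_assoc, g.app_conj,
          LinearMap.comp_assoc] }

/-- The component `φ_U : X_U → Y_U` of a homomorphism. -/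
def component {X Y : CohMackey.{w} R G} (φ : X ⟶ Y) (U : Subgroup G) :
    X.obj U →ₗ[R] Y.obj U :=
  Hom.app φ U

/-- Evaluation of cohomological Mackey functors at a subgroup, `X ↦ X_U`. -/
def ev (U : Subgroup G) : CohMackey.{w} R G ⥤ ModuleCat.{w} R where
  obj X := ModuleCat.of R (X.obj U)
  map φ := ModuleCat.ofHom (component φ U)
  map_id _ := rfl
  map_comp _ _ := rfl

/-- All values are finitely generated `R`-modules. -/
def IsFG (X : CohMackey.{w} R G) : Prop :=
  ∀ U : Subgroup G, Module.Finite R (X.obj U)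

/-- All values are `R`-lattices, i.e. finitely generated projective `R`-modules. -/
def IsLattice (X : CohMackey.{w} R G) : Prop :=
  ∀ U : Subgroup G, Module.Finite R (X.obj U) ∧ Module.Projective R (X.obj U)

/-- A projective object of the category of cohomological Mackey functors all of whose values
are `R`-lattices. -/
def IsProjectiveLattice (P : CohMackey.{w} R G) : Prop :=
  Projective P ∧ P.IsLattice

/-- All restriction maps `i_{U,V}` are injective. -/
def IsIInjective (X : CohMackey.{w} R G) : Prop :=
  ∀ (U V : Subgroup G) (h : V ≤ U), Function.Injective (X.res h)

/-- `X` is of type `H⁰` (Galois descent): it is `i`-injective, and for all `V ⊴ U ≤ G` the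
image of `i_{U,V}` is all of the `U`-invariants `X_V ^ U`, where `x ∈ U` acts on `X_V` by
`c_{x,V}`. -/
def IsTypeH0 (X : CohMackey.{w} R G) : Prop :=
  X.IsIInjective ∧
    ∀ (U V : Subgroup G) (hVU : V ≤ U), (V.subgroupOf U).Normal →
      ∀ a : X.obj V,
        (∀ x ∈ U, ∀ h : V = conjSubgroup x V, X.conj x V V h a = a) →
          ∃ b : X.obj U, X.res hVU b = a

end CohMackey

/-! ### Projective dimension via projective resolutions -/

section ProjDim

variable {R : Type u} [CommRing R] {A : Type*} [Category A] {ι : Type*}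

/-- Let `A` be a category of functors with values in `R`-modules, with evaluation functors `ev`.
`X` has a projective resolution `… → P₁ → P₀ → X → 0` (exactness being
tested on all values) with `P_k = 0` for `k > d`. -/
def HasProjectiveResolutionOfLength (ev : ι → A ⥤ ModuleCat.{w} R) (X : A) (d : ℕ) : Prop :=
  ∃ (P : ℕ → A) (δ : ∀ k, P (k + 1) ⟶ P k) (ε : P 0 ⟶ X),
    (∀ k, Projective (P k)) ∧
    (∀ i, Function.Surjective ((ev i).map ε)) ∧
    (∀ i, Function.Exact ((ev i).map (δ 0)) ((ev i).map ε)) ∧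
    (∀ k i, Function.Exact ((ev i).map (δ (k + 1))) ((ev i).map (δ k))) ∧
    (∀ k, d < k → ∀ i, Subsingleton ((ev i).obj (P k)))

/-- The projective dimension: the least length of a projective resolution, `⊤` if there is no
projective resolution of finite length. -/
noncomputable def projDim (ev : ι → A ⥤ ModuleCat.{w} R) (X : A) : ℕ∞ :=
  ⨅ (d : ℕ) (_ : HasProjectiveResolutionOfLength ev X d), (d : ℕ∞)

end ProjDim

/-! ### Linear functors on an `R`-category and its global dimensions -/

section RCategory

variable (R : Type u) [CommRing R] (C : Type*) [Category C] [Preadditive C] [Linear R C]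

/-- Being an `R`-linear (contravariant) functor from `C` to `R`-modules. -/
def IsLinearPresheaf : ObjectProperty (Cᵒᵖ ⥤ ModuleCat.{w} R) := fun F =>
  (∀ ⦃A B : C⦄ (f g : A ⟶ B), F.map (f + g).op = F.map f.op + F.map g.op) ∧
    ∀ ⦃A B : C⦄ (r : R) (f : A ⟶ B), F.map (r • f).op = r • F.map f.op

/-- The category of `R`-linear contravariant functors from `C` to `R`-modules, with all natural
transformations. -/
abbrev LinearPresheaf := (IsLinearPresheaf.{w} R C).FullSubcategory

/-- Evaluation at an object of `C`. -/
def LinearPresheaf.ev (A : C) : LinearPresheaf.{w} R C ⥤ ModuleCat.{w} R :=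
  (IsLinearPresheaf.{w} R C).ι ⋙ (evaluation Cᵒᵖ (ModuleCat.{w} R)).obj (Opposite.op A)

/-- `F` is an `R`-lattice functor: all values are finitely generated projective. -/
def LinearPresheaf.IsLattice (F : LinearPresheaf.{w} R C) : Prop :=
  ∀ A : C, Module.Finite R (F.obj.obj (Opposite.op A)) ∧
    Module.Projective R (F.obj.obj (Opposite.op A))

/-- The global dimension of the `R`-category `C`. -/
noncomputable def globalDim : ℕ∞ :=
  ⨆ F : LinearPresheaf.{w} R C, projDim (LinearPresheaf.ev.{w} R C) F

/-- The global `R`-lattice dimension of the `R`-category `C`. -/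
noncomputable def globalLatticeDim : ℕ∞ :=
  ⨆ (F : LinearPresheaf.{w} R C) (_ : LinearPresheaf.IsLattice.{w} R C F),
    projDim (LinearPresheaf.ev.{w} R C) F

end RCategory

/-- The Mackey category `𝓜_R(G)`: its objects are the subgroups of `G`, and the morphisms from
`U` to `V` are the `R[G]`-linear maps `R[G/U] → R[G/V]`. -/
abbrev MackeyCat (R : Type u) (G : Type v) [CommRing R] [Group G] :=
  InducedCategory (Rep.{max u v} R G)
    (fun U : Subgroup G => Rep.ofMulAction R G (G ⧸ U))

/-!
Let `G` be cyclic of order `p ^ n` with generator `σ`, and let `X ↦ X_1` be evaluation at the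
trivial subgroup. Call `X` a functor of fixed points if `X_U` is the module of `U`-invariants of
`X_1` for every `U` (`CohMackey.IsFixed`). Homomorphisms into such functors are just equivariant
maps at the trivial subgroup (`CohMackey.IsFixed.exists_hom`).

*Projective functors.* The Mackey functor `perm R U` represented by `R[G/U]` is projective by
Yoneda's lemma (`CohMackey.projective_perm`), and every functor is a quotient of a direct sum of
such functors. Hence every projective functor is a functor of fixed points, and its value at `1`
is `R`-free and coflasque, i.e. all `H¹(U, -)` vanish (`CohMackey.IsCoflasqueFixed`).

*The converse* is the heart of the matter: over a cyclic `p`-group and with `p` generating the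
maximal ideal of `R`, an `R`-free coflasque module is a summand of a permutation module. In the
form needed here, such a module lifts along all equivariant maps that are surjective on invariants
(`IsCoflasque.isFixedProjective`). The proof is by induction on `n`. Let `Φ` be the `p ^ n`-th
cyclotomic polynomial. The part `L'` of the module `L` killed by `Φ` is a module over `R[X]/(Φ)`,
which is a principal ideal domain since `Φ` is Eisenstein after a shift. So `L'` is free over it,
and this provides an `R`-endomorphism `χ` of `L'` whose trace is `σ ^ (p ^ (n - 1)) - 1`
(`exists_trace_eq_pow_sub_one`). As `L` is coflasque, this can be divided by
`σ ^ (p ^ (n - 1)) - 1`, so that there is an endomorphism of `L` whose trace is the identity on `L'`. Maps out of `L`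
then decompose into traces, which lift because `L` is `R`-free, and maps out of `L / L'`, a
coflasque module for a group of order `p ^ (n - 1)`.

*Upper bounds.* The kernel of a surjection of a projective functor onto a functor of fixed points
is again coflasque, hence projective. The kernel of a map from a functor of fixed points to a
functor with injective restriction maps is a functor of fixed points. Thus one more syzygy is
required for functors with injective restrictions, such as all lattices, and one further syzygy in
general.

*Lower bounds.* Let `C` be the constant functor `R`, i.e. `perm R ⊤`. The subfunctor that is `p C`
at `G` and `C` elsewhere is a lattice but not a functor of fixed points, which rules out
projective dimension one. The quotient of `C` by it vanishes at the trivial subgroup but not at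
`G`, which rules out projective dimension two. Both follow from the vanishing of `H¹` for
projective functors (`CohMackey.exists_lift_of_fixed`).

Finally, the subgroups of `G` form a chain, so the homomorphisms from `perm R U` can be written
down explicitly, and cohomological Mackey functors are the same as linear functors on the Mackey
category (`CohMackey.equivLinearPresheaf`).
-/

/-! ### Submodules of free modules over a principal ideal domain -/

section PID

variable {R : Type*} [CommRing R] [IsDomain R] [IsPrincipalIdealRing R]

/-- A submodule of a free module of arbitrary rank over a principal ideal domain is free: for a
well-order on the index set, the leading coefficients in each degree form a principal ideal, and
elements realising generators of the non-zero ones among these ideals are a basis. -/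
theorem Module.free_of_submodule_finsupp {ι : Type*} (N : Submodule R (ι →₀ R)) :
    Module.Free R N := by
  classical
  obtain ⟨_, _⟩ := exists_wellFoundedLT ι
  -- `D j` is the part of `N` supported in degrees at most `j`
  let D : ι → Submodule R (ι →₀ R) := fun j => N ⊓ Finsupp.supported R R (Set.Iic j)
  have hgen : ∀ j, ∃ x ∈ D j, ∀ y ∈ D j, ∃ c : R, y j = c * x j := by
    intro j
    have hp := IsPrincipalIdealRing.principal ((D j).map (Finsupp.lapply j))
    obtain ⟨a, ha⟩ := hp
    have : a ∈ (D j).map (Finsupp.lapply j) := ha ▸ Submodule.mem_span_singleton_self a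
    obtain ⟨x, hx, rfl⟩ := this
    refine ⟨x, hx, fun y hy => ?_⟩
    have : Finsupp.lapply j y ∈ (D j).map (Finsupp.lapply j) := Submodule.mem_map_of_mem hy
    rw [ha, Submodule.mem_span_singleton] at this
    obtain ⟨c, hc⟩ := this
    exact ⟨c, by simpa using hc.symm⟩
  choose x hxD hx using hgen
  have hDmax : ∀ (z : ι →₀ R) (hne : z.support.Nonempty), z ∈ N → z ∈ D (z.support.max' hne) :=
    fun z hne hz => Submodule.mem_inf.2 ⟨hz, (Finsupp.mem_supported R z).2
      fun i hi => Finset.le_max' _ _ hi⟩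
  let J : Set ι := {j | x j j ≠ 0}
  have hsupp : ∀ j k, j < k → x j k = 0 := by
    intro j k hjk
    by_contra h
    have h1 := (Finsupp.mem_supported R (x j)).1 (hxD j).2 (Finsupp.mem_support_iff.2 h)
    exact absurd h1 (not_le.2 hjk)
  have hlin : LinearIndependent R (fun j : J => x j) := by
    refine linearIndependent_iff'.2 fun s g hg => ?_
    by_contra! hne
    obtain ⟨i₀, hi₀, hgi₀⟩ := hne
    -- compare the leading coefficients of a dependence relation
    let s' := s.filter (fun i => g i ≠ 0)
    have hs' : s'.Nonempty := ⟨i₀, by simp [s', hi₀, hgi₀]⟩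
    obtain ⟨m, hm, hmax⟩ := s'.exists_max_image id hs'
    have h0 := DFunLike.congr_fun hg (m : ι)
    rw [Finsupp.finsetSum_apply, Finset.sum_eq_single m] at h0
    · have hms := (Finset.mem_filter.1 hm).2
      rcases mul_eq_zero.1 h0 with h | h
      · exact hms h
      · exact m.2 h
    · intro b hb hbm
      by_cases hgb : g b = 0
      · simp [hgb]
      · have hle : b ≤ m := hmax b (by simp [s', hb, hgb])
        have hlt : (b : ι) < m := lt_of_le_of_ne hle fun h => hbm (Subtype.ext h)
        simp [hsupp _ _ hlt]
    · intro h
      exact absurd (Finset.mem_filter.1 hm).1 h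
  let v : J → N := fun j => ⟨x j, (hxD j).1⟩
  refine Module.Free.of_basis (Module.Basis.mk (v := v) ?_ ?_)
  · exact LinearIndependent.of_comp N.subtype hlin
  · have key : ∀ j, ∀ y : N, (y : ι →₀ R) ∈ D j → y ∈ Submodule.span R (Set.range v) := by
      intro j
      induction j using WellFoundedLT.induction with
      | _ j ih =>
        intro y hy
        obtain ⟨c, hc⟩ := hx j y hy
        have hlow : ∀ z : N, (z : ι →₀ R) ∈ D j → (z : ι →₀ R) j = 0 →
            z ∈ Submodule.span R (Set.range v) := by
          intro z hzD hzj
          by_cases hz : (z : ι →₀ R) = 0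
          · have : z = 0 := Subtype.ext hz
            rw [this]; exact zero_mem _
          · have hne : (z : ι →₀ R).support.Nonempty := Finsupp.support_nonempty_iff.2 hz
            have hmem := Finset.max'_mem _ hne
            refine ih _ (lt_of_le_of_ne ?_ ?_) z (hDmax _ hne z.2)
            · exact (Finsupp.mem_supported R _).1 (Submodule.mem_inf.1 hzD).2 hmem
            · intro h
              rw [h] at hmem
              exact (Finsupp.mem_support_iff.1 hmem) hzj
        let xj : N := ⟨x j, (hxD j).1⟩
        -- subtracting a multiple of `x j` removes the leading term
        have hyz : y = (y - c • xj) + c • xj :=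
          Subtype.ext (sub_add_cancel (y : ι →₀ R) (c • x j)).symm
        rw [hyz]
        refine add_mem (hlow _ ((D j).sub_mem hy ((D j).smul_mem c (hxD j))) ?_)
          (Submodule.smul_mem _ _ ?_)
        · simp [xj, hc]
        · by_cases hj : x j j = 0
          · exact hlow xj (hxD j) hj
          · exact Submodule.subset_span ⟨⟨j, hj⟩, rfl⟩
    intro y _
    by_cases hy : (y : ι →₀ R) = 0
    · have : y = 0 := Subtype.ext hy
      rw [this]; exact zero_mem _
    · have hne : (y : ι →₀ R).support.Nonempty := Finsupp.support_nonempty_iff.2 hy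
      exact key _ y (hDmax _ hne y.2)

/-- Over a principal ideal domain, a module that embeds into a projective module is free. -/
theorem Module.Free.of_injective_of_projective {M P : Type*} [AddCommGroup M] [Module R M]
    [AddCommGroup P] [Module R P] [Module.Projective R P] (f : M →ₗ[R] P)
    (hf : Function.Injective f) : Module.Free R M := by
  obtain ⟨s, hs⟩ := (Module.projective_def' (R := R) (P := P)).1 inferInstance
  have hsi : Function.Injective s := fun a b hab => by
    have := congrArg (Finsupp.linearCombination R id) hab
    simpa using (DFunLike.congr_fun hs a).symm.trans (this.trans (DFunLike.congr_fun hs b))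
  have hinj : Function.Injective (s ∘ₗ f) := hsi.comp hf
  have := Module.free_of_submodule_finsupp (LinearMap.range (s ∘ₗ f))
  exact Module.Free.of_equiv (LinearEquiv.ofInjective (s ∘ₗ f) hinj).symm

end PID

/-! ### The ring generated by a root of unity of order `p ^ (m + 1)` -/

section Cyclotomic

open Polynomial

variable {R : Type*} [CommRing R] [IsDomain R] [IsDiscreteValuationRing R] [CharZero R]
  {p : ℕ}

/-- As `p` is a uniformizer of `R`, the `p ^ (m + 1)`-th cyclotomic polynomial is Eisenstein over
`R` after the substitution `X ↦ X + 1`; in particular it is prime. -/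
theorem prime_cyclotomic_of_maximalIdeal_eq (hp : p.Prime)
    (hR : IsLocalRing.maximalIdeal R = Ideal.span {(p : R)}) (m : ℕ) :
    Prime (cyclotomic (p ^ (m + 1)) R) := by
  have : Fact p.Prime := ⟨hp⟩
  have hmon := cyclotomic.monic (p ^ (m + 1)) R
  have hmap : (cyclotomic (p ^ (m + 1)) R).comp (X + 1) =
      ((cyclotomic (p ^ (m + 1)) ℤ).comp (X + 1)).map (Int.castRingHom R) := by
    rw [Polynomial.map_comp, map_cyclotomic]
    simp
  have hmon' : ((cyclotomic (p ^ (m + 1)) R).comp (X + 1)).Monic := by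
    simpa using hmon.comp_X_add_C 1
  have hp0 : (p : R) ≠ 0 := Nat.cast_ne_zero.2 hp.ne_zero
  have hdeg : ((cyclotomic (p ^ (m + 1)) ℤ).comp (X + 1)).natDegree =
      ((cyclotomic (p ^ (m + 1)) R).comp (X + 1)).natDegree := by
    have hZ : ((cyclotomic (p ^ (m + 1)) ℤ).comp (X + 1)).Monic := by
      simpa using (cyclotomic.monic (p ^ (m + 1)) ℤ).comp_X_add_C 1
    rw [hmap, hZ.natDegree_map]
  have hE : ((cyclotomic (p ^ (m + 1)) R).comp (X + 1)).IsEisensteinAt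
      (IsLocalRing.maximalIdeal R) := by
    refine ⟨?_, ?_, ?_⟩
    · rw [hmon'.leadingCoeff]
      exact fun h => (IsLocalRing.maximalIdeal.isMaximal R).ne_top ((Ideal.eq_top_iff_one _).2 h)
    · intro n hn
      have h := (cyclotomic_prime_pow_comp_X_add_one_isEisensteinAt p m).mem
        (n := n) (by rw [hdeg]; exact hn)
      obtain ⟨c, hc⟩ := Ideal.mem_span_singleton.1 h
      rw [hmap, coeff_map, hc, hR]
      refine Ideal.mem_span_singleton.2 ⟨(c : R), by simp⟩
    · rw [hR, Ideal.span_singleton_pow, Ideal.mem_span_singleton]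
      rintro ⟨c, hc⟩
      have h1 : (cyclotomic (p ^ (m + 1)) R).eval 1 = p := by simp
      rw [coeff_zero_eq_eval_zero, eval_comp] at hc
      simp only [eval_add, eval_X, eval_one, zero_add] at hc
      rw [h1] at hc
      have : (p : R) * (p * c) = p * 1 := by
        linear_combination -hc
      have hu : IsUnit (p : R) := IsUnit.of_mul_eq_one _ (mul_left_cancel₀ hp0 this)
      have hmem : (p : R) ∈ IsLocalRing.maximalIdeal R := hR ▸ Ideal.mem_span_singleton_self _
      exact (IsLocalRing.mem_maximalIdeal _).1 hmem hu
  have hirr := hE.irreducible (IsLocalRing.maximalIdeal.isMaximal R).isPrime hmon'.isPrimitive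
    (by
      rw [natDegree_comp, natDegree_cyclotomic, ← C_1, natDegree_X_add_C, mul_one]
      exact Nat.totient_pos.2 (pow_pos hp.pos _))
  have hirr' : Irreducible (cyclotomic (p ^ (m + 1)) R) := by
    have h := (MulEquiv.irreducible_iff (algEquivAevalXAddC (1 : R)).toMulEquiv
      (x := cyclotomic (p ^ (m + 1)) R))
    refine h.1 ?_
    convert hirr using 1
    simp [algEquivAevalXAddC_apply, aeval_def, comp, eval₂_eq_eval_map, algebraMap_eq]
  exact hirr'.prime

theorem isDomain_adjoinRoot_cyclotomic (hp : p.Prime)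
    (hR : IsLocalRing.maximalIdeal R = Ideal.span {(p : R)}) (m : ℕ) :
    IsDomain (AdjoinRoot (cyclotomic (p ^ (m + 1)) R)) :=
  AdjoinRoot.isDomain_of_prime (prime_cyclotomic_of_maximalIdeal_eq hp hR m)

/-- The ring `R[ζ]` is a principal ideal domain: its only non-zero prime ideal is generated by
`ζ - 1`. -/
theorem isPrincipalIdealRing_adjoinRoot_cyclotomic (hp : p.Prime)
    (hR : IsLocalRing.maximalIdeal R = Ideal.span {(p : R)}) (m : ℕ) :
    IsPrincipalIdealRing (AdjoinRoot (cyclotomic (p ^ (m + 1)) R)) := by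
  have : Fact p.Prime := ⟨hp⟩
  have := isDomain_adjoinRoot_cyclotomic hp hR m
  set Φ := cyclotomic (p ^ (m + 1)) R with hΦ
  have hmon : Φ.Monic := cyclotomic.monic (p ^ (m + 1)) R
  have := hmon.finite_adjoinRoot
  set z := AdjoinRoot.root Φ - 1 with hz
  have hmk : ∀ f : R[X], ∃ b, AdjoinRoot.mk Φ f = algebraMap R _ (f.eval 1) + z * b := by
    intro f
    obtain ⟨g, hg⟩ := X_sub_C_dvd_sub_C_eval (a := (1 : R)) (p := f)
    refine ⟨AdjoinRoot.mk Φ g, ?_⟩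
    have := congrArg (AdjoinRoot.mk Φ) hg
    simp only [map_sub, map_mul, AdjoinRoot.mk_C, AdjoinRoot.mk_X, map_one] at this
    rw [hz, AdjoinRoot.algebraMap_eq, ← this]
    ring
  have hpz : ∃ b, (p : AdjoinRoot Φ) = z * b := by
    obtain ⟨b, hb⟩ := hmk Φ
    refine ⟨-b, ?_⟩
    have hev : Φ.eval 1 = p := by rw [hΦ, eval_one_cyclotomic_prime_pow]
    rw [AdjoinRoot.mk_self, hev, map_natCast] at hb
    linear_combination -hb
  refine IsPrincipalIdealRing.of_prime fun P hP => ?_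
  by_cases hbot : P = ⊥
  · rw [hbot]; exact bot_isPrincipal
  have hcomap : P.comap (algebraMap R (AdjoinRoot Φ)) ≠ ⊥ := by
    obtain ⟨x, hx, hx0⟩ := Submodule.exists_mem_ne_zero_of_ne_bot hbot
    exact Ideal.comap_ne_bot_of_integral_mem hx0 hx (Algebra.IsIntegral.isIntegral x)
  have hmax : P.comap (algebraMap R (AdjoinRoot Φ)) = IsLocalRing.maximalIdeal R :=
    IsLocalRing.eq_maximalIdeal ((hP.comap _).isMaximal hcomap)
  have hpP : (p : AdjoinRoot Φ) ∈ P := by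
    have : (p : R) ∈ P.comap (algebraMap R (AdjoinRoot Φ)) := by
      rw [hmax, hR]; exact Ideal.mem_span_singleton_self _
    simpa using this
  have hzP : z ∈ P := by
    -- the domain `R[ζ] ⧸ P` of characteristic `p` has no root of unity other than `1`
    -- whose order is a power of `p`
    have : CharP (AdjoinRoot Φ ⧸ P) p := by
      refine (CharP.charP_iff_prime_eq_zero hp).2 ?_
      rw [← map_natCast (Ideal.Quotient.mk P)]
      exact Ideal.Quotient.eq_zero_iff_mem.2 hpP
    rw [← Ideal.Quotient.eq_zero_iff_mem]
    refine eq_zero_of_pow_eq_zero (n := p ^ (m + 1)) ?_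
    have hroot : AdjoinRoot.root Φ ^ (p ^ (m + 1)) = 1 := by
      have h := congrArg (AdjoinRoot.mk Φ) (cyclotomic_prime_pow_mul_X_pow_sub_one R p m)
      rw [map_mul, ← hΦ, AdjoinRoot.mk_self, zero_mul] at h
      simpa [sub_eq_zero] using h.symm
    rw [hz, map_sub, map_one, sub_pow_char_pow, ← map_pow, hroot]
    simp
  refine ⟨z, le_antisymm ?_ ?_⟩
  · intro a ha
    obtain ⟨f, rfl⟩ := AdjoinRoot.mk_surjective a
    obtain ⟨b, hb⟩ := hmk f
    have h1 : f.eval 1 ∈ P.comap (algebraMap R (AdjoinRoot Φ)) := by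
      rw [Ideal.mem_comap]
      have : algebraMap R (AdjoinRoot Φ) (f.eval 1) = AdjoinRoot.mk Φ f - z * b := by
        rw [hb]; ring
      rw [this]
      exact P.sub_mem ha (P.mul_mem_right _ hzP)
    rw [hmax, hR, Ideal.mem_span_singleton] at h1
    obtain ⟨c, hc⟩ := h1
    obtain ⟨d, hd⟩ := hpz
    refine Ideal.mem_span_singleton.2 ⟨d * algebraMap R _ c + b, ?_⟩
    rw [hb, hc, map_mul, map_natCast, hd]
    ring
  · exact (Ideal.span_singleton_le_iff_mem _).2 hzP

end Cyclotomic

/-! ### Traces of linear maps over a polynomial ring -/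

section RelativeTrace

open Polynomial

theorem Finset.sum_range_succ_eq_sum_range {M : Type*} [AddCommGroup M] (g : ℕ → M) (q : ℕ)
    (h : g q = g 0) : ∑ k ∈ Finset.range q, g (k + 1) = ∑ k ∈ Finset.range q, g k := by
  have h1 := Finset.sum_range_succ g q
  rw [Finset.sum_range_succ', h] at h1
  exact add_right_cancel h1

variable {R : Type u} [CommRing R]
  {L : Type*} [AddCommGroup L] [Module R L] [Module R[X] L] [IsScalarTower R R[X] L]
  {N : Type*} [AddCommGroup N] [Module R N] [Module R[X] N] [IsScalarTower R R[X] N]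
  {N' : Type*} [AddCommGroup N'] [Module R N'] [Module R[X] N'] [IsScalarTower R R[X] N']

/-- An `R`-linear map that commutes with the action of `X` is `R[X]`-linear. -/
def LinearMap.ofCommuteX (f : L →ₗ[R] N) (h : ∀ x, f ((X : R[X]) • x) = (X : R[X]) • f x) :
    L →ₗ[R[X]] N where
  toFun := f
  map_add' := f.map_add
  map_smul' a x := by
    induction a using Polynomial.induction_on' generalizing x with
    | add a b ha hb => simp only [add_smul, map_add, RingHom.id_apply] at *; rw [ha, hb]
    | monomial n r =>
      rw [← C_mul_X_pow_eq_monomial, RingHom.id_apply, mul_smul, mul_smul, ← algebraMap_eq,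
        algebraMap_smul, algebraMap_smul, map_smul]
      congr 1
      induction n generalizing x with
      | zero => simp
      | succ n ih => rw [pow_succ, mul_smul, ih, h, ← mul_smul]

@[simp]
theorem LinearMap.ofCommuteX_apply (f : L →ₗ[R] N)
    (h : ∀ x, f ((X : R[X]) • x) = (X : R[X]) • f x) (x : L) :
    LinearMap.ofCommuteX f h x = f x := rfl

/-- The trace `∑ k < q, X ^ k ∘ ψ ∘ X ^ (-k)` of an `R`-linear map `ψ`, where `X ^ q` acts
trivially on the source and on the image of `ψ`. -/
noncomputable def relTrace (q : ℕ) (ψ : L →ₗ[R] N) (hL : ∀ x : L, (X : R[X]) ^ q • x = x)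
    (hN : ∀ x, (X : R[X]) ^ q • ψ x = ψ x) : L →ₗ[R[X]] N :=
  LinearMap.ofCommuteX
    (∑ k ∈ Finset.range q, (Algebra.lsmul R R N ((X : R[X]) ^ k)) ∘ₗ ψ ∘ₗ
      (Algebra.lsmul R R L ((X : R[X]) ^ (q - k)))) (by
    intro x
    simp only [LinearMap.coe_sum, Finset.sum_apply, LinearMap.comp_apply, Algebra.lsmul_coe,
      Finset.smul_sum]
    rw [← Finset.sum_range_succ_eq_sum_range
      (fun k => (X : R[X]) ^ k • ψ ((X : R[X]) ^ (q - k) • (X : R[X]) • x))]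
    · refine Finset.sum_congr rfl fun k hk => ?_
      have hk' := Finset.mem_range.1 hk
      rw [← mul_smul, ← mul_smul, ← pow_succ, ← pow_succ',
        show q - (k + 1) + 1 = q - k by omega]
    · simp [hL, hN])

theorem relTrace_apply (q : ℕ) (ψ : L →ₗ[R] N) (hL : ∀ x : L, (X : R[X]) ^ q • x = x)
    (hN : ∀ x, (X : R[X]) ^ q • ψ x = ψ x) (x : L) :
    relTrace q ψ hL hN x =
      ∑ k ∈ Finset.range q, (X : R[X]) ^ k • ψ ((X : R[X]) ^ (q - k) • x) := by
  simp only [relTrace, LinearMap.ofCommuteX_apply, LinearMap.coe_sum, Finset.sum_apply,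
    LinearMap.comp_apply, Algebra.lsmul_coe]

end RelativeTrace

/-! ### Lattices over the ring generated by a root of unity -/

section CyclotomicTrace

open Polynomial TensorProduct

variable {R : Type u} [CommRing R]

theorem sum_dvd_mul_pow {A : Type*} [CommRing A] [Module R A] (q : ℕ) (hq : 0 < q) (z : A)
    (hz : z ^ q = 1) (n : ℕ) :
    ∑ k ∈ Finset.range q, (if q ∣ q - k + n then (1 : R) else 0) • z ^ k = z ^ n := by
  rw [Finset.sum_eq_single (n % q)]
  · have h1 : q ∣ q - n % q + n := by
      have h := Nat.mod_lt n hq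
      have h2 := Nat.mod_add_div n q
      refine ⟨1 + n / q, ?_⟩
      rw [mul_add, mul_one]
      omega
    rw [if_pos h1, one_smul]
    conv_rhs => rw [← Nat.mod_add_div n q, pow_add, pow_mul, hz, one_pow, mul_one]
  · intro k hk hkn
    have hk' := Finset.mem_range.1 hk
    rw [if_neg, zero_smul]
    rintro ⟨c, hc⟩
    apply hkn
    have hn : n + q = k + q * c := by omega
    have := congrArg (· % q) hn
    simpa [Nat.mod_eq_of_lt hk'] using this.symm
  · intro h
    exact absurd (Finset.mem_range.2 (Nat.mod_lt n hq)) h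

/-- The linear form on `R[X]` sending `X ^ j` to `[q ∣ j + s] - [q ∣ j]`. -/
noncomputable def cyclicForm (R : Type u) [CommRing R] (q s : ℕ) : R[X] →ₗ[R] R :=
  (Polynomial.basisMonomials R).constr R fun j =>
    (if q ∣ j + s then (1 : R) else 0) - (if q ∣ j then (1 : R) else 0)

theorem cyclicForm_X_pow (q s j : ℕ) : cyclicForm R q s (X ^ j) =
    (if q ∣ j + s then (1 : R) else 0) - (if q ∣ j then (1 : R) else 0) := by
  have := (Polynomial.basisMonomials R).constr_basis R (fun j =>
    (if q ∣ j + s then (1 : R) else 0) - (if q ∣ j then (1 : R) else 0)) j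
  rwa [coe_basisMonomials, show (fun s => (monomial s) (1 : R)) j = X ^ j from
    monomial_one_right_eq_X_pow j] at this

theorem cyclicForm_cyclotomic_mul {p : ℕ} (hp : p.Prime) (m : ℕ) (g : R[X]) :
    cyclicForm R (p ^ (m + 1)) (p ^ m) (cyclotomic (p ^ (m + 1)) R * g) = 0 := by
  induction g using Polynomial.induction_on' with
  | add a b ha hb => rw [mul_add, map_add, ha, hb, add_zero]
  | monomial j r =>
    rw [← C_mul_X_pow_eq_monomial, mul_left_comm, ← smul_eq_C_mul, map_smul,
      cyclotomic_prime_pow_eq_geom_sum hp, Finset.sum_mul, map_sum]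
    simp only [← pow_mul, ← pow_add, cyclicForm_X_pow]
    have h := Finset.sum_range_sub
      (fun i => if p ^ (m + 1) ∣ p ^ m * i + j then (1 : R) else 0) p
    have h2 : ∀ i, p ^ m * (i + 1) + j = p ^ m * i + j + p ^ m := fun i => by ring
    simp only [h2] at h
    rw [h, ← pow_succ]
    simp

variable [IsDomain R] [IsDiscreteValuationRing R] [CharZero R] {p : ℕ}
  {V : Type*} [AddCommGroup V] [Module R V] [Module.Free R V]

/-- A free `R`-module on which a primitive `p ^ (m + 1)`-th root of unity `ζ` acts has an `R`-linear
endomorphism whose trace under the action of `ζ` is `ζ ^ (p ^ m) - 1`. Such an endomorphism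
is visible on a free `R[ζ]`-module, and the module is free over the principal ideal domain `R[ζ]`
because `x ↦ ∑ ζ ^ k ⊗ ζ ^ (-k) x` embeds it into `R[ζ] ⊗ V`. -/
theorem exists_trace_eq_pow_sub_one (hp : p.Prime)
    (hR : IsLocalRing.maximalIdeal R = Ideal.span {(p : R)}) (m : ℕ) (s : Module.End R V)
    (hs : aeval s (cyclotomic (p ^ (m + 1)) R) = 0) :
    ∃ χ : V →ₗ[R] V, ∀ x, ∑ k ∈ Finset.range (p ^ (m + 1)),
      (s ^ k) (χ ((s ^ (p ^ (m + 1) - k)) x)) = (s ^ p ^ m) x - x := by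
  set Φ := cyclotomic (p ^ (m + 1)) R with hΦ
  set q := p ^ (m + 1) with hq
  have : Fact p.Prime := ⟨hp⟩
  have hq0 : 0 < q := pow_pos hp.pos _
  have hmon : Φ.Monic := cyclotomic.monic q R
  have := isDomain_adjoinRoot_cyclotomic hp hR m
  have := isPrincipalIdealRing_adjoinRoot_cyclotomic hp hR m
  rw [← hq, ← hΦ] at this
  let toEnd : AdjoinRoot Φ →ₐ[R] Module.End R V :=
    Ideal.Quotient.liftₐ (Ideal.span {Φ}) (aeval s) fun a ha => by
      obtain ⟨b, rfl⟩ := Ideal.mem_span_singleton.1 ha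
      rw [map_mul, hs, zero_mul]
  let : Module (AdjoinRoot Φ) V := Module.compHom V toEnd.toRingHom
  have hsm : ∀ (a : AdjoinRoot Φ) (x : V), a • x = toEnd a x := fun _ _ => rfl
  have : IsScalarTower R (AdjoinRoot Φ) V := ⟨fun r a x => by simp [hsm]⟩
  set z := AdjoinRoot.root Φ with hzdef
  have hzk : ∀ (k : ℕ) (x : V), z ^ k • x = (s ^ k) x := by
    intro k x
    have h : toEnd z = s := by
      change aeval s X = s
      rw [aeval_X]
    rw [hsm, map_pow, h]
  have hz : z ^ q = 1 := by
    have h := congrArg (AdjoinRoot.mk Φ) (cyclotomic_prime_pow_mul_X_pow_sub_one R p m)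
    rw [map_mul, ← hq, ← hΦ, AdjoinRoot.mk_self, zero_mul] at h
    simpa [sub_eq_zero] using h.symm
  let μ : AdjoinRoot Φ ⊗[R] V →ₗ[AdjoinRoot Φ] V := LinearMap.liftBaseChange _ LinearMap.id
  have hμ : ∀ (a : AdjoinRoot Φ) (x : V), μ (a ⊗ₜ x) = a • x := fun a x => by simp [μ]
  -- the embedding into a free `R[ζ]`-module
  let jfun : V →ₗ[R] AdjoinRoot Φ ⊗[R] V :=
    ∑ k ∈ Finset.range q, (TensorProduct.mk R (AdjoinRoot Φ) V (z ^ k)) ∘ₗ (s ^ (q - k))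
  have hjfun : ∀ x, jfun x = ∑ k ∈ Finset.range q, (z ^ k) ⊗ₜ[R] (z ^ (q - k) • x) := by
    intro x; simp [jfun, hzk]
  have hjz : ∀ x, jfun (z • x) = z • jfun x := by
    intro x
    rw [hjfun, hjfun, Finset.smul_sum, ← Finset.sum_range_succ_eq_sum_range
      (fun k => (z ^ k) ⊗ₜ[R] (z ^ (q - k) • z • x))]
    · refine Finset.sum_congr rfl fun k hk => ?_
      have hk' := Finset.mem_range.1 hk
      rw [TensorProduct.smul_tmul', smul_eq_mul, ← mul_smul, ← pow_succ, ← pow_succ',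
        show q - (k + 1) + 1 = q - k by omega]
    · simp [hz]
  have hjz' : ∀ (a : AdjoinRoot Φ) (x : V), jfun (a • x) = a • jfun x := by
    intro a x
    induction a using AdjoinRoot.induction_on with
    | _ f =>
      induction f using Polynomial.induction_on' generalizing x with
      | add a b ha hb => rw [map_add, add_smul, map_add, ha, hb, add_smul]
      | monomial n r =>
        rw [← C_mul_X_pow_eq_monomial, map_mul, map_pow, AdjoinRoot.mk_X, AdjoinRoot.mk_C,
          ← AdjoinRoot.algebraMap_eq, mul_smul, mul_smul, algebraMap_smul, algebraMap_smul,
          map_smul]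
        congr 1
        induction n generalizing x with
        | zero => simp
        | succ n ih => rw [pow_succ, mul_smul, ih, hjz, ← mul_smul]
  let j : V →ₗ[AdjoinRoot Φ] AdjoinRoot Φ ⊗[R] V :=
    { toFun := jfun, map_add' := jfun.map_add, map_smul' := hjz' }
  have hμj : ∀ x, μ (j x) = (q : R) • x := by
    intro x
    change μ (jfun x) = _
    rw [hjfun, map_sum, Finset.sum_congr rfl (g := fun _ => x), Finset.sum_const,
      Finset.card_range, Nat.cast_smul_eq_nsmul]
    intro k hk
    have hk' := Finset.mem_range.1 hk
    rw [hμ, ← mul_smul, ← pow_add, show k + (q - k) = q by omega, hz, one_smul]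
  have hj : Function.Injective j := by
    rw [injective_iff_map_eq_zero]
    intro x hx
    have h := hμj x
    rw [hx, map_zero] at h
    exact (smul_eq_zero.1 h.symm).resolve_left (Nat.cast_ne_zero.2 hq0.ne')
  have hfree : Module.Free (AdjoinRoot Φ) V := Module.Free.of_injective_of_projective j hj
  obtain ⟨i, hi⟩ := Module.projective_lifting_property μ (LinearMap.id : V →ₗ[AdjoinRoot Φ] V)
    (fun x => ⟨1 ⊗ₜ x, by rw [hμ, one_smul]⟩)
  -- the linear form `R[ζ] → R` with trace `ζ ^ (p ^ m) - 1`
  let c : AdjoinRoot Φ →ₗ[R] R := cyclicForm R q (p ^ m) ∘ₗ AdjoinRoot.modByMonicHom hmon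
  have hc : ∀ f : R[X], c (AdjoinRoot.mk Φ f) = cyclicForm R q (p ^ m) f := by
    intro f
    have h : cyclicForm R q (p ^ m) (Φ * (f /ₘ Φ)) = 0 := cyclicForm_cyclotomic_mul hp m _
    rw [LinearMap.comp_apply, AdjoinRoot.modByMonicHom_mk, modByMonic_eq_sub_mul_div,
      map_sub, h, sub_zero]
  have hctr : ∀ a : AdjoinRoot Φ,
      ∑ k ∈ Finset.range q, c (z ^ (q - k) * a) • z ^ k = z ^ p ^ m * a - a := by
    intro a
    induction a using AdjoinRoot.induction_on with
    | _ f =>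
      induction f using Polynomial.induction_on' with
      | add a b ha hb =>
        simp only [map_add, mul_add, add_smul, Finset.sum_add_distrib]
        rw [ha, hb]; ring
      | monomial n r =>
        have h1 : ∀ k, c (z ^ (q - k) * AdjoinRoot.mk Φ (C r * X ^ n)) =
            r * ((if q ∣ q - k + (n + p ^ m) then (1 : R) else 0) -
              (if q ∣ q - k + n then (1 : R) else 0)) := by
          intro k
          rw [hzdef, ← AdjoinRoot.mk_X, ← map_pow, ← map_mul, hc, mul_left_comm, ← pow_add,
            ← smul_eq_C_mul, map_smul, cyclicForm_X_pow, smul_eq_mul, add_assoc]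
        simp only [← C_mul_X_pow_eq_monomial, h1, mul_smul, sub_smul, smul_sub,
          Finset.sum_sub_distrib, ← Finset.smul_sum]
        rw [sum_dvd_mul_pow q hq0 z hz, sum_dvd_mul_pow q hq0 z hz, map_mul, map_pow,
          AdjoinRoot.mk_X, AdjoinRoot.mk_C, ← AdjoinRoot.algebraMap_eq, Algebra.smul_def,
          Algebra.smul_def]
        ring
  let c1 : AdjoinRoot Φ ⊗[R] V →ₗ[R] V := (TensorProduct.lid R V).toLinearMap ∘ₗ c.rTensor V
  have hc1 : ∀ t : AdjoinRoot Φ ⊗[R] V,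
      ∑ k ∈ Finset.range q, z ^ k • c1 (z ^ (q - k) • t) = z ^ p ^ m • μ t - μ t := by
    intro t
    induction t using TensorProduct.induction_on with
    | zero => simp
    | add a b ha hb =>
      simp only [map_add, smul_add, Finset.sum_add_distrib]
      rw [ha, hb]; abel
    | tmul a x =>
      rw [hμ, ← mul_smul, ← sub_smul, ← hctr, Finset.sum_smul]
      refine Finset.sum_congr rfl fun k _ => ?_
      rw [TensorProduct.smul_tmul', smul_eq_mul, smul_assoc]
      simp only [c1, LinearMap.comp_apply, LinearEquiv.coe_coe, LinearMap.rTensor_tmul,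
        TensorProduct.lid_tmul]
      rw [smul_comm]
  refine ⟨c1 ∘ₗ i.restrictScalars R, fun x => ?_⟩
  have h := hc1 (i x)
  have hix : μ (i x) = x := LinearMap.congr_fun hi x
  rw [hix] at h
  simp only [← hzk]
  rw [← h]
  refine Finset.sum_congr rfl fun k _ => ?_
  simp

end CyclotomicTrace

/-! ### Coflasque lattices over cyclic `p`-groups -/

section Coflasque

open Polynomial

/-- The norm polynomial `∑ X ^ (p ^ j * i)`, `i < p ^ (m - j)`, of the subgroup generated by
`X ^ (p ^ j)` in the cyclic group of order `p ^ m` generated by `X`. -/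
noncomputable def normPoly (R : Type u) [CommRing R] (p m j : ℕ) : R[X] :=
  ∑ i ∈ Finset.range (p ^ (m - j)), (X ^ p ^ j) ^ i

/-- An `R[X]`-module, on which `X` acts as an automorphism of order dividing `p ^ m`, is coflasque
if the first cohomology groups of the subgroups generated by the `X ^ (p ^ j)` vanish. -/
def IsCoflasque (R : Type u) [CommRing R] (p m : ℕ) (L : Type w) [AddCommGroup L]
    [Module R[X] L] : Prop :=
  ∀ j ≤ m, ∀ x : L, normPoly R p m j • x = 0 → ∃ y : L, ((X : R[X]) ^ p ^ j - 1) • y = x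

/-- `L` is projective relative to the homomorphisms that are surjective on the elements fixed by
`X ^ (p ^ j)`, for every `j`. Permutation modules and their direct summands have this property. -/
def IsFixedProjective (R : Type u) [CommRing R] (p : ℕ) (L : Type w) [AddCommGroup L]
    [Module R[X] L] : Prop :=
  ∀ (E Y : Type w) [AddCommGroup E] [Module R E] [Module R[X] E] [IsScalarTower R R[X] E]
    [AddCommGroup Y] [Module R Y] [Module R[X] Y] [IsScalarTower R R[X] Y]
    (f : E →ₗ[R[X]] Y) (g : L →ₗ[R[X]] Y),
    (∀ j, ∀ y : Y, (X : R[X]) ^ p ^ j • y = y → ∃ e : E, (X : R[X]) ^ p ^ j • e = e ∧ f e = y) →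
    ∃ h : L →ₗ[R[X]] E, f ∘ₗ h = g

theorem normPoly_mul {R : Type u} [CommRing R] {p m j : ℕ} (hj : j ≤ m) :
    normPoly R p m j * (X ^ p ^ j - 1) = X ^ p ^ m - 1 := by
  rw [normPoly, geom_sum_mul, ← pow_mul, ← pow_add, Nat.add_sub_of_le hj]

theorem normPoly_succ_self {R : Type u} [CommRing R] {p : ℕ} (hp : p.Prime) (m : ℕ) :
    normPoly R p (m + 1) m = cyclotomic (p ^ (m + 1)) R := by
  rw [normPoly, cyclotomic_prime_pow_eq_geom_sum hp]
  simp

theorem X_pow_sub_one_ne_zero' {R : Type u} [CommRing R] [Nontrivial R] {n : ℕ} (hn : 0 < n) :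
    (X ^ n - 1 : R[X]) ≠ 0 := by
  simpa using X_pow_sub_C_ne_zero (R := R) hn 1

theorem normPoly_succ {R : Type u} [CommRing R] [IsDomain R] {p m j : ℕ} (hp : p.Prime)
    (hj : j ≤ m) :
    normPoly R p (m + 1) j = cyclotomic (p ^ (m + 1)) R * normPoly R p m j := by
  have h0 : (X ^ p ^ j - 1 : R[X]) ≠ 0 := X_pow_sub_one_ne_zero' (pow_pos hp.pos _)
  apply mul_right_cancel₀ h0
  have : Fact p.Prime := ⟨hp⟩
  rw [normPoly_mul (hj.trans m.le_succ), mul_assoc, normPoly_mul hj,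
    cyclotomic_prime_pow_mul_X_pow_sub_one]

/-- An `R`-linear map from a free module into elements fixed by `X ^ (p ^ j)` lifts to an
`R`-linear map into elements fixed by `X ^ (p ^ j)`. -/
theorem exists_linear_lift_of_fixed {R : Type u} [CommRing R] {n : ℕ}
    {L E Y : Type*} [AddCommGroup L] [Module R L] [Module.Projective R L]
    [AddCommGroup E] [Module R E] [Module R[X] E] [IsScalarTower R R[X] E]
    [AddCommGroup Y] [Module R Y] [Module R[X] Y] [IsScalarTower R R[X] Y]
    (f : E →ₗ[R[X]] Y) (g : L →ₗ[R] Y) (hg : ∀ x, (X : R[X]) ^ n • g x = g x)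
    (hf : ∀ y : Y, (X : R[X]) ^ n • y = y → ∃ e : E, (X : R[X]) ^ n • e = e ∧ f e = y) :
    ∃ h : L →ₗ[R] E, (∀ x, f (h x) = g x) ∧ ∀ x, (X : R[X]) ^ n • h x = h x := by
  let E' : Submodule R E :=
    LinearMap.ker ((Algebra.lsmul R R E ((X : R[X]) ^ n) : E →ₗ[R] E) - LinearMap.id)
  let Y' : Submodule R Y :=
    LinearMap.ker ((Algebra.lsmul R R Y ((X : R[X]) ^ n) : Y →ₗ[R] Y) - LinearMap.id)
  have hE' : ∀ e, e ∈ E' ↔ (X : R[X]) ^ n • e = e := fun e => by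
    simp only [E', LinearMap.mem_ker, LinearMap.sub_apply, Algebra.lsmul_coe, LinearMap.id_apply,
      sub_eq_zero]
  have hY' : ∀ e, e ∈ Y' ↔ (X : R[X]) ^ n • e = e := fun e => by
    simp only [Y', LinearMap.mem_ker, LinearMap.sub_apply, Algebra.lsmul_coe, LinearMap.id_apply,
      sub_eq_zero]
  let f' : E' →ₗ[R] Y' := (f.restrictScalars R).restrict fun e he => by
    rw [hE'] at he
    rw [hY', LinearMap.restrictScalars_apply, ← map_smul, he]
  have hf' : Function.Surjective f' := by
    rintro ⟨y, hy⟩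
    obtain ⟨e, he, rfl⟩ := hf y ((hY' y).1 hy)
    exact ⟨⟨e, (hE' e).2 he⟩, rfl⟩
  let g' : L →ₗ[R] Y' := g.codRestrict Y' fun x => (hY' _).2 (hg x)
  obtain ⟨h, hh⟩ := Module.projective_lifting_property f' g' hf'
  refine ⟨E'.subtype ∘ₗ h, fun x => ?_, fun x => (hE' _).1 (h x).2⟩
  exact congrArg Subtype.val (LinearMap.congr_fun hh x)

variable {R : Type u} [CommRing R] [IsDomain R] [IsDiscreteValuationRing R] [CharZero R]
  {p : ℕ}

/-- An `R`-free coflasque module over a cyclic `p`-group is projective relative to homomorphisms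
that are surjective on fixed points, when `p` is a uniformizer of `R`. By induction on the order,
the claim holds for the quotient `L / L'` by the kernel `L'` of the norm of the subgroup of order
`p`. The identity of `L` is the sum of a map that factors through `L / L'` and of the trace of an
`R`-linear map `ψ`; the latter comes from an endomorphism of `L'` with trace `X ^ (p ^ m) - 1`,
composed with an `R`-linear section of `X ^ (p ^ m) - 1 : L → L'`. -/
theorem IsCoflasque.isFixedProjective (hp : p.Prime)
    (hR : IsLocalRing.maximalIdeal R = Ideal.span {(p : R)}) (m : ℕ)
    (L : Type w) [AddCommGroup L] [Module R L] [Module R[X] L] [IsScalarTower R R[X] L]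
    [Module.Free R L] (hL : ∀ x : L, (X : R[X]) ^ p ^ m • x = x) (hc : IsCoflasque R p m L) :
    IsFixedProjective R p L := by
  induction m generalizing L with
  | zero =>
    intro E Y _ _ _ _ _ _ _ _ f g hf
    obtain ⟨h, hfh, hh⟩ := exists_linear_lift_of_fixed f (g.restrictScalars R)
      (fun x => by rw [LinearMap.restrictScalars_apply, ← map_smul, hL]) (hf 0)
    refine ⟨LinearMap.ofCommuteX h fun x => ?_, LinearMap.ext hfh⟩
    have h1 := hL x
    have h2 := hh x
    rw [pow_zero, pow_one] at h1 h2
    rw [h1, h2]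
  | succ m ih =>
    have : Fact p.Prime := ⟨hp⟩
    set Φ := cyclotomic (p ^ (m + 1)) R with hΦ
    set q := p ^ (m + 1) with hq
    have hΦX : Φ * (X ^ p ^ m - 1) = X ^ q - 1 := cyclotomic_prime_pow_mul_X_pow_sub_one R p m
    have hLq : ∀ x : L, (X ^ q - 1 : R[X]) • x = 0 := fun x => by
      rw [sub_smul, hL, one_smul, sub_self]
    let L' : Submodule R[X] L := Submodule.torsionBy R[X] L Φ
    have hL' : ∀ x, x ∈ L' ↔ Φ • x = 0 := fun x => Submodule.mem_torsionBy_iff _ _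
    -- the quotient `L / L'` is isomorphic to `Φ L`
    let ν : (L ⧸ L') →ₗ[R[X]] L := L'.liftQ (LinearMap.lsmul R[X] L Φ) fun x hx => (hL' x).1 hx
    have hν : Function.Injective ν := by
      refine LinearMap.ker_eq_bot.1 (Submodule.ker_liftQ_eq_bot _ _ _ fun x hx => (hL' x).2 hx)
    have hMfree : Module.Free R (L ⧸ L') :=
      Module.Free.of_injective_of_projective (ν.restrictScalars R) hν
    have hL'free : Module.Free R L' :=
      Module.Free.of_injective_of_projective (L'.subtype.restrictScalars R) Subtype.val_injective
    have hMX : ∀ x : L ⧸ L', (X : R[X]) ^ p ^ m • x = x := by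
      intro x
      obtain ⟨x, rfl⟩ := Submodule.Quotient.mk_surjective _ x
      rw [← Submodule.Quotient.mk_smul, Submodule.Quotient.eq, hL']
      have h : (X : R[X]) ^ p ^ m • x - x = (X ^ p ^ m - 1 : R[X]) • x := by
        rw [sub_smul, one_smul]
      rw [h, ← mul_smul, hΦX, hLq]
    have hMc : IsCoflasque R p m (L ⧸ L') := by
      intro j hj x hx
      obtain ⟨x, rfl⟩ := Submodule.Quotient.mk_surjective _ x
      rw [← Submodule.Quotient.mk_smul, Submodule.Quotient.mk_eq_zero, hL', ← mul_smul,
        ← normPoly_succ hp hj] at hx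
      obtain ⟨y, hy⟩ := hc j (hj.trans m.le_succ) x hx
      exact ⟨Submodule.Quotient.mk y, by rw [← Submodule.Quotient.mk_smul, hy]⟩
    have hM := ih (L ⧸ L') hMX hMc
    -- an endomorphism of `L'` with trace `X ^ (p ^ m) - 1`
    let s : Module.End R L' := Algebra.lsmul R R L' (X : R[X])
    have hsf : ∀ f : R[X], aeval s f = Algebra.lsmul R R L' f := fun f => by
      rw [aeval_algHom_apply, aeval_X_left_apply]
    have hsk : ∀ (k : ℕ) (x : L'), (s ^ k) x = (X : R[X]) ^ k • x := fun k x => by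
      rw [← map_pow]; rfl
    obtain ⟨χ, hχ⟩ := exists_trace_eq_pow_sub_one hp hR m s (by
      rw [hsf]
      ext x
      exact (hL' x).1 x.2)
    simp only [hsk] at hχ
    -- an `R`-linear section `ω` of `X ^ (p ^ m) - 1 : L → L'`
    let β : L →ₗ[R] L' := (Algebra.lsmul R R L (X ^ p ^ m - 1 : R[X]) : L →ₗ[R] L).codRestrict
      (L'.restrictScalars R) fun x => (hL' _).2 (by
        rw [Algebra.lsmul_coe, ← mul_smul, hΦX, hLq])
    have hβ : Function.Surjective β := by
      intro x
      obtain ⟨y, hy⟩ := hc m m.le_succ x (by rw [normPoly_succ_self hp]; exact (hL' x).1 x.2)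
      exact ⟨y, Subtype.ext hy⟩
    obtain ⟨ω, hω⟩ := Module.projective_lifting_property β (LinearMap.id : L' →ₗ[R] L') hβ
    have hω' : ∀ x : L', (X ^ p ^ m - 1 : R[X]) • ω x = x := fun x =>
      congrArg Subtype.val (LinearMap.congr_fun hω x)
    -- an `R`-linear projection `π : L → L'`
    obtain ⟨t, ht⟩ := Module.projective_lifting_property (L'.mkQ.restrictScalars R)
      (LinearMap.id : (L ⧸ L') →ₗ[R] (L ⧸ L')) L'.mkQ_surjective
    let π : L →ₗ[R] L' := (LinearMap.id - t ∘ₗ (L'.mkQ.restrictScalars R)).codRestrict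
      (L'.restrictScalars R) fun x => by
        have h : L'.mkQ (t (L'.mkQ x)) = L'.mkQ x := LinearMap.congr_fun ht (L'.mkQ x)
        rw [Submodule.restrictScalars_mem, ← Submodule.Quotient.mk_eq_zero, ← Submodule.mkQ_apply]
        simp only [LinearMap.sub_apply, LinearMap.id_apply, LinearMap.comp_apply,
          LinearMap.restrictScalars_apply, map_sub, h, sub_self]
    have hπ : ∀ x : L', π x = x := fun x => by
      have h : L'.mkQ (x : L) = 0 := (Submodule.Quotient.mk_eq_zero _).2 x.2
      apply Subtype.ext
      change (x : L) - t (L'.mkQ x) = x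
      rw [h, map_zero, sub_zero]
    let ψ : L →ₗ[R] L := ω ∘ₗ χ ∘ₗ π
    let T : L →ₗ[R[X]] L := relTrace q ψ hL fun x => hL _
    have hT : ∀ x : L', T x = x := by
      intro x
      have h1 : T x = ∑ k ∈ Finset.range q, (X : R[X]) ^ k • ω (χ ((X : R[X]) ^ (q - k) • x)) := by
        rw [relTrace_apply]
        refine Finset.sum_congr rfl fun k _ => ?_
        rw [LinearMap.comp_apply, LinearMap.comp_apply, ← Submodule.coe_smul, hπ]
      have h2 : (X ^ p ^ m - 1 : R[X]) • (T x - x) = 0 := by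
        rw [smul_sub, h1, Finset.smul_sum]
        simp only [smul_comm (X ^ p ^ m - 1 : R[X]) ((X : R[X]) ^ _), hω']
        have h3 := congrArg Subtype.val (hχ x)
        rw [AddSubmonoidClass.coe_finsetSum] at h3
        simp only [Submodule.coe_smul, AddSubgroupClass.coe_sub] at h3
        rw [h3, sub_smul, one_smul, sub_self]
      -- on elements fixed by `X ^ (p ^ m)` the polynomial `Φ` acts as multiplication by `p`
      have h4 : Φ • (T x - x) = (p : R) • (T x - x) := by
        have h5 : (X : R[X]) ^ p ^ m • (T x - x) = T x - x := by
          rw [sub_smul, one_smul, sub_eq_zero] at h2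
          exact h2
        have h6 : ∀ i : ℕ, ((X : R[X]) ^ p ^ m) ^ i • (T x - x) = T x - x := by
          intro i
          induction i with
          | zero => simp
          | succ i ihi => rw [pow_succ, mul_smul, h5, ihi]
        rw [hΦ, cyclotomic_prime_pow_eq_geom_sum hp, Finset.sum_smul,
          Finset.sum_congr rfl fun i _ => h6 i, Finset.sum_const, Finset.card_range,
          Nat.cast_smul_eq_nsmul]
      have h7 : Φ • (T x - x) = 0 := by
        have h8 : Φ • (x : L) = 0 := (hL' x).1 x.2
        rw [smul_sub, ← map_smul, h8, map_zero, sub_zero]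
      rw [h7] at h4
      exact sub_eq_zero.1 ((smul_eq_zero.1 h4.symm).resolve_left (Nat.cast_ne_zero.2 hp.ne_zero))
    intro E Y _ _ _ _ _ _ _ _ f g hf
    let φ : (L ⧸ L') →ₗ[R[X]] L := L'.liftQ (LinearMap.id - T) fun x hx => by
      rw [LinearMap.mem_ker, LinearMap.sub_apply, LinearMap.id_apply, hT ⟨x, hx⟩, sub_self]
    obtain ⟨h₁, hh₁⟩ := hM E Y f (g ∘ₗ φ) hf
    obtain ⟨h₂, hfh₂, hh₂⟩ := exists_linear_lift_of_fixed f (g.restrictScalars R ∘ₗ ψ)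
      (fun x => by
        rw [LinearMap.comp_apply, LinearMap.restrictScalars_apply, ← map_smul, hL]) (hf (m + 1))
    refine ⟨h₁ ∘ₗ L'.mkQ + relTrace q h₂ hL hh₂, LinearMap.ext fun x => ?_⟩
    have e1 : f (h₁ (L'.mkQ x)) = g (x - T x) := LinearMap.congr_fun hh₁ (L'.mkQ x)
    have e2 : f (relTrace q h₂ hL hh₂ x) = g (T x) := by
      rw [relTrace_apply, map_sum, relTrace_apply, map_sum]
      refine Finset.sum_congr rfl fun k _ => ?_
      rw [map_smul, hfh₂, LinearMap.comp_apply, LinearMap.restrictScalars_apply, ← map_smul]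
    rw [LinearMap.comp_apply, LinearMap.add_apply, map_add, LinearMap.comp_apply, e1, e2,
      ← map_add, sub_add_cancel]

end Coflasque

/-! ### Constructions with cohomological Mackey functors -/

namespace CohMackey

variable {R : Type u} {G : Type v} [CommRing R] [Group G]

section Hom

variable {X Y Z : CohMackey.{w} R G}

theorem component_res (φ : X ⟶ Y) {U V : Subgroup G} (h : V ≤ U) (x : X.obj U) :
    component φ V (X.res h x) = Y.res h (component φ U x) :=
  LinearMap.congr_fun (Hom.app_res φ h) x

theorem component_tr (φ : X ⟶ Y) {U V : Subgroup G} (h : V ≤ U) (x : X.obj V) :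
    component φ U (X.tr h x) = Y.tr h (component φ V x) :=
  LinearMap.congr_fun (Hom.app_tr φ h) x

theorem component_conj (φ : X ⟶ Y) (g : G) (U U' : Subgroup G) (h : U' = conjSubgroup g U)
    (x : X.obj U) : component φ U' (X.conj g U U' h x) = Y.conj g U U' h (component φ U x) :=
  LinearMap.congr_fun (Hom.app_conj φ g U U' h) x

theorem component_comp (φ : X ⟶ Y) (ψ : Y ⟶ Z) (U : Subgroup G) (x : X.obj U) :
    component (φ ≫ ψ) U x = component ψ U (component φ U x) := rfl

theorem component_id (U : Subgroup G) (x : X.obj U) : component (𝟙 X) U x = x := rfl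

theorem hom_ext {φ ψ : X ⟶ Y} (h : ∀ U x, component φ U x = component ψ U x) : φ = ψ :=
  Hom.ext (funext fun U => LinearMap.ext (h U))

/-- A homomorphism given by a family of linear maps. -/
def homMk (app : ∀ U : Subgroup G, X.obj U →ₗ[R] Y.obj U)
    (h_res : ∀ {U V : Subgroup G} (h : V ≤ U) (x : X.obj U),
      app V (X.res h x) = Y.res h (app U x))
    (h_tr : ∀ {U V : Subgroup G} (h : V ≤ U) (x : X.obj V), app U (X.tr h x) = Y.tr h (app V x))
    (h_conj : ∀ (g : G) (U U' : Subgroup G) (h : U' = conjSubgroup g U) (x : X.obj U),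
      app U' (X.conj g U U' h x) = Y.conj g U U' h (app U x)) : X ⟶ Y :=
  Hom.mk app (fun h => LinearMap.ext (h_res h)) (fun h => LinearMap.ext (h_tr h))
    (fun g U U' h => LinearMap.ext (h_conj g U U' h))

@[simp]
theorem component_homMk (app : ∀ U : Subgroup G, X.obj U →ₗ[R] Y.obj U) (h_res) (h_tr) (h_conj)
    (U : Subgroup G) : component (homMk (X := X) (Y := Y) app h_res h_tr h_conj) U = app U := rfl

variable (X)

theorem res_self_apply {U : Subgroup G} (h : U ≤ U) (x : X.obj U) : X.res h x = x :=
  LinearMap.congr_fun (X.res_self U h) x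

theorem tr_self_apply {U : Subgroup G} (h : U ≤ U) (x : X.obj U) : X.tr h x = x :=
  LinearMap.congr_fun (X.tr_self U h) x

theorem res_res_apply {U V W : Subgroup G} (hWV : W ≤ V) (hVU : V ≤ U) (x : X.obj U) :
    X.res hWV (X.res hVU x) = X.res (hWV.trans hVU) x :=
  LinearMap.congr_fun (X.res_res hWV hVU) x

theorem tr_tr_apply {U V W : Subgroup G} (hWV : W ≤ V) (hVU : V ≤ U) (x : X.obj W) :
    X.tr hVU (X.tr hWV x) = X.tr (hWV.trans hVU) x :=
  LinearMap.congr_fun (X.tr_tr hWV hVU) x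

theorem tr_res_apply {U V : Subgroup G} (hV : V ≤ U) (x : X.obj U) :
    X.tr hV (X.res hV x) = V.relIndex U • x :=
  LinearMap.congr_fun (X.cohomological hV) x

end Hom

section Constructors

variable (obj : Subgroup G → Type w) [∀ U, AddCommGroup (obj U)] [∀ U, Module R (obj U)]
  (res : ∀ {U V : Subgroup G}, V ≤ U → obj U →ₗ[R] obj V)
  (tr : ∀ {V U : Subgroup G}, V ≤ U → obj V →ₗ[R] obj U)
  (conj : ∀ (g : G) (U U' : Subgroup G), U' = conjSubgroup g U → obj U →ₗ[R] obj U')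

/-- A family of modules with restriction, transfer and conjugation maps is a cohomological Mackey
functor if it has a jointly injective family of homomorphisms into such functors. -/
def ofJointlyInjective {A : Type*} (X : A → CohMackey.{w} R G)
    (π : ∀ a U, obj U →ₗ[R] (X a).obj U) (hπ : ∀ U x y, (∀ a, π a U x = π a U y) → x = y)
    (hres : ∀ a {U V : Subgroup G} (h : V ≤ U) x, π a V (res h x) = (X a).res h (π a U x))
    (htr : ∀ a {V U : Subgroup G} (h : V ≤ U) x, π a U (tr h x) = (X a).tr h (π a V x))
    (hconj : ∀ a g U U' h x, π a U' (conj g U U' h x) = (X a).conj g U U' h (π a U x)) :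
    CohMackey.{w} R G where
  obj := obj
  res := res
  tr := tr
  conj := conj
  res_self U h := LinearMap.ext fun x => hπ _ _ _ fun a => by
    rw [hres, (X a).res_self]; rfl
  tr_self U h := LinearMap.ext fun x => hπ _ _ _ fun a => by
    rw [htr, (X a).tr_self]; rfl
  conj_self U x hx h := LinearMap.ext fun y => hπ _ _ _ fun a => by
    rw [hconj, (X a).conj_self U x hx]; rfl
  res_res h₁ h₂ := LinearMap.ext fun x => hπ _ _ _ fun a => by
    rw [LinearMap.comp_apply, hres, hres, hres, ← (X a).res_res h₁ h₂]; rfl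
  tr_tr h₁ h₂ := LinearMap.ext fun x => hπ _ _ _ fun a => by
    rw [LinearMap.comp_apply, htr, htr, htr, ← (X a).tr_tr h₁ h₂]; rfl
  conj_conj g h U U' U'' h₁ h₂ h₃ := LinearMap.ext fun x => hπ _ _ _ fun a => by
    rw [LinearMap.comp_apply, hconj, hconj, hconj, ← (X a).conj_conj g h U U' U'' h₁ h₂ h₃]; rfl
  res_conj g U V U' V' h₁ h₂ h₃ h₄ := LinearMap.ext fun x => hπ _ _ _ fun a => by
    rw [LinearMap.comp_apply, LinearMap.comp_apply, hres, hconj, hconj, hres]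
    exact LinearMap.congr_fun ((X a).res_conj g U V U' V' h₁ h₂ h₃ h₄) _
  tr_conj g U V U' V' h₁ h₂ h₃ h₄ := LinearMap.ext fun x => hπ _ _ _ fun a => by
    rw [LinearMap.comp_apply, LinearMap.comp_apply, htr, hconj, hconj, htr]
    exact LinearMap.congr_fun ((X a).tr_conj g U V U' V' h₁ h₂ h₃ h₄) _
  mackey U V W hV hW S hS := LinearMap.ext fun x => hπ _ _ _ fun a => by
    rw [LinearMap.comp_apply, hres, htr, LinearMap.sum_apply, map_sum]
    refine (LinearMap.congr_fun ((X a).mackey U V W hV hW S hS) _).trans ?_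
    rw [LinearMap.sum_apply]
    refine Finset.sum_congr rfl fun g _ => ?_
    simp only [LinearMap.comp_apply]
    rw [htr, hconj, hres]
  cohomological hV := LinearMap.ext fun x => hπ _ _ _ fun a => by
    rw [LinearMap.comp_apply, htr, hres, ← LinearMap.comp_apply, (X a).cohomological]
    simp

/-- A family of modules with restriction, transfer and conjugation maps is a cohomological Mackey
functor if it receives a surjective homomorphism from such a functor. -/
def ofSurjective (X : CohMackey.{w} R G)
    (π : ∀ U, X.obj U →ₗ[R] obj U) (hπ : ∀ U, Function.Surjective (π U))
    (hres : ∀ {U V : Subgroup G} (h : V ≤ U) x, res h (π U x) = π V (X.res h x))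
    (htr : ∀ {V U : Subgroup G} (h : V ≤ U) x, tr h (π V x) = π U (X.tr h x))
    (hconj : ∀ g U U' h x, conj g U U' h (π U x) = π U' (X.conj g U U' h x)) :
    CohMackey.{w} R G where
  obj := obj
  res := res
  tr := tr
  conj := conj
  res_self U h := LinearMap.ext ((hπ _).forall.2 fun x => by
    rw [hres, X.res_self]; rfl)
  tr_self U h := LinearMap.ext ((hπ _).forall.2 fun x => by
    rw [htr, X.tr_self]; rfl)
  conj_self U x hx h := LinearMap.ext ((hπ _).forall.2 fun x => by
    rw [hconj, X.conj_self _ _ hx]; rfl)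
  res_res h₁ h₂ := LinearMap.ext ((hπ _).forall.2 fun x => by
    rw [LinearMap.comp_apply, hres, hres, hres, ← X.res_res h₁ h₂]; rfl)
  tr_tr h₁ h₂ := LinearMap.ext ((hπ _).forall.2 fun x => by
    rw [LinearMap.comp_apply, htr, htr, htr, ← X.tr_tr h₁ h₂]; rfl)
  conj_conj g h U U' U'' h₁ h₂ h₃ := LinearMap.ext ((hπ _).forall.2 fun x => by
    rw [LinearMap.comp_apply, hconj, hconj, hconj, ← X.conj_conj g h U U' U'' h₁ h₂ h₃]; rfl)
  res_conj g U V U' V' h₁ h₂ h₃ h₄ := LinearMap.ext ((hπ _).forall.2 fun x => by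
    rw [LinearMap.comp_apply, LinearMap.comp_apply, hconj, hres, hres, hconj]
    exact congrArg _ (LinearMap.congr_fun (X.res_conj g U V U' V' h₁ h₂ h₃ h₄) _))
  tr_conj g U V U' V' h₁ h₂ h₃ h₄ := LinearMap.ext ((hπ _).forall.2 fun x => by
    rw [LinearMap.comp_apply, LinearMap.comp_apply, hconj, htr, htr, hconj]
    exact congrArg _ (LinearMap.congr_fun (X.tr_conj g U V U' V' h₁ h₂ h₃ h₄) _))
  mackey U V W hV hW S hS := LinearMap.ext ((hπ _).forall.2 fun x => by
    rw [LinearMap.comp_apply, htr, hres, LinearMap.sum_apply]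
    refine (congrArg _ (LinearMap.congr_fun (X.mackey U V W hV hW S hS) x)).trans ?_
    rw [LinearMap.sum_apply, map_sum]
    refine Finset.sum_congr rfl fun g _ => ?_
    simp only [LinearMap.comp_apply]
    rw [hres, hconj, htr])
  cohomological hV := LinearMap.ext ((hπ _).forall.2 fun x => by
    rw [LinearMap.comp_apply, hres, htr, X.tr_res_apply]
    simp)

end Constructors

section SubQuotient

variable (X : CohMackey.{w} R G) (S : ∀ U, Submodule R (X.obj U))
  (hres : ∀ {U V : Subgroup G} (h : V ≤ U) x, x ∈ S U → X.res h x ∈ S V)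
  (htr : ∀ {U V : Subgroup G} (h : V ≤ U) x, x ∈ S V → X.tr h x ∈ S U)
  (hconj : ∀ (g : G) (U U' : Subgroup G) (h : U' = conjSubgroup g U) x, x ∈ S U →
    X.conj g U U' h x ∈ S U')

/-- The subfunctor given by a family of submodules. -/
def sub : CohMackey.{w} R G :=
  ofJointlyInjective (fun U => S U) (fun h => (X.res h).restrict (hres h))
    (fun h => (X.tr h).restrict (htr h)) (fun g U U' h => (X.conj g U U' h).restrict
      (hconj g U U' h)) (fun _ : Unit => X) (fun _ U => (S U).subtype)
    (fun _ _ _ h => Subtype.ext (h ())) (fun _ _ _ _ _ => rfl) (fun _ _ _ _ _ => rfl)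
    (fun _ _ _ _ _ _ => rfl)

/-- The inclusion of a subfunctor. -/
def subι : X.sub S hres htr hconj ⟶ X :=
  homMk (fun U => (S U).subtype) (fun _ _ => rfl) (fun _ _ => rfl) (fun _ _ _ _ _ => rfl)

theorem component_subι_injective (U : Subgroup G) :
    Function.Injective (component (X.subι S hres htr hconj) U) := Subtype.val_injective

theorem range_component_subι (U : Subgroup G) :
    LinearMap.range (component (X.subι S hres htr hconj) U) = S U := Submodule.range_subtype _

/-- The quotient of a functor by a family of submodules. -/
def quot : CohMackey.{w} R G :=
  ofSurjective (fun U => X.obj U ⧸ S U) (fun h => Submodule.mapQ _ _ (X.res h) (hres h))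
    (fun h => Submodule.mapQ _ _ (X.tr h) (htr h)) (fun g U U' h => Submodule.mapQ _ _
      (X.conj g U U' h) (hconj g U U' h)) X (fun U => (S U).mkQ)
    (fun U => (S U).mkQ_surjective) (fun _ _ => rfl) (fun _ _ => rfl) (fun _ _ _ _ _ => rfl)

/-- The projection onto a quotient functor. -/
def quotπ : X ⟶ X.quot S hres htr hconj :=
  homMk (fun U => (S U).mkQ) (fun _ _ => rfl) (fun _ _ => rfl) (fun _ _ _ _ _ => rfl)

theorem component_quotπ_surjective (U : Subgroup G) :
    Function.Surjective (component (X.quotπ S hres htr hconj) U) := (S U).mkQ_surjective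

theorem component_quotπ_eq_zero {U : Subgroup G} (x : X.obj U) :
    component (X.quotπ S hres htr hconj) U x = 0 ↔ x ∈ S U :=
  Submodule.Quotient.mk_eq_zero _

end SubQuotient

section Kernel

variable {X Y : CohMackey.{w} R G}

/-- The kernel of a homomorphism. -/
def ker (φ : X ⟶ Y) : CohMackey.{w} R G :=
  X.sub (fun U => LinearMap.ker (component φ U))
    (fun h x hx => by rw [LinearMap.mem_ker] at *; rw [component_res, hx, map_zero])
    (fun h x hx => by rw [LinearMap.mem_ker] at *; rw [component_tr, hx, map_zero])
    (fun g U U' h x hx => by rw [LinearMap.mem_ker] at *; rw [component_conj, hx, map_zero])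

/-- The inclusion of the kernel of a homomorphism. -/
def kerι (φ : X ⟶ Y) : ker φ ⟶ X :=
  homMk (fun U => (LinearMap.ker (component φ U)).subtype) (fun _ _ => rfl) (fun _ _ => rfl)
    (fun _ _ _ _ _ => rfl)

theorem component_kerι_injective (φ : X ⟶ Y) (U : Subgroup G) :
    Function.Injective (component (kerι φ) U) := Subtype.val_injective

theorem exact_kerι (φ : X ⟶ Y) (U : Subgroup G) :
    Function.Exact (component (kerι φ) U) (component φ U) :=
  (LinearMap.exact_iff).2 (Submodule.range_subtype _).symm

theorem epi_of_surjective (φ : X ⟶ Y) (h : ∀ U, Function.Surjective (component φ U)) : Epi φ where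
  left_cancellation α β hαβ := hom_ext fun U y => by
    obtain ⟨x, rfl⟩ := h U y
    rw [← component_comp, hαβ, component_comp]

/-- Epimorphisms are surjective on values: compare the projection to the cokernel with zero. -/
theorem surjective_of_epi (φ : X ⟶ Y) [Epi φ] (U : Subgroup G) :
    Function.Surjective (component φ U) := by
  let S : ∀ U, Submodule R (Y.obj U) := fun U => LinearMap.range (component φ U)
  have hres : ∀ {U V : Subgroup G} (h : V ≤ U) x, x ∈ S U → Y.res h x ∈ S V := by
    rintro U V h _ ⟨x, rfl⟩
    exact ⟨X.res h x, component_res ..⟩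
  have htr : ∀ {U V : Subgroup G} (h : V ≤ U) x, x ∈ S V → Y.tr h x ∈ S U := by
    rintro U V h _ ⟨x, rfl⟩
    exact ⟨X.tr h x, component_tr ..⟩
  have hconj : ∀ (g : G) (U U' : Subgroup G) (h : U' = conjSubgroup g U) x, x ∈ S U →
      Y.conj g U U' h x ∈ S U' := by
    rintro g U U' h _ ⟨x, rfl⟩
    exact ⟨X.conj g U U' h x, component_conj ..⟩
  let z : Y ⟶ Y.quot S hres htr hconj := homMk (fun _ => 0) (fun _ _ => by simp)
    (fun _ _ => by simp) (fun _ _ _ _ _ => by simp)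
  have h : φ ≫ Y.quotπ S hres htr hconj = φ ≫ z := hom_ext fun U x => by
    rw [component_comp, component_comp, component_homMk, LinearMap.zero_apply,
      component_quotπ_eq_zero]
    exact ⟨x, rfl⟩
  rw [cancel_epi] at h
  intro y
  have h0 : component (Y.quotπ S hres htr hconj) U y = 0 := by rw [h]; rfl
  exact (component_quotπ_eq_zero ..).1 h0

/-- A projective functor lifts along homomorphisms that are surjective on values. -/
theorem exists_lift_of_projective {P : CohMackey.{w} R G} [Projective P] (φ : X ⟶ Y)
    (h : ∀ U, Function.Surjective (component φ U)) (f : P ⟶ Y) : ∃ g : P ⟶ X, g ≫ φ = f :=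
  have := epi_of_surjective φ h
  ⟨Projective.factorThru f φ, Projective.factorThru_comp f φ⟩

end Kernel

section DirectSum

open DirectSum

variable {ι : Type w} (X : ι → CohMackey.{w} R G)

/-- The direct sum of a family of functors. -/
noncomputable def directSum : CohMackey.{w} R G := by
  classical
  exact ofJointlyInjective (fun U => ⨁ i, (X i).obj U)
    (fun h => DirectSum.lmap fun i => (X i).res h)
    (fun h => DirectSum.lmap fun i => (X i).tr h)
    (fun g U U' h => DirectSum.lmap fun i => (X i).conj g U U' h) X
    (fun i U => DirectSum.component R ι _ i)
    (fun U x y h => DFinsupp.ext h) (fun _ _ _ _ _ => rfl) (fun _ _ _ _ _ => rfl)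
    (fun _ _ _ _ _ _ => rfl)

variable [DecidableEq ι]

/-- The inclusion of a summand of a direct sum. -/
noncomputable def directSumι (i : ι) : X i ⟶ directSum X :=
  homMk (fun U => DirectSum.lof R ι (fun i => (X i).obj U) i)
    (fun h x => (DirectSum.lmap_lof (fun i => (X i).res h) i x).symm)
    (fun h x => (DirectSum.lmap_lof (fun i => (X i).tr h) i x).symm)
    (fun g U U' h x => (DirectSum.lmap_lof (fun i => (X i).conj g U U' h) i x).symm)

variable {X} {Y : CohMackey.{w} R G}

/-- The homomorphism out of a direct sum with given components. -/
noncomputable def directSumDesc (f : ∀ i, X i ⟶ Y) : directSum X ⟶ Y :=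
  homMk (fun U => DirectSum.toModule R ι (Y.obj U) fun i => CohMackey.component (f i) U)
    (fun h x => by
      refine LinearMap.congr_fun (f := DirectSum.toModule R ι _ _ ∘ₗ DirectSum.lmap _)
        (g := Y.res h ∘ₗ DirectSum.toModule R ι _ _) (DirectSum.linearMap_ext R fun i =>
          LinearMap.ext fun x => ?_) x
      simp [component_res])
    (fun h x => by
      refine LinearMap.congr_fun (f := DirectSum.toModule R ι _ _ ∘ₗ DirectSum.lmap _)
        (g := Y.tr h ∘ₗ DirectSum.toModule R ι _ _) (DirectSum.linearMap_ext R fun i =>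
          LinearMap.ext fun x => ?_) x
      simp [component_tr])
    (fun g U U' h x => by
      refine LinearMap.congr_fun (f := DirectSum.toModule R ι _ _ ∘ₗ DirectSum.lmap _)
        (g := Y.conj g U U' h ∘ₗ DirectSum.toModule R ι _ _) (DirectSum.linearMap_ext R fun i =>
          LinearMap.ext fun x => ?_) x
      simp [component_conj])

theorem directSumι_desc (f : ∀ i, X i ⟶ Y) (i : ι) : directSumι X i ≫ directSumDesc f = f i :=
  hom_ext fun U x => by
    change (DirectSum.toModule R ι (Y.obj U) fun i => CohMackey.component (f i) U)
      (DirectSum.lof R ι (fun i => (X i).obj U) i x) = _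
    rw [DirectSum.toModule_lof]

theorem directSum_hom_ext {f g : directSum X ⟶ Y}
    (h : ∀ i, directSumι X i ≫ f = directSumι X i ≫ g) : f = g :=
  hom_ext fun U => LinearMap.congr_fun (DirectSum.linearMap_ext R fun i => LinearMap.ext fun x =>
    LinearMap.congr_fun (congrArg (fun φ => CohMackey.component φ U) (h i)) x)

theorem projective_directSum (h : ∀ i, Projective (X i)) : Projective (directSum X) where
  factors {E Z} f e _ := by
    refine ⟨directSumDesc fun i => Projective.factorThru (directSumι X i ≫ f) e,
      directSum_hom_ext fun i => ?_⟩
    rw [← Category.assoc, directSumι_desc, Projective.factorThru_comp]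

end DirectSum

end CohMackey

/-! ### Functors of fixed points -/

theorem conjSubgroup_bot {G : Type v} [Group G] (g : G) : conjSubgroup g (⊥ : Subgroup G) = ⊥ :=
  Subgroup.map_bot _

/-- Double coset systems exist in finite groups. -/
theorem exists_isDoubleCosetSystem {G : Type v} [Group G] [Finite G] {W U V : Subgroup G}
    (hW : W ≤ U) (hV : V ≤ U) : ∃ S : Finset G, IsDoubleCosetSystem W U V S := by
  classical
  have := Fintype.ofFinite G
  let r := DoubleCoset.setoid (W : Set G) (V : Set G)
  have hr : ∀ x y : G, (⟦x⟧ : Quotient r) = ⟦y⟧ ↔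
      y ∈ DoubleCoset.doubleCoset x (W : Set G) (V : Set G) := by
    intro x y
    rw [Quotient.eq]
    change DoubleCoset.doubleCoset x _ _ = DoubleCoset.doubleCoset y _ _ ↔ _
    refine ⟨fun h => ?_, fun h => (DoubleCoset.doubleCoset_eq_of_mem h).symm⟩
    rw [h]
    exact DoubleCoset.mem_doubleCoset_self _ _ _
  refine ⟨Finset.univ.filter fun s => s ∈ U ∧ (⟦s⟧ : Quotient r).out = s, ?_, ?_⟩
  · intro s hs
    exact (Finset.mem_filter.1 hs).2.1
  · intro x hx
    have h1 : x ∈ DoubleCoset.doubleCoset (⟦x⟧ : Quotient r).out (W : Set G) (V : Set G) := by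
      rw [← hr, Quotient.out_eq]
    refine ⟨(⟦x⟧ : Quotient r).out, ⟨?_, h1⟩, ?_⟩
    · refine Finset.mem_filter.2 ⟨Finset.mem_univ _, ?_, by rw [Quotient.out_eq]⟩
      obtain ⟨a, ha, b, hb, hab⟩ := DoubleCoset.mem_doubleCoset.1 h1
      have : (⟦x⟧ : Quotient r).out = a⁻¹ * x * b⁻¹ := by
        conv_rhs => rw [hab]
        group
      rw [this]
      exact U.mul_mem (U.mul_mem (U.inv_mem (hW ha)) hx) (U.inv_mem (hV hb))
    · rintro s ⟨hs, hxs⟩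
      rw [← hr] at hxs
      rw [← hxs, (Finset.mem_filter.1 hs).2.2]

namespace CohMackey

variable {R : Type u} {G : Type v} [CommRing R] [Group G]

section Action

variable (X : CohMackey.{w} R G)

/-- The action of `g` on the value `X_1` at the trivial subgroup. -/
def act (g : G) : X.obj ⊥ →ₗ[R] X.obj ⊥ := X.conj g ⊥ ⊥ (conjSubgroup_bot g).symm

theorem act_one (x : X.obj ⊥) : X.act 1 x = x :=
  LinearMap.congr_fun (X.conj_self ⊥ 1 (one_mem _) _) x

theorem act_mul (g h : G) (x : X.obj ⊥) : X.act (g * h) x = X.act g (X.act h x) :=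
  (LinearMap.congr_fun (X.conj_conj h g ⊥ ⊥ ⊥ _ _ (conjSubgroup_bot (g * h)).symm) x).symm

theorem act_res {U : Subgroup G} {g : G} (hg : g ∈ U) (x : X.obj U) :
    X.act g (X.res bot_le x) = X.res bot_le x := by
  have hU : U = conjSubgroup g U := by
    ext y
    rw [mem_conjSubgroup]
    exact ⟨fun h => U.mul_mem (U.mul_mem (U.inv_mem hg) h) hg, fun h => by
      have := U.mul_mem (U.mul_mem hg h) (U.inv_mem hg)
      simpa [mul_assoc] using this⟩
  have h := LinearMap.congr_fun (X.res_conj g U ⊥ U ⊥ bot_le bot_le hU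
    (conjSubgroup_bot g).symm) x
  rw [X.conj_self U g hg hU] at h
  exact h.symm

theorem component_act {X Y : CohMackey.{w} R G} (φ : X ⟶ Y) (g : G) (x : X.obj ⊥) :
    component φ ⊥ (X.act g x) = Y.act g (component φ ⊥ x) := component_conj ..

theorem act_eq_of_mem_zpowers {g x : G} (hx : x ∈ Subgroup.zpowers g) {a : X.obj ⊥}
    (ha : X.act g a = a) : X.act x a = a := by
  have h : Subgroup.zpowers g ≤
      { carrier := {y | X.act y a = a}
        mul_mem' := fun {y z} hy hz => by
          change X.act (y * z) a = a
          rw [act_mul, show X.act z a = a from hz, show X.act y a = a from hy]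
        one_mem' := X.act_one a
        inv_mem' := fun {y} hy => by
          change X.act y⁻¹ a = a
          conv_lhs => rw [← show X.act y a = a from hy]
          rw [← act_mul, inv_mul_cancel, act_one] } := by
    rw [Subgroup.zpowers_le]
    exact ha
  exact h hx

theorem tr_conj_res_of_eq_bot (g : G) {U A B W : Subgroup G} (hA : A = ⊥) (hB : B = ⊥) (hW : W = ⊥)
    (hAW : A ≤ W) (hBU : B ≤ U) (hAB : A = conjSubgroup g B) (x : X.obj U) (hW' : W ≤ ⊥) :
    X.res (bot_le : ⊥ ≤ W) (X.tr hAW (X.conj g B A hAB (X.res hBU x))) =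
      X.act g (X.res bot_le x) := by
  subst hA hB hW
  rw [X.tr_self, X.res_self]
  rfl

/-- The restriction of a transfer to the trivial subgroup is a sum of conjugates. -/
theorem res_tr_bot {U V : Subgroup G} (hV : V ≤ U) {S : Finset G}
    (hS : IsDoubleCosetSystem ⊥ U V S) (x : X.obj V) :
    X.res bot_le (X.tr hV x) = ∑ g ∈ S, X.act g (X.res bot_le x) := by
  have h := LinearMap.congr_fun (X.mackey U V ⊥ hV bot_le S hS) x
  rw [LinearMap.comp_apply] at h
  rw [h, LinearMap.sum_apply]
  refine Finset.sum_congr rfl fun g _ => ?_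
  have h2 := X.tr_conj_res_of_eq_bot g (inf_bot_eq _ : conjSubgroup g V ⊓ ⊥ = ⊥)
    (by rw [conjSubgroup_bot, inf_bot_eq] : V ⊓ conjSubgroup g⁻¹ ⊥ = ⊥) rfl inf_le_right
    inf_le_left (conj_inf_eq g V ⊥) x le_rfl
  rw [X.res_self_apply] at h2
  exact h2

/-- `X` is a functor of fixed points: the values `X_U` are the `U`-invariants of `X_1`. -/
def IsFixed : Prop :=
  ∀ U : Subgroup G, Function.Injective (X.res (bot_le : ⊥ ≤ U)) ∧
    ∀ a : X.obj ⊥, (∀ x ∈ U, X.act x a = a) → ∃ b, X.res (bot_le : ⊥ ≤ U) b = a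

variable {X}

theorem IsTypeH0.isFixed (h : X.IsTypeH0) : X.IsFixed := fun U =>
  ⟨h.1 U ⊥ bot_le, fun a ha => h.2 U ⊥ bot_le (by rw [Subgroup.bot_subgroupOf]; infer_instance) a
    fun x hx _ => ha x hx⟩

variable [Finite G]

/-- Equivariant maps into the value at `1` of a functor of fixed points extend to homomorphisms of
functors. -/
theorem IsFixed.exists_hom {T K : CohMackey.{w} R G} (hK : K.IsFixed)
    (f : T.obj ⊥ →ₗ[R] K.obj ⊥) (hf : ∀ g x, f (T.act g x) = K.act g (f x)) :
    ∃ φ : T ⟶ K, ∀ x, component φ ⊥ x = f x := by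
  have hex : ∀ U (x : T.obj U), ∃ y : K.obj U, K.res bot_le y = f (T.res bot_le x) :=
    fun U x => (hK U).2 _ fun g hg => by rw [← hf, T.act_res hg]
  choose F hF using hex
  let app : ∀ U, T.obj U →ₗ[R] K.obj U := fun U =>
    { toFun := F U
      map_add' := fun x y => (hK U).1 (by simp [hF])
      map_smul' := fun r x => (hK U).1 (by simp [hF]) }
  have happ : ∀ U (x : T.obj U), K.res bot_le (app U x) = f (T.res bot_le x) := hF
  refine ⟨homMk app ?_ ?_ ?_, fun x => ?_⟩
  · intro U V h x
    apply (hK V).1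
    rw [happ, res_res_apply, res_res_apply, happ]
  · intro U V h x
    apply (hK U).1
    obtain ⟨S, hS⟩ := exists_isDoubleCosetSystem (bot_le : ⊥ ≤ U) h
    rw [happ, res_tr_bot _ h hS, res_tr_bot _ h hS, map_sum]
    simp only [hf, happ]
  · intro g U U' h x
    apply (hK U').1
    have h1 := LinearMap.congr_fun (T.res_conj g U ⊥ U' ⊥ bot_le bot_le h
      (conjSubgroup_bot g).symm) x
    have h2 := LinearMap.congr_fun (K.res_conj g U ⊥ U' ⊥ bot_le bot_le h
      (conjSubgroup_bot g).symm) (app U x)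
    rw [LinearMap.comp_apply] at h1 h2
    rw [happ, h1, h2, LinearMap.comp_apply, LinearMap.comp_apply, happ]
    exact hf g _
  · have := happ ⊥ x
    rwa [res_self_apply, res_self_apply] at this

end Action

/-- `X` is the functor of fixed points of an `R`-free coflasque module over the cyclic group
generated by `σ` of order `p ^ n`: its first cohomology groups over all subgroups vanish. -/
structure IsCoflasqueFixed (p n : ℕ) (σ : G) (X : CohMackey.{w} R G) : Prop where
  isFixed : X.IsFixed
  free : Module.Free R (X.obj ⊥)
  coflasque : ∀ j ≤ n, ∀ x : X.obj ⊥,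
    ∑ i ∈ Finset.range (p ^ (n - j)), X.act ((σ ^ p ^ j) ^ i) x = 0 →
      ∃ y, X.act (σ ^ p ^ j) y - y = x

namespace IsCoflasqueFixed

variable {p n : ℕ} {σ : G}

theorem of_retract {X Y : CohMackey.{w} R G} [IsDomain R] [IsPrincipalIdealRing R]
    (hY : Y.IsCoflasqueFixed p n σ) (i : X ⟶ Y) (r : Y ⟶ X) (hir : i ≫ r = 𝟙 X) :
    X.IsCoflasqueFixed p n σ := by
  have h : ∀ U x, component r U (component i U x) = x := fun U x => by
    rw [← component_comp, hir, component_id]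
  have hinj : ∀ U, Function.Injective (component i U) := fun U =>
    Function.LeftInverse.injective (h U)
  refine ⟨fun U => ⟨fun x y hxy => ?_, fun a ha => ?_⟩, ?_, fun j hj x hx => ?_⟩
  · apply hinj
    apply (hY.isFixed U).1
    rw [← component_res, ← component_res, hxy]
  · obtain ⟨b, hb⟩ := (hY.isFixed U).2 (component i ⊥ a) fun x hx => by
      rw [← component_act, ha x hx]
    exact ⟨component r U b, by rw [← component_res, hb, h]⟩
  · have := hY.free
    exact Module.Free.of_injective_of_projective _ (hinj ⊥)
  · obtain ⟨y, hy⟩ := hY.coflasque j hj (component i ⊥ x) (by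
      simp only [← component_act]
      rw [← map_sum, hx, map_zero])
    exact ⟨component r ⊥ y, by rw [← component_act, ← map_sub, hy, h]⟩

/-- A kernel `K → P → Y` inherits the vanishing of cohomology from `P` when restriction is
injective on `Y`, and invariant elements in the image of `P_1 → Y_1` come from `P_U`. -/
theorem of_exact [IsDomain R] [IsPrincipalIdealRing R] {K P Y : CohMackey.{w} R G}
    (hP : P.IsCoflasqueFixed p n σ) (κ : K ⟶ P) (δ : P ⟶ Y)
    (hκ : ∀ U, Function.Injective (component κ U))
    (hex : ∀ U, Function.Exact (component κ U) (component δ U))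
    (hY : ∀ U : Subgroup G, Function.Injective (Y.res (bot_le : ⊥ ≤ U)))
    (hsat : ∀ (U : Subgroup G) (y : P.obj ⊥),
      (∀ x ∈ U, Y.act x (component δ ⊥ y) = component δ ⊥ y) →
        ∃ c : P.obj U, Y.res bot_le (component δ U c) = component δ ⊥ y) :
    K.IsCoflasqueFixed p n σ := by
  refine ⟨fun U => ⟨fun x y hxy => ?_, fun a ha => ?_⟩, ?_, fun j hj x hx => ?_⟩
  · apply hκ
    apply (hP.isFixed U).1
    rw [← component_res, ← component_res, hxy]
  · obtain ⟨b, hb⟩ := (hP.isFixed U).2 (component κ ⊥ a) fun x hx => by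
      rw [← component_act, ha x hx]
    have h0 : component δ U b = 0 := by
      apply hY U
      rw [← component_res, hb, map_zero]
      exact (hex ⊥).apply_apply_eq_zero a
    obtain ⟨c, rfl⟩ := (hex U b).1 h0
    exact ⟨c, hκ ⊥ (by rw [component_res, hb])⟩
  · have := hP.free
    exact Module.Free.of_injective_of_projective _ (hκ ⊥)
  · obtain ⟨y, hy⟩ := hP.coflasque j hj (component κ ⊥ x) (by
      simp only [← component_act]
      rw [← map_sum, hx, map_zero])
    have h1 : Y.act (σ ^ p ^ j) (component δ ⊥ y) = component δ ⊥ y := by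
      rw [← sub_eq_zero, ← component_act, ← map_sub, hy]
      exact (hex ⊥).apply_apply_eq_zero x
    obtain ⟨c, hc⟩ := hsat (Subgroup.zpowers (σ ^ p ^ j)) y fun x hx =>
      Y.act_eq_of_mem_zpowers hx h1
    -- `y` may be corrected by the `U`-invariant element `res c`
    obtain ⟨z, hz⟩ := (hex ⊥ (y - P.res bot_le c)).1 (by
      rw [map_sub, component_res, hc, sub_self])
    refine ⟨z, hκ ⊥ ?_⟩
    rw [map_sub, component_act, hz, map_sub, P.act_res (Subgroup.mem_zpowers _)]
    rw [← hy]
    abel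

/-- Kernels of homomorphisms onto functors of fixed points. -/
theorem of_exact_of_surjective [IsDomain R] [IsPrincipalIdealRing R] {K P Y : CohMackey.{w} R G}
    (hP : P.IsCoflasqueFixed p n σ) (κ : K ⟶ P) (δ : P ⟶ Y)
    (hκ : ∀ U, Function.Injective (component κ U))
    (hex : ∀ U, Function.Exact (component κ U) (component δ U))
    (hδ : ∀ U, Function.Surjective (component δ U)) (hY : Y.IsFixed) :
    K.IsCoflasqueFixed p n σ :=
  hP.of_exact κ δ hκ hex (fun U => (hY U).1) fun U y hy => by
    obtain ⟨b, hb⟩ := (hY U).2 _ hy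
    obtain ⟨c, rfl⟩ := hδ U b
    exact ⟨c, hb⟩

/-- Kernels of homomorphisms into functors with injective restriction maps that continue to a
longer exact sequence of such functors. -/
theorem of_exact_of_exact [IsDomain R] [IsPrincipalIdealRing R] {K P Y Z : CohMackey.{w} R G}
    (hP : P.IsCoflasqueFixed p n σ) (κ : K ⟶ P) (δ : P ⟶ Y) (ε : Y ⟶ Z)
    (hκ : ∀ U, Function.Injective (component κ U))
    (hex : ∀ U, Function.Exact (component κ U) (component δ U))
    (hex' : ∀ U, Function.Exact (component δ U) (component ε U)) (hY : Y.IsFixed)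
    (hZ : ∀ U : Subgroup G, Function.Injective (Z.res (bot_le : ⊥ ≤ U))) :
    K.IsCoflasqueFixed p n σ :=
  hP.of_exact κ δ hκ hex (fun U => (hY U).1) fun U y hy => by
    obtain ⟨b, hb⟩ := (hY U).2 _ hy
    obtain ⟨c, rfl⟩ := (hex' U b).1 (hZ U (by
      rw [← component_res, hb, map_zero]
      exact (hex' ⊥).apply_apply_eq_zero y))
    exact ⟨c, hb⟩

open DirectSum in
theorem directSum {ι : Type w} (X : ι → CohMackey.{w} R G)
    (hX : ∀ i, (X i).IsCoflasqueFixed p n σ) :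
    (CohMackey.directSum X).IsCoflasqueFixed p n σ := by
  classical
  have hact : ∀ g (x : (CohMackey.directSum X).obj ⊥) i,
      (show ⨁ i, (X i).obj ⊥ from (CohMackey.directSum X).act g x) i =
        (X i).act g ((show ⨁ i, (X i).obj ⊥ from x) i) := fun _ _ _ => rfl
  -- componentwise preimages may be chosen to vanish where the given component vanishes
  have hchoose : ∀ (U V : Subgroup G) (rel : ∀ i, (X i).obj U → (X i).obj V → Prop)
      (_ : ∀ i, rel i 0 0) (x : ⨁ i, (X i).obj U) (_ : ∀ i, ∃ y, rel i (x i) y),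
      ∃ y : ⨁ i, (X i).obj V, ∀ i, rel i (x i) (y i) := by
    intro U V rel h0 x hx
    choose y hy using hx
    refine ⟨DFinsupp.mapRange (fun i a => if a = 0 then 0 else y i) (fun i => by simp) x,
      fun i => ?_⟩
    rw [DFinsupp.mapRange_apply]
    split_ifs with h
    · rw [h]; exact h0 i
    · exact hy i
  refine ⟨fun U => ⟨fun x y hxy => ?_, fun a ha => ?_⟩, ?_, fun j hj x hx => ?_⟩
  · refine DFinsupp.ext fun i => ((hX i).isFixed U).1 ?_
    exact DFunLike.congr_fun (F := ⨁ i, (X i).obj ⊥) hxy i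
  · obtain ⟨b, hb⟩ := hchoose ⊥ U (fun i a b => (X i).res bot_le b = a) (fun i => map_zero _) a
      fun i => ((hX i).isFixed U).2 _ fun x hx => by
        rw [← hact]
        exact DFunLike.congr_fun (F := ⨁ i, (X i).obj ⊥) (ha x hx) i
    exact ⟨b, DFinsupp.ext hb⟩
  · have := fun i => (hX i).free
    exact inferInstanceAs (Module.Free R (⨁ i, (X i).obj ⊥))
  · obtain ⟨y, hy⟩ := hchoose ⊥ ⊥ (fun i a b => (X i).act (σ ^ p ^ j) b - b = a)
      (fun i => by rw [map_zero, sub_zero]) x fun i => (hX i).coflasque j hj _ (by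
        let c : (CohMackey.directSum X).obj ⊥ →ₗ[R] (X i).obj ⊥ :=
          DirectSum.component R ι (fun i => (X i).obj ⊥) i
        have := congrArg c hx
        rw [map_zero, map_sum] at this
        exact this)
    exact ⟨y, DFinsupp.ext hy⟩

variable [IsDomain R] [IsDiscreteValuationRing R] [CharZero R] [Finite G]

open Polynomial in
/-- The functor of fixed points of an `R`-free coflasque module is projective as soon as it is
covered by a projective functor of fixed points. -/
theorem projective {K Q : CohMackey.{w} R G} (hp : p.Prime)
    (hR : IsLocalRing.maximalIdeal R = Ideal.span {(p : R)}) (hσ : ∀ g : G, ∃ k : ℕ, g = σ ^ k)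
    (hn : σ ^ p ^ n = 1)
    (hK : K.IsCoflasqueFixed p n σ) (π : Q ⟶ K) [Projective Q]
    (hπ : ∀ U, Function.Surjective (component π U)) (hQ : Q.IsFixed) : Projective K := by
  let modK : Module R[X] (K.obj ⊥) := Module.compHom _ (aeval (K.act σ)).toRingHom
  let modQ : Module R[X] (Q.obj ⊥) := Module.compHom _ (aeval (Q.act σ)).toRingHom
  have hsK : ∀ (f : R[X]) (x : K.obj ⊥), f • x = aeval (K.act σ) f x := fun _ _ => rfl
  have hsQ : ∀ (f : R[X]) (x : Q.obj ⊥), f • x = aeval (Q.act σ) f x := fun _ _ => rfl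
  have : IsScalarTower R R[X] (K.obj ⊥) := ⟨fun r f x => by simp [hsK]⟩
  have : IsScalarTower R R[X] (Q.obj ⊥) := ⟨fun r f x => by simp [hsQ]⟩
  have hXK : ∀ (k : ℕ) (x : K.obj ⊥), (X : R[X]) ^ k • x = K.act (σ ^ k) x := by
    intro k x
    induction k generalizing x with
    | zero => simp [act_one]
    | succ k ih => rw [pow_succ, mul_smul, ih, pow_succ, act_mul, hsK, aeval_X]
  have hXQ : ∀ (k : ℕ) (x : Q.obj ⊥), (X : R[X]) ^ k • x = Q.act (σ ^ k) x := by
    intro k x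
    induction k generalizing x with
    | zero => simp [act_one]
    | succ k ih => rw [pow_succ, mul_smul, ih, pow_succ, act_mul, hsQ, aeval_X]
  have hcof : IsCoflasque R p n (K.obj ⊥) := by
    intro j hj x hx
    obtain ⟨y, hy⟩ := hK.coflasque j hj x (by
      rw [normPoly, Finset.sum_smul] at hx
      simp only [← pow_mul] at hx ⊢
      simpa only [hXK] using hx)
    exact ⟨y, by rw [sub_smul, one_smul, hXK, hy]⟩
  have := hK.free
  have hrel := hcof.isFixedProjective hp hR n (K.obj ⊥) fun x => by rw [hXK, hn, act_one]
  let f : Q.obj ⊥ →ₗ[R[X]] K.obj ⊥ := LinearMap.ofCommuteX (component π ⊥) fun x => by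
    have h1 := hXQ 1 x
    have h2 := hXK 1 (component π ⊥ x)
    rw [pow_one, pow_one] at h1 h2
    rw [h1, h2, component_act]
  obtain ⟨h, hh⟩ := hrel _ _ f LinearMap.id fun j y hy => by
    rw [hXK] at hy
    obtain ⟨b, rfl⟩ := (hK.isFixed (Subgroup.zpowers (σ ^ p ^ j))).2 y fun x hx =>
      K.act_eq_of_mem_zpowers hx hy
    obtain ⟨c, rfl⟩ := hπ _ b
    exact ⟨Q.res bot_le c, by rw [hXQ, Q.act_res (Subgroup.mem_zpowers _)], component_res ..⟩
  obtain ⟨s, hs⟩ := hQ.exists_hom (h.restrictScalars R) fun g x => by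
    obtain ⟨k, rfl⟩ := hσ g
    rw [← hXK, ← hXQ, LinearMap.restrictScalars_apply, LinearMap.restrictScalars_apply, map_smul]
  have hsπ : s ≫ π = 𝟙 K := hom_ext fun U x => by
    apply (hK.isFixed U).1
    rw [component_comp, component_id, ← component_res, ← component_res, hs]
    exact LinearMap.congr_fun hh _
  exact Retract.projective { i := s, r := π, retract := hsπ }

end IsCoflasqueFixed

end CohMackey

/-! ### Matrices of homomorphisms between permutation modules -/

/-- The set of cosets of a subgroup of a finite group is finite. -/
@[reducible]
noncomputable def cosetFintype {G : Type v} [Group G] [Finite G] (U : Subgroup G) :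
    Fintype (G ⧸ U) := Fintype.ofFinite _

namespace MackeyCat

attribute [local instance] cosetFintype

open MonoidAlgebra

variable {R : Type u} {G : Type v} [CommRing R] [Group G]

variable (R) in
/-- The object of the Mackey category given by a subgroup. -/
abbrev ofSubgroup (U : Subgroup G) : MackeyCat R G := U

section Entry

variable {U V W : Subgroup G}

/-- The matrix entries of a homomorphism `R[G/U] → R[G/V]`. -/
noncomputable def entry (f : ofSubgroup R U ⟶ ofSubgroup R V) (x : G ⧸ U) (y : G ⧸ V) : R :=
  (f.hom.hom (single x 1)).coeff y

/-- Matrix entries as linear forms. -/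
noncomputable def entryₗ (x : G ⧸ U) (y : G ⧸ V) : (ofSubgroup R U ⟶ ofSubgroup R V) →ₗ[R] R where
  toFun f := entry f x y
  map_add' _ _ := rfl
  map_smul' _ _ := rfl

theorem entry_sum {ι : Type*} (s : Finset ι) (f : ι → (ofSubgroup R U ⟶ ofSubgroup R V))
    (x : G ⧸ U) (y : G ⧸ V) : entry (∑ i ∈ s, f i) x y = ∑ i ∈ s, entry (f i) x y :=
  map_sum (entryₗ x y) f s

theorem entry_ext {f g : ofSubgroup R U ⟶ ofSubgroup R V}
    (h : ∀ x y, entry f x y = entry g x y) : f = g := by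
  apply InducedCategory.hom_ext
  apply Rep.hom_ext
  apply Representation.IntertwiningMap.ext
  refine MonoidAlgebra.lhom_ext' fun x => LinearMap.ext_ring ?_
  apply MonoidAlgebra.coeff_injective
  exact Finsupp.ext (h x)

theorem entry_smul_smul (f : ofSubgroup R U ⟶ ofSubgroup R V) (g : G) (x : G ⧸ U) (y : G ⧸ V) :
    entry f (g • x) (g • y) = entry f x y := by
  have h := Rep.hom_comm_apply f.hom g (single x 1)
  rw [Representation.ofMulAction_single] at h
  rw [entry, h, Representation.coeff_ofMulAction, inv_smul_smul]
  rfl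

open Classical in
theorem entry_id (x y : G ⧸ U) : entry (𝟙 (ofSubgroup R U)) x y = if x = y then 1 else 0 :=
  Finsupp.single_apply

variable [Finite G]

theorem entry_comp (f : ofSubgroup R U ⟶ ofSubgroup R V) (g : ofSubgroup R V ⟶ ofSubgroup R W)
    (x : G ⧸ U) (z : G ⧸ W) : entry (f ≫ g) x z = ∑ y, entry f x y * entry g y z := by
  have h : ∀ a : R[G ⧸ V], (g.hom.hom a).coeff z = ∑ y, a.coeff y * entry g y z := by
    intro a
    have ha : a = ∑ y, a.coeff y • single y (1 : R) := by
      classical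
      apply MonoidAlgebra.coeff_injective
      ext y
      simp
    let l : R[G ⧸ V] →ₗ[R] R := Finsupp.lapply z ∘ₗ
      (MonoidAlgebra.coeffLinearEquiv R).toLinearMap ∘ₗ g.hom.hom.toLinearMap
    change l a = _
    conv_lhs => rw [ha]
    rw [map_sum]
    refine Finset.sum_congr rfl fun y _ => ?_
    rw [map_smul]
    rfl
  exact h _

/-- The linear map `R[G/U] → R[G/V]` with a given matrix. -/
noncomputable def matrixMap (m : G ⧸ U → G ⧸ V → R) : R[G ⧸ U] →ₗ[R] R[G ⧸ V] :=
  (MonoidAlgebra.coeffLinearEquiv R).symm.toLinearMap ∘ₗ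
    Finsupp.linearCombination R (fun x => Finsupp.equivFunOnFinite.symm (m x)) ∘ₗ
    (MonoidAlgebra.coeffLinearEquiv R).toLinearMap

theorem coeff_matrixMap (m : G ⧸ U → G ⧸ V → R) (x : G ⧸ U) (y : G ⧸ V) :
    (matrixMap m (single x 1)).coeff y = m x y := by
  simp [matrixMap]

/-- The homomorphism with a given `G`-invariant matrix. -/
noncomputable def ofEntry (m : G ⧸ U → G ⧸ V → R) (hm : ∀ (g : G) x y, m (g • x) (g • y) = m x y) :
    ofSubgroup R U ⟶ ofSubgroup R V :=
  InducedCategory.homMk (Rep.ofHom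
    { toLinearMap := matrixMap m
      isIntertwining' := fun g => by
        refine MonoidAlgebra.lhom_ext' fun x => LinearMap.ext_ring ?_
        change matrixMap m (Representation.ofMulAction R G (G ⧸ U) g (single x 1)) =
          Representation.ofMulAction R G (G ⧸ V) g (matrixMap m (single x 1))
        apply MonoidAlgebra.coeff_injective
        ext y
        rw [Representation.coeff_ofMulAction, Representation.ofMulAction_single, coeff_matrixMap,
          coeff_matrixMap, ← hm g x (g⁻¹ • y), smul_inv_smul] })

theorem entry_ofEntry (m : G ⧸ U → G ⧸ V → R) (hm) (x : G ⧸ U) (y : G ⧸ V) :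
    entry (ofEntry m hm) x y = m x y :=
  coeff_matrixMap m x y

open Classical in
/-- The homomorphism of permutation modules given by a map of `G`-sets. -/
noncomputable def mapHom (α : G ⧸ U → G ⧸ V) (hα : ∀ (g : G) x, α (g • x) = g • α x) :
    ofSubgroup R U ⟶ ofSubgroup R V :=
  ofEntry (fun x y => if α x = y then 1 else 0) fun g x y => by
    simp only [hα, (MulAction.injective g).eq_iff]

open Classical in
/-- The transpose of the homomorphism of permutation modules given by a map of `G`-sets. -/
noncomputable def transferHom (α : G ⧸ U → G ⧸ V) (hα : ∀ (g : G) x, α (g • x) = g • α x) :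
    ofSubgroup R V ⟶ ofSubgroup R U :=
  ofEntry (fun x y => if α y = x then 1 else 0) fun g x y => by
    simp only [hα, (MulAction.injective g).eq_iff]

open Classical in
theorem entry_mapHom (α : G ⧸ U → G ⧸ V) (hα) (x : G ⧸ U) (y : G ⧸ V) :
    entry (mapHom (R := R) α hα) x y = if α x = y then 1 else 0 := entry_ofEntry _ _ _ _

open Classical in
theorem entry_transferHom (α : G ⧸ U → G ⧸ V) (hα) (x : G ⧸ V) (y : G ⧸ U) :
    entry (transferHom (R := R) α hα) x y = if α y = x then 1 else 0 := entry_ofEntry _ _ _ _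

theorem entry_mapHom_comp (α : G ⧸ U → G ⧸ V) (hα) (f : ofSubgroup R V ⟶ ofSubgroup R W)
    (x : G ⧸ U) (z : G ⧸ W) : entry (mapHom α hα ≫ f) x z = entry f (α x) z := by
  classical
  simp [entry_comp, entry_mapHom]

theorem entry_comp_transferHom (α : G ⧸ W → G ⧸ V) (hα) (f : ofSubgroup R U ⟶ ofSubgroup R V)
    (x : G ⧸ U) (z : G ⧸ W) : entry (f ≫ transferHom α hα) x z = entry f x (α z) := by
  classical
  simp [entry_comp, entry_transferHom]

open Classical in
theorem entry_transferHom_comp (α : G ⧸ V → G ⧸ U) (hα) (f : ofSubgroup R V ⟶ ofSubgroup R W)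
    (x : G ⧸ U) (z : G ⧸ W) :
    entry (transferHom α hα ≫ f) x z = ∑ y, if α y = x then entry f y z else 0 := by
  simp [entry_comp, entry_transferHom]

end Entry

section Generators

theorem quotientMapOfLE_smul {U V : Subgroup G} (h : V ≤ U) (g : G) (x : G ⧸ V) :
    Subgroup.quotientMapOfLE h (g • x) = g • Subgroup.quotientMapOfLE h x := by
  induction x using QuotientGroup.induction_on
  rfl

/-- The map `G/ᵍU → G/U`, `x ᵍU ↦ x g U`. -/
def cosetConj (g : G) (U U' : Subgroup G) (h : U' = conjSubgroup g U) : G ⧸ U' → G ⧸ U :=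
  Quotient.map' (· * g) fun a b hab => by
    rw [QuotientGroup.leftRel_apply] at hab ⊢
    rw [h, mem_conjSubgroup] at hab
    simpa [mul_assoc] using hab

theorem cosetConj_mk (g : G) (U U' : Subgroup G) (h : U' = conjSubgroup g U) (a : G) :
    cosetConj g U U' h (a : G ⧸ U') = ((a * g : G) : G ⧸ U) := rfl

theorem cosetConj_smul (g : G) (U U' : Subgroup G) (h : U' = conjSubgroup g U) (a : G)
    (x : G ⧸ U') : cosetConj g U U' h (a • x) = a • cosetConj g U U' h x := by
  induction x using QuotientGroup.induction_on with
  | _ b => exact congrArg _ (mul_assoc a b g)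

theorem cosetConj_injective (g : G) (U U' : Subgroup G) (h : U' = conjSubgroup g U) :
    Function.Injective (cosetConj g U U' h) := by
  intro x y
  induction x using QuotientGroup.induction_on
  induction y using QuotientGroup.induction_on
  rw [cosetConj_mk, cosetConj_mk, QuotientGroup.eq, QuotientGroup.eq, h, mem_conjSubgroup]
  intro hxy
  simpa [mul_assoc] using hxy

theorem cosetConj_surjective (g : G) (U U' : Subgroup G) (h : U' = conjSubgroup g U) :
    Function.Surjective (cosetConj g U U' h) := by
  intro x
  induction x using QuotientGroup.induction_on with
  | _ b => exact ⟨((b * g⁻¹ : G) : G ⧸ U'), by rw [cosetConj_mk, inv_mul_cancel_right]⟩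

variable (R) [Finite G]

/-- The projection `R[G/V] → R[G/U]` for `V ≤ U`. -/
noncomputable def proj {U V : Subgroup G} (h : V ≤ U) : ofSubgroup R V ⟶ ofSubgroup R U :=
  mapHom (Subgroup.quotientMapOfLE h) (quotientMapOfLE_smul h)

/-- The transfer `R[G/U] → R[G/V]` for `V ≤ U`, sending a coset of `U` to the sum of the cosets of
`V` it contains. -/
noncomputable def transfer {U V : Subgroup G} (h : V ≤ U) : ofSubgroup R U ⟶ ofSubgroup R V :=
  transferHom (Subgroup.quotientMapOfLE h) (quotientMapOfLE_smul h)

/-- The isomorphism `R[G/ᵍU] → R[G/U]`. -/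
noncomputable def conjHom (g : G) (U U' : Subgroup G) (h : U' = conjSubgroup g U) :
    ofSubgroup R U' ⟶ ofSubgroup R U :=
  mapHom (cosetConj g U U' h) (cosetConj_smul g U U' h)

variable {R}

theorem proj_self {U : Subgroup G} (h : U ≤ U) : proj R h = 𝟙 _ := entry_ext fun x y => by
  classical
  rw [proj, entry_mapHom, entry_id]
  induction x using QuotientGroup.induction_on
  rfl

theorem transfer_self {U : Subgroup G} (h : U ≤ U) : transfer R h = 𝟙 _ :=
  entry_ext fun x y => by
    classical
    rw [transfer, entry_transferHom, entry_id]
    induction y using QuotientGroup.induction_on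
    exact if_congr eq_comm rfl rfl

theorem conjHom_self {U : Subgroup G} {g : G} (hg : g ∈ U) (h : U = conjSubgroup g U) :
    conjHom R g U U h = 𝟙 _ := entry_ext fun x y => by
  classical
  rw [conjHom, entry_mapHom, entry_id]
  induction x using QuotientGroup.induction_on with
  | _ a =>
    have : cosetConj g U U h (a : G ⧸ U) = a := by
      rw [cosetConj_mk, QuotientGroup.eq]
      simpa using hg
    rw [this]

theorem proj_proj {U V W : Subgroup G} (hWV : W ≤ V) (hVU : V ≤ U) :
    proj R hWV ≫ proj R hVU = proj R (hWV.trans hVU) := entry_ext fun x y => by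
  classical
  rw [proj, entry_mapHom_comp, proj, proj, entry_mapHom, entry_mapHom]
  induction x using QuotientGroup.induction_on
  rfl

theorem transfer_transfer {U V W : Subgroup G} (hWV : W ≤ V) (hVU : V ≤ U) :
    transfer R hVU ≫ transfer R hWV = transfer R (hWV.trans hVU) := entry_ext fun x y => by
  classical
  rw [transfer, transfer, entry_comp_transferHom, transfer, entry_transferHom, entry_transferHom]
  induction y using QuotientGroup.induction_on
  rfl

theorem conjHom_conjHom (g h : G) (U U' U'' : Subgroup G) (h₁ : U' = conjSubgroup g U)
    (h₂ : U'' = conjSubgroup h U') (h₃ : U'' = conjSubgroup (h * g) U) :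
    conjHom R h U' U'' h₂ ≫ conjHom R g U U' h₁ = conjHom R (h * g) U U'' h₃ :=
  entry_ext fun x y => by
    classical
    rw [conjHom, entry_mapHom_comp, conjHom, conjHom, entry_mapHom, entry_mapHom]
    induction x using QuotientGroup.induction_on
    rw [cosetConj_mk, cosetConj_mk, cosetConj_mk, mul_assoc]

theorem proj_conjHom (g : G) (U V U' V' : Subgroup G) (hVU : V ≤ U) (hVU' : V' ≤ U')
    (hU : U' = conjSubgroup g U) (hV : V' = conjSubgroup g V) :
    proj R hVU' ≫ conjHom R g U U' hU = conjHom R g V V' hV ≫ proj R hVU :=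
  entry_ext fun x y => by
    classical
    rw [proj, conjHom, conjHom, proj, entry_mapHom_comp, entry_mapHom_comp, entry_mapHom,
      entry_mapHom]
    induction x using QuotientGroup.induction_on
    rfl

theorem transfer_conjHom (g : G) (U V U' V' : Subgroup G) (hVU : V ≤ U) (hVU' : V' ≤ U')
    (hU : U' = conjSubgroup g U) (hV : V' = conjSubgroup g V) :
    transfer R hVU' ≫ conjHom R g V V' hV = conjHom R g U U' hU ≫ transfer R hVU :=
  entry_ext fun x y => by
    classical
    rw [conjHom, conjHom, transfer, transfer, entry_mapHom_comp, entry_transferHom,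
      entry_transferHom_comp]
    obtain ⟨z, rfl⟩ := cosetConj_surjective g V V' hV y
    rw [Finset.sum_eq_single z]
    · have h : Subgroup.quotientMapOfLE hVU (cosetConj g V V' hV z) =
          cosetConj g U U' hU (Subgroup.quotientMapOfLE hVU' z) := by
        induction z using QuotientGroup.induction_on
        rfl
      simp only [h, (cosetConj_injective g U U' hU).eq_iff, entry_mapHom, if_true]
    · intro b _ hb
      simp only [entry_mapHom, (cosetConj_injective g V V' hV).eq_iff, if_neg hb, ite_self]
    · intro h
      exact absurd (Finset.mem_univ _) h

open Classical in
theorem card_fiber_quotientMapOfLE {U V : Subgroup G} (h : V ≤ U) (x : G ⧸ U) :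
    (Finset.univ.filter fun y : G ⧸ V => Subgroup.quotientMapOfLE h y = x).card =
      V.relIndex U := by
  induction x using QuotientGroup.induction_on with
  | _ a =>
  have e : U ⧸ V.subgroupOf U ≃ {y : G ⧸ V // Subgroup.quotientMapOfLE h y = (a : G ⧸ U)} :=
    { toFun := fun t => ⟨Quotient.liftOn' t (fun u : U => ((a * u : G) : G ⧸ V)) (fun b c hbc => by
          rw [QuotientGroup.leftRel_apply] at hbc
          refine QuotientGroup.eq.2 ?_
          rw [Subgroup.mem_subgroupOf] at hbc
          simpa [mul_assoc] using hbc), by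
        induction t using Quotient.inductionOn' with
        | _ u =>
          change ((a * u : G) : G ⧸ U) = a
          rw [QuotientGroup.eq]
          simp⟩
      invFun := fun y => ((⟨a⁻¹ * (y : G ⧸ V).out, by
        obtain ⟨y, hy⟩ := y
        rw [← QuotientGroup.out_eq' y] at hy
        exact QuotientGroup.eq.1 (Eq.symm hy)⟩ : U) : U ⧸ V.subgroupOf U)
      left_inv := fun t => by
        induction t using Quotient.inductionOn' with
        | _ u =>
          refine QuotientGroup.eq.2 ?_
          rw [Subgroup.mem_subgroupOf]
          have h1 : ((a * u : G) : G ⧸ V).out⁻¹ * (a * u) ∈ V :=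
            QuotientGroup.eq.1 (QuotientGroup.out_eq' ((a * u : G) : G ⧸ V))
          change (a⁻¹ * ((a * u : G) : G ⧸ V).out)⁻¹ * u ∈ V
          simpa [mul_assoc] using h1
      right_inv := fun y => Subtype.ext (by
        change ((a * (a⁻¹ * (y : G ⧸ V).out) : G) : G ⧸ V) = y
        rw [mul_inv_cancel_left, QuotientGroup.out_eq']) }
  rw [Subgroup.relIndex, Subgroup.index, Nat.card_congr e, Nat.card_eq_fintype_card,
    Fintype.card_subtype]

theorem transfer_proj {U V : Subgroup G} (h : V ≤ U) :
    transfer R h ≫ proj R h = V.relIndex U • 𝟙 (ofSubgroup R U) := entry_ext fun x z => by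
  classical
  have h1 : entry (V.relIndex U • 𝟙 (ofSubgroup R U)) x z =
      V.relIndex U • entry (𝟙 (ofSubgroup R U)) x z := map_nsmul (entryₗ x z) _ _
  rw [h1, transfer, entry_transferHom_comp, entry_id, ← card_fiber_quotientMapOfLE h x,
    ← Finset.sum_filter]
  rw [Finset.sum_congr rfl (g := fun _ => if x = z then (1 : R) else 0), Finset.sum_const]
  intro y hy
  rw [proj, entry_mapHom, (Finset.mem_filter.1 hy).2]

theorem proj_transfer (U V W : Subgroup G) (hV : V ≤ U) (hW : W ≤ U) (S : Finset G)
    (hS : IsDoubleCosetSystem W U V S) :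
    proj R hW ≫ transfer R hV = ∑ g ∈ S,
      transfer R (inf_le_right : conjSubgroup g V ⊓ W ≤ W) ≫
        conjHom R g (V ⊓ conjSubgroup g⁻¹ W) (conjSubgroup g V ⊓ W) (conj_inf_eq g V W) ≫
          proj R (inf_le_left : V ⊓ conjSubgroup g⁻¹ W ≤ V) := entry_ext fun x z => by
  classical
  rw [entry_sum, proj, entry_mapHom_comp, transfer, entry_transferHom]
  induction x using QuotientGroup.induction_on with | _ a =>
  induction z using QuotientGroup.induction_on with | _ b =>
  have hterm : ∀ g ∈ S, entry (transfer R (inf_le_right : conjSubgroup g V ⊓ W ≤ W) ≫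
      conjHom R g (V ⊓ conjSubgroup g⁻¹ W) (conjSubgroup g V ⊓ W) (conj_inf_eq g V W) ≫
        proj R (inf_le_left : V ⊓ conjSubgroup g⁻¹ W ≤ V)) (a : G ⧸ W) (b : G ⧸ V) =
      if a⁻¹ * b ∈ DoubleCoset.doubleCoset g (W : Set G) (V : Set G) then (1 : R) else 0 := by
    intro g _
    rw [transfer, entry_transferHom_comp]
    have h1 : ∀ y : G ⧸ conjSubgroup g V ⊓ W,
        entry (conjHom R g (V ⊓ conjSubgroup g⁻¹ W) (conjSubgroup g V ⊓ W) (conj_inf_eq g V W) ≫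
          proj R (inf_le_left : V ⊓ conjSubgroup g⁻¹ W ≤ V)) y (b : G ⧸ V) =
        if Subgroup.quotientMapOfLE inf_le_left (cosetConj g (V ⊓ conjSubgroup g⁻¹ W)
          (conjSubgroup g V ⊓ W) (conj_inf_eq g V W) y) = (b : G ⧸ V) then 1 else 0 := fun y => by
      rw [conjHom, entry_mapHom_comp, proj, entry_mapHom]
    simp only [h1]
    split_ifs with h
    · obtain ⟨c, hc, d, hd, hcd⟩ := DoubleCoset.mem_doubleCoset.1 h
      rw [Finset.sum_eq_single ((a * c : G) : G ⧸ conjSubgroup g V ⊓ W)]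
      · rw [if_pos, if_pos]
        · change ((a * c * g : G) : G ⧸ V) = b
          rw [QuotientGroup.eq]
          have : (a * c * g)⁻¹ * b = d := by
            have : b = a * (c * g * d) := by rw [← hcd]; group
            rw [this]; group
          rw [this]; exact hd
        · change ((a * c : G) : G ⧸ W) = a
          rw [QuotientGroup.eq]
          simpa using hc
      · intro y _ hy
        induction y using QuotientGroup.induction_on with | _ e =>
        by_contra hne
        apply hy
        rw [ite_eq_right_iff, Classical.not_imp] at hne
        obtain ⟨h2, h3⟩ := hne
        rw [ite_eq_right_iff, Classical.not_imp] at h3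
        have h4 : e⁻¹ * a ∈ W := QuotientGroup.eq.1 h2
        have h5 : (e * g)⁻¹ * b ∈ V := QuotientGroup.eq.1 h3.1
        rw [QuotientGroup.eq, Subgroup.mem_inf, mem_conjSubgroup]
        constructor
        · have : g⁻¹ * (e⁻¹ * (a * c)) * g = ((e * g)⁻¹ * b) * d⁻¹ := by
            have : b = a * (c * g * d) := by rw [← hcd]; group
            rw [this]; group
          rw [this]
          exact V.mul_mem h5 (V.inv_mem hd)
        · have := W.mul_mem h4 hc
          simpa [mul_assoc] using this
      · intro h; exact absurd (Finset.mem_univ _) h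
    · refine Finset.sum_eq_zero fun y _ => ?_
      induction y using QuotientGroup.induction_on with | _ e =>
      by_contra hne
      apply h
      rw [ite_eq_right_iff, Classical.not_imp] at hne
      obtain ⟨h2, h3⟩ := hne
      rw [ite_eq_right_iff, Classical.not_imp] at h3
      have h4 : e⁻¹ * a ∈ W := QuotientGroup.eq.1 h2
      have h5 : (e * g)⁻¹ * b ∈ V := QuotientGroup.eq.1 h3.1
      refine DoubleCoset.mem_doubleCoset.2 ⟨a⁻¹ * e, ?_, _, h5, by group⟩
      have := W.inv_mem h4
      simpa using this
  rw [Finset.sum_congr rfl hterm]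
  split_ifs with h
  · have hU : a⁻¹ * b ∈ U := by
      have h1 : ((b : G) : G ⧸ U) = a := h
      rw [eq_comm, QuotientGroup.eq] at h1
      exact h1
    obtain ⟨s, ⟨hs, hs'⟩, huniq⟩ := hS.2 _ hU
    rw [Finset.sum_eq_single s]
    · rw [if_pos hs']
    · intro t ht hts
      exact if_neg fun h => hts (huniq t ⟨ht, h⟩)
    · intro h; exact absurd hs h
  · refine (Finset.sum_eq_zero fun g hg => if_neg fun hg' => h ?_).symm
    obtain ⟨c, hc, d, hd, hcd⟩ := DoubleCoset.mem_doubleCoset.1 hg'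
    change ((b : G) : G ⧸ U) = a
    rw [eq_comm, QuotientGroup.eq, hcd]
    exact U.mul_mem (U.mul_mem (hW hc) (hS.1 g hg)) (hV hd)

end Generators

end MackeyCat

/-! ### From linear functors on the Mackey category to cohomological Mackey functors -/

namespace LinearPresheaf

section

variable {R : Type u} [CommRing R] {C : Type*} [Category C] [Preadditive C] [Linear R C]

/-- The action of morphisms on an `R`-linear functor, as an `R`-linear map. -/
def mapₗ (F : LinearPresheaf.{w} R C) {A B : C} :
    (A ⟶ B) →ₗ[R] (F.obj.obj (Opposite.op B) →ₗ[R] F.obj.obj (Opposite.op A)) where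
  toFun f := (F.obj.map f.op).hom
  map_add' f g := by rw [F.property.1 f g]; rfl
  map_smul' r f := by rw [F.property.2 r f]; rfl

theorem mapₗ_id (F : LinearPresheaf.{w} R C) (A : C) : F.mapₗ (𝟙 A) = LinearMap.id := by
  change (F.obj.map (𝟙 A).op).hom = _
  rw [op_id, F.obj.map_id]
  rfl

theorem mapₗ_comp (F : LinearPresheaf.{w} R C) {A B D : C} (f : A ⟶ B) (g : B ⟶ D) :
    F.mapₗ (f ≫ g) = F.mapₗ f ∘ₗ F.mapₗ g := by
  change (F.obj.map (f ≫ g).op).hom = _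
  rw [op_comp, F.obj.map_comp]
  rfl

theorem naturality (F F' : LinearPresheaf.{w} R C) (φ : F ⟶ F') {A B : C} (f : A ⟶ B)
    (x : F.obj.obj (Opposite.op B)) :
    (φ.hom.app (Opposite.op A)).hom (F.mapₗ f x) =
      F'.mapₗ f ((φ.hom.app (Opposite.op B)).hom x) :=
  ConcreteCategory.congr_hom (φ.hom.naturality f.op) x

end

open MackeyCat

variable {R : Type u} {G : Type v} [CommRing R] [Group G] [Finite G]

/-- The cohomological Mackey functor of an `R`-linear functor on the Mackey category: restriction,
transfer and conjugation are induced by the projections `R[G/V] → R[G/U]`, by the transfers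
`R[G/U] → R[G/V]` and by the isomorphisms `R[G/ᵍU] → R[G/U]`. -/
noncomputable def toCohMackeyObj (F : LinearPresheaf.{w} R (MackeyCat R G)) :
    CohMackey.{w} R G where
  obj U := F.obj.obj (Opposite.op (ofSubgroup R U))
  res h := F.mapₗ (proj R h)
  tr h := F.mapₗ (transfer R h)
  conj g U U' h := F.mapₗ (conjHom R g U U' h)
  res_self U h := by rw [proj_self, mapₗ_id]
  tr_self U h := by rw [transfer_self, mapₗ_id]
  conj_self U x hx h := by rw [conjHom_self hx, mapₗ_id]
  res_res h₁ h₂ := by rw [← mapₗ_comp, proj_proj]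
  tr_tr h₁ h₂ := by rw [← mapₗ_comp, transfer_transfer]
  conj_conj g h U U' U'' h₁ h₂ h₃ := by rw [← mapₗ_comp, conjHom_conjHom]
  res_conj g U V U' V' h₁ h₂ h₃ h₄ := by
    rw [← mapₗ_comp, ← mapₗ_comp, proj_conjHom g U V U' V' h₁ h₂ h₃ h₄]
  tr_conj g U V U' V' h₁ h₂ h₃ h₄ := by
    rw [← mapₗ_comp, ← mapₗ_comp, transfer_conjHom g U V U' V' h₁ h₂ h₃ h₄]
  mackey U V W hV hW S hS := by
    rw [← mapₗ_comp, proj_transfer U V W hV hW S hS, map_sum]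
    refine Finset.sum_congr rfl fun g _ => ?_
    rw [mapₗ_comp, mapₗ_comp]
  cohomological hV := by rw [← mapₗ_comp, transfer_proj, map_nsmul, mapₗ_id]

variable (R G) in
/-- The functor from `R`-linear functors on the Mackey category to cohomological Mackey
functors. -/
noncomputable def toCohMackey :
    LinearPresheaf.{w} R (MackeyCat R G) ⥤ CohMackey.{w} R G where
  obj F := toCohMackeyObj F
  map {F F'} φ := CohMackey.homMk
    (fun U => (φ.hom.app (Opposite.op (ofSubgroup R U))).hom)
    (fun h x => naturality F F' φ (proj R h) x)
    (fun h x => naturality F F' φ (transfer R h) x)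
    (fun g U U' h x => naturality F F' φ (conjHom R g U U' h) x)
  map_id _ := rfl
  map_comp _ _ := rfl

/-- The representable functor of a subgroup. -/
noncomputable def representable (U : Subgroup G) :
    LinearPresheaf.{max u v} R (MackeyCat R G) where
  obj := (linearYoneda R (MackeyCat R G)).obj (ofSubgroup R U)
  property := by
    refine ⟨fun A B f g => ?_, fun A B r f => ?_⟩
    · ext x
      exact Preadditive.add_comp _ _ _ f g x
    · ext x
      exact Linear.smul_comp _ _ _ r f x

end LinearPresheaf

/-! ### The functors of fixed points of `R[G/U]` and the Yoneda lemma -/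

namespace CohMackey

attribute [local instance] cosetFintype

open MackeyCat

variable {R : Type u} {G : Type v} [CommRing R] [Group G]

section Perm

/-- The coefficients of the image of the trivial coset. -/
noncomputable def coef {U V : Subgroup G} (f : ofSubgroup R V ⟶ ofSubgroup R U) (y : G ⧸ U) : R :=
  entry f ((1 : G) : G ⧸ V) y

theorem entry_mk {U V : Subgroup G} (f : ofSubgroup R V ⟶ ofSubgroup R U) (g : G) (y : G ⧸ U) :
    entry f (g : G ⧸ V) y = coef f (g⁻¹ • y) := by
  have h := entry_smul_smul f g ((1 : G) : G ⧸ V) (g⁻¹ • y)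
  rwa [smul_inv_smul, MulAction.Quotient.smul_coe, smul_eq_mul, mul_one] at h

theorem coef_smul_of_mem {U V : Subgroup G} (f : ofSubgroup R V ⟶ ofSubgroup R U) {g : G}
    (hg : g ∈ V) (y : G ⧸ U) : coef f (g • y) = coef f y := by
  have h := entry_mk f g⁻¹ y
  rw [inv_inv] at h
  rw [← h, coef]
  congr 1
  rw [QuotientGroup.eq]
  simpa using hg

theorem coef_ext {U V : Subgroup G} {f f' : ofSubgroup R V ⟶ ofSubgroup R U}
    (h : ∀ y, coef f y = coef f' y) : f = f' := entry_ext fun x y => by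
  induction x using QuotientGroup.induction_on
  rw [entry_mk, entry_mk, h]

theorem inv_out_smul_eq_iff {V : Subgroup G} (z w : G ⧸ V) :
    z.out⁻¹ • w = ((1 : G) : G ⧸ V) ↔ w = z := by
  rw [inv_smul_eq_iff, MulAction.Quotient.smul_coe, smul_eq_mul, mul_one, QuotientGroup.out_eq']

variable [Finite G]

variable (R) in
/-- The cohomological Mackey functor `V ↦ Hom(R[G/V], R[G/U])` represented by `U`. -/
noncomputable def perm (U : Subgroup G) : CohMackey.{max u v} R G :=
  (LinearPresheaf.toCohMackey R G).obj (LinearPresheaf.representable U)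

/-- A homomorphism `R[G/V] → R[G/U]` as an element of a value of `perm R U`. -/
def permMk {U V : Subgroup G} (f : ofSubgroup R V ⟶ ofSubgroup R U) : (perm R U).obj V := f

/-- An element of a value of `perm R U` as a homomorphism `R[G/V] → R[G/U]`. -/
def permHom {U V : Subgroup G} (f : (perm R U).obj V) : ofSubgroup R V ⟶ ofSubgroup R U := f

theorem permHom_res {U V V' : Subgroup G} (h : V' ≤ V) (f : (perm R U).obj V) :
    permHom ((perm R U).res h f) = proj R h ≫ permHom f := rfl

end Perm

section Commutative

variable (hc : ∀ a b : G, a * b = b * a)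

include hc in
theorem conjSubgroup_eq_self (g : G) (U : Subgroup G) : U = conjSubgroup g U := by
  ext x
  rw [mem_conjSubgroup, hc _ x, mul_assoc, inv_mul_cancel, mul_one]

/-- The action of a commutative group on the values of a Mackey functor. -/
def actAt (X : CohMackey.{w} R G) (g : G) (U : Subgroup G) : X.obj U →ₗ[R] X.obj U :=
  X.conj g U U (conjSubgroup_eq_self hc g U)

variable (X : CohMackey.{w} R G)

theorem actAt_mul (g h : G) (U : Subgroup G) (x : X.obj U) :
    actAt hc X (g * h) U x = actAt hc X g U (actAt hc X h U x) :=
  (LinearMap.congr_fun (X.conj_conj h g U U U _ _ (conjSubgroup_eq_self hc (g * h) U)) x).symm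

theorem actAt_of_mem {g : G} {U : Subgroup G} (hg : g ∈ U) (x : X.obj U) :
    actAt hc X g U x = x := LinearMap.congr_fun (X.conj_self U g hg _) x

theorem res_actAt (g : G) {U V : Subgroup G} (h : V ≤ U) (x : X.obj U) :
    X.res h (actAt hc X g U x) = actAt hc X g V (X.res h x) :=
  LinearMap.congr_fun (X.res_conj g U V U V h h _ _) x

theorem tr_actAt (g : G) {U V : Subgroup G} (h : V ≤ U) (x : X.obj V) :
    X.tr h (actAt hc X g V x) = actAt hc X g U (X.tr h x) :=
  LinearMap.congr_fun (X.tr_conj g U V U V h h _ _) x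

theorem component_actAt {X Y : CohMackey.{w} R G} (φ : X ⟶ Y) (g : G) (U : Subgroup G)
    (x : X.obj U) : component φ U (actAt hc X g U x) = actAt hc Y g U (component φ U x) :=
  component_conj ..

theorem actAt_res_of_mem {U V : Subgroup G} (h : V ≤ U) (x : X.obj U) (a : G) (ha : a ∈ U) :
    actAt hc X a V (X.res h x) = X.res h x := by
  rw [← res_actAt, actAt_of_mem hc X ha]

/-- Elements of a coset of `U` act in the same way on elements invariant under `U`. -/
theorem actAt_eq_of_mk_eq {g h : G} {U V : Subgroup G} (hgh : (g : G ⧸ U) = h) {x : X.obj V}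
    (hx : ∀ a ∈ U, actAt hc X a V x = x) : actAt hc X g V x = actAt hc X h V x := by
  have h1 : h = g * (g⁻¹ * h) := by group
  rw [h1, actAt_mul, hx _ (QuotientGroup.eq.1 hgh)]

theorem tr_conj_res_of_eq (g : G) {U W A B : Subgroup G} (hB : B = U) (hA : A = U)
    (hAW : A ≤ W) (hBU : B ≤ U) (hAB : A = conjSubgroup g B) (hUW : U ≤ W) (x : X.obj U) :
    X.tr hAW (X.conj g B A hAB (X.res hBU x)) = actAt hc X g W (X.tr hUW x) := by
  subst hB hA
  rw [X.res_self_apply, ← tr_actAt]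
  rfl

/-- The Mackey formula for `U ≤ W ≤ V` in a commutative group. -/
theorem res_tr_of_le {U V W : Subgroup G} (hUW : U ≤ W) (hWV : W ≤ V) {S : Finset G}
    (hS : IsDoubleCosetSystem W V U S) (x : X.obj U) :
    X.res hWV (X.tr (hUW.trans hWV) x) = ∑ g ∈ S, actAt hc X g W (X.tr hUW x) := by
  have h := LinearMap.congr_fun (X.mackey V U W (hUW.trans hWV) hWV S hS) x
  rw [LinearMap.comp_apply] at h
  rw [h, LinearMap.sum_apply]
  refine Finset.sum_congr rfl fun g _ => ?_
  refine tr_conj_res_of_eq hc X g ?_ ?_ inf_le_right inf_le_left _ hUW x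
  · rw [← conjSubgroup_eq_self hc, inf_eq_left.2 hUW]
  · rw [← conjSubgroup_eq_self hc, inf_eq_left.2 hUW]

include hc in
theorem coef_mk_mul_of_mem {U V : Subgroup G} (f : ofSubgroup R V ⟶ ofSubgroup R U) (g : G)
    {a : G} (ha : a ∈ V) : coef f ((g * a : G) : G ⧸ U) = coef f (g : G ⧸ U) := by
  rw [hc, ← smul_eq_mul, ← MulAction.Quotient.smul_coe, coef_smul_of_mem f ha]

include hc in
theorem coef_mk_eq_of_mk_eq {U V : Subgroup G} (f : ofSubgroup R V ⟶ ofSubgroup R U) {g h : G}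
    (hgh : (g : G ⧸ V) = h) : coef f (g : G ⧸ U) = coef f (h : G ⧸ U) := by
  have h1 : h = g * (g⁻¹ * h) := by group
  rw [h1, coef_mk_mul_of_mem hc f g (QuotientGroup.eq.1 hgh)]

variable [Finite G]

/-- The image of `f : R[G/V] → R[G/U]` under the homomorphism `perm R U ⟶ X` given by `x ∈ X_U`,
for `V ≤ U`. -/
noncomputable def yonedaRes {U V : Subgroup G} (h : V ≤ U) (x : X.obj U) :
    (ofSubgroup R V ⟶ ofSubgroup R U) →ₗ[R] X.obj V :=
  ∑ z : G ⧸ U, (entryₗ ((1 : G) : G ⧸ V) z).smulRight (actAt hc X z.out V (X.res h x))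

/-- The image of `f : R[G/V] → R[G/U]` under the homomorphism `perm R U ⟶ X` given by `x ∈ X_U`,
for `U ≤ V`. -/
noncomputable def yonedaTr {U V : Subgroup G} (h : U ≤ V) (x : X.obj U) :
    (ofSubgroup R V ⟶ ofSubgroup R U) →ₗ[R] X.obj V :=
  ∑ z : G ⧸ V, (entryₗ ((1 : G) : G ⧸ V) (z.out : G ⧸ U)).smulRight
    (actAt hc X z.out V (X.tr h x))

theorem yonedaRes_apply {U V : Subgroup G} (h : V ≤ U) (x : X.obj U)
    (f : ofSubgroup R V ⟶ ofSubgroup R U) :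
    yonedaRes hc X h x f = ∑ z : G ⧸ U, coef f z • actAt hc X z.out V (X.res h x) := by
  rw [yonedaRes, LinearMap.sum_apply]
  rfl

theorem yonedaTr_apply {U V : Subgroup G} (h : U ≤ V) (x : X.obj U)
    (f : ofSubgroup R V ⟶ ofSubgroup R U) :
    yonedaTr hc X h x f =
      ∑ z : G ⧸ V, coef f (z.out : G ⧸ U) • actAt hc X z.out V (X.tr h x) := by
  rw [yonedaTr, LinearMap.sum_apply]
  rfl

theorem yonedaRes_res {U V V' : Subgroup G} (h : V' ≤ V) (hV : V ≤ U) (x : X.obj U)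
    (f : ofSubgroup R V ⟶ ofSubgroup R U) :
    yonedaRes hc X (h.trans hV) x (proj R h ≫ f) = X.res h (yonedaRes hc X hV x f) := by
  rw [yonedaRes_apply, yonedaRes_apply, map_sum]
  refine Finset.sum_congr rfl fun z _ => ?_
  rw [map_smul, res_actAt, res_res_apply]
  congr 1
  rw [coef, proj, entry_mapHom_comp]
  rfl

theorem yonedaRes_tr {U V V' : Subgroup G} (h : V' ≤ V) (hV : V ≤ U) (x : X.obj U)
    (f : ofSubgroup R V' ⟶ ofSubgroup R U) :
    yonedaRes hc X hV x (transfer R h ≫ f) = X.tr h (yonedaRes hc X (h.trans hV) x f) := by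
  classical
  rw [yonedaRes_apply, yonedaRes_apply, map_sum]
  refine Finset.sum_congr rfl fun z _ => ?_
  rw [map_smul, tr_actAt, ← X.res_res_apply h hV, tr_res_apply, map_nsmul, smul_comm,
    ← smul_assoc]
  congr 1
  rw [coef, transfer, entry_transferHom_comp, ← Finset.sum_filter, ← card_fiber_quotientMapOfLE h
    ((1 : G) : G ⧸ V), ← Finset.sum_const]
  refine Finset.sum_congr rfl fun y hy => ?_
  have hy := (Finset.mem_filter.1 hy).2
  induction y using QuotientGroup.induction_on with | _ a =>
  have ha : a ∈ V := by
    have h1 : ((a : G) : G ⧸ V) = (1 : G) := hy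
    rw [eq_comm, QuotientGroup.eq] at h1
    simpa using h1
  rw [entry_mk]
  congr 1
  induction z using QuotientGroup.induction_on with | _ b =>
  rw [MulAction.Quotient.smul_coe, smul_eq_mul, hc, QuotientGroup.eq]
  simpa using hV ha

theorem yonedaTr_tr {U V V' : Subgroup G} (h : V' ≤ V) (hV : U ≤ V') (x : X.obj U)
    (f : ofSubgroup R V' ⟶ ofSubgroup R U) :
    yonedaTr hc X (hV.trans h) x (transfer R h ≫ f) = X.tr h (yonedaTr hc X hV x f) := by
  classical
  rw [yonedaTr_apply, yonedaTr_apply, map_sum,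
    ← Finset.sum_fiberwise Finset.univ (Subgroup.quotientMapOfLE h)]
  refine Finset.sum_congr rfl fun w _ => ?_
  have h1 : ∀ z ∈ Finset.univ.filter (fun z : G ⧸ V' => Subgroup.quotientMapOfLE h z = w),
      X.tr h (coef f (z.out : G ⧸ U) • actAt hc X z.out V' (X.tr hV x)) =
        coef f (z.out : G ⧸ U) • actAt hc X w.out V (X.tr (hV.trans h) x) := by
    intro z hz
    rw [map_smul, tr_actAt, tr_tr_apply]
    congr 1
    refine actAt_eq_of_mk_eq hc X (U := V) ?_ fun a ha => actAt_of_mem hc X ha _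
    rw [QuotientGroup.out_eq', ← (Finset.mem_filter.1 hz).2]
    conv_rhs => rw [← QuotientGroup.out_eq' z]
    rfl
  rw [Finset.sum_congr rfl h1, ← Finset.sum_smul]
  congr 1
  rw [coef, transfer, entry_transferHom_comp, ← Finset.sum_filter]
  have hmem : ∀ (a : G ⧸ V') (b c : G ⧸ V), Subgroup.quotientMapOfLE h a = b →
      Subgroup.quotientMapOfLE h ((a.out⁻¹ * c.out : G) : G ⧸ V') =
        ((b.out⁻¹ * c.out : G) : G ⧸ V) := by
    rintro a _ c rfl
    change ((a.out⁻¹ * c.out : G) : G ⧸ V) = _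
    rw [QuotientGroup.eq]
    have h2 : a.out⁻¹ * (Subgroup.quotientMapOfLE h a).out ∈ V := by
      rw [← QuotientGroup.eq, QuotientGroup.out_eq']
      conv_rhs => rw [← QuotientGroup.out_eq' a]
      rfl
    have h3 : (a.out⁻¹ * c.out)⁻¹ * ((Subgroup.quotientMapOfLE h a).out⁻¹ * c.out) =
        (a.out⁻¹ * (Subgroup.quotientMapOfLE h a).out)⁻¹ := by
      rw [hc (a.out⁻¹) c.out, hc _ c.out]
      group
      rw [hc]
    rw [h3]
    exact V.inv_mem h2
  have hinv : ∀ (a : G ⧸ V') (c : G ⧸ V),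
      ((((a.out⁻¹ * c.out : G) : G ⧸ V').out⁻¹ * c.out : G) : G ⧸ V') = a := by
    intro a c
    have h2 : (a.out⁻¹ * c.out)⁻¹ * ((a.out⁻¹ * c.out : G) : G ⧸ V').out ∈ V' := by
      rw [← QuotientGroup.eq, QuotientGroup.out_eq']
    conv_rhs => rw [← QuotientGroup.out_eq' a]
    rw [QuotientGroup.eq]
    have h3 : (((a.out⁻¹ * c.out : G) : G ⧸ V').out⁻¹ * c.out)⁻¹ * a.out =
        (a.out⁻¹ * c.out)⁻¹ * ((a.out⁻¹ * c.out : G) : G ⧸ V').out := by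
      rw [mul_inv_rev, inv_inv, mul_inv_rev, inv_inv, mul_assoc, hc _ a.out, mul_assoc]
    rw [h3]
    exact h2
  refine Finset.sum_bij' (fun y _ => ((y.out⁻¹ * w.out : G) : G ⧸ V'))
    (fun z _ => ((z.out⁻¹ * w.out : G) : G ⧸ V')) ?_ ?_ ?_ ?_ ?_
  · intro y hy
    refine Finset.mem_filter.2 ⟨Finset.mem_univ _, ?_⟩
    rw [hmem y _ w (Finset.mem_filter.1 hy).2]
    conv_rhs => rw [← QuotientGroup.out_eq' w]
    rw [QuotientGroup.eq]
    have h2 : ((1 : G) : G ⧸ V).out ∈ V := by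
      have : (1 : G)⁻¹ * ((1 : G) : G ⧸ V).out ∈ V := by
        rw [← QuotientGroup.eq, QuotientGroup.out_eq']
      simpa using this
    have h3 : (((1 : G) : G ⧸ V).out⁻¹ * w.out)⁻¹ * w.out = ((1 : G) : G ⧸ V).out := by
      rw [mul_inv_rev, inv_inv, mul_assoc, hc _ w.out, inv_mul_cancel_left]
    rw [h3]
    exact h2
  · intro z hz
    refine Finset.mem_filter.2 ⟨Finset.mem_univ _, ?_⟩
    rw [hmem z _ w (Finset.mem_filter.1 hz).2, inv_mul_cancel]
  · intro y _
    exact hinv y w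
  · intro z _
    exact hinv z w
  · intro y hy
    conv_lhs => rw [← QuotientGroup.out_eq' y]
    rw [entry_mk, MulAction.Quotient.smul_coe, smul_eq_mul]
    exact coef_mk_eq_of_mk_eq hc f (QuotientGroup.out_eq' _).symm

theorem yonedaTr_res {U V V' : Subgroup G} (h : V' ≤ V) (hV : U ≤ V') (x : X.obj U)
    (f : ofSubgroup R V ⟶ ofSubgroup R U) :
    yonedaTr hc X hV x (proj R h ≫ f) = X.res h (yonedaTr hc X (hV.trans h) x f) := by
  classical
  obtain ⟨S, hS⟩ := exists_isDoubleCosetSystem h (hV.trans h)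
  rw [yonedaTr_apply, yonedaTr_apply, map_sum,
    ← Finset.sum_fiberwise Finset.univ (Subgroup.quotientMapOfLE h)]
  refine Finset.sum_congr rfl fun w _ => ?_
  have hcoef : ∀ y, coef (proj R h ≫ f) y = coef f y := fun y => by
    rw [coef, proj, entry_mapHom_comp]
    rfl
  have hV' : ∀ a ∈ V', actAt hc X a V' (X.tr hV x) = X.tr hV x := fun a ha =>
    actAt_of_mem hc X ha _
  have hmk : ∀ z : G ⧸ V', Subgroup.quotientMapOfLE h z = (z.out : G ⧸ V) := fun z => by
    conv_lhs => rw [← QuotientGroup.out_eq' z]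
    rfl
  rw [map_smul, res_actAt, res_tr_of_le hc X hV h hS, map_sum, Finset.smul_sum]
  symm
  refine Finset.sum_bij (fun s _ => ((w.out * s : G) : G ⧸ V')) ?_ ?_ ?_ ?_
  · intro s hs
    refine Finset.mem_filter.2 ⟨Finset.mem_univ _, ?_⟩
    change ((w.out * s : G) : G ⧸ V) = w
    conv_rhs => rw [← QuotientGroup.out_eq' w]
    rw [eq_comm, QuotientGroup.eq, inv_mul_cancel_left]
    exact hS.1 s hs
  · intro s hs t ht hst
    rw [QuotientGroup.eq] at hst
    obtain ⟨r, _, hr⟩ := hS.2 t (hS.1 t ht)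
    rw [hr t ⟨ht, DoubleCoset.mem_doubleCoset_self _ _ _⟩]
    refine hr s ⟨hs, DoubleCoset.mem_doubleCoset.2 ⟨s⁻¹ * t, ?_, 1, U.one_mem, ?_⟩⟩
    · simpa [mul_assoc] using hst
    · rw [hc (s⁻¹ * t), mul_inv_cancel_left, mul_one]
  · intro z hz
    have hz := (Finset.mem_filter.1 hz).2
    have h1 : w.out⁻¹ * z.out ∈ V := by
      rw [← QuotientGroup.eq, ← hmk, hz, QuotientGroup.out_eq']
    obtain ⟨s, ⟨hs, hs'⟩, _⟩ := hS.2 _ h1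
    refine ⟨s, hs, ?_⟩
    obtain ⟨a, ha, b, hb, hab⟩ := DoubleCoset.mem_doubleCoset.1 hs'
    conv_rhs => rw [← QuotientGroup.out_eq' z]
    rw [QuotientGroup.eq]
    have h2 : (w.out * s)⁻¹ * z.out = a * b := by
      have : z.out = w.out * (a * s * b) := by rw [← hab, mul_inv_cancel_left]
      rw [this, hc a s]
      group
    rw [h2]
    exact V'.mul_mem ha (hV hb)
  · intro s hs
    rw [hcoef, ← actAt_mul]
    have hz : (((w.out * s : G) : G ⧸ V').out : G ⧸ V) = w.out := by
      rw [← hmk]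
      change ((w.out * s : G) : G ⧸ V) = _
      rw [eq_comm, QuotientGroup.eq, inv_mul_cancel_left]
      exact hS.1 s hs
    rw [coef_mk_eq_of_mk_eq hc f hz]
    congr 1
    exact actAt_eq_of_mk_eq hc X (QuotientGroup.out_eq' _).symm hV'

theorem coef_conjHom {U V : Subgroup G} (g : G) (h : V = conjSubgroup g V)
    (f : ofSubgroup R V ⟶ ofSubgroup R U) (y : G ⧸ U) :
    coef (conjHom R g V V h ≫ f) y = coef f (g⁻¹ • y) := by
  rw [coef, conjHom, entry_mapHom_comp, cosetConj_mk, one_mul, entry_mk]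

theorem yonedaRes_conj {U V : Subgroup G} (g : G) (hV : V ≤ U) (h : V = conjSubgroup g V)
    (x : X.obj U) (f : ofSubgroup R V ⟶ ofSubgroup R U) :
    yonedaRes hc X hV x (conjHom R g V V h ≫ f) = actAt hc X g V (yonedaRes hc X hV x f) := by
  rw [yonedaRes_apply, yonedaRes_apply, map_sum]
  symm
  refine Fintype.sum_equiv (MulAction.toPerm g) _ _ fun z => ?_
  rw [map_smul, ← actAt_mul, coef_conjHom, MulAction.toPerm_apply, inv_smul_smul]
  congr 1
  refine actAt_eq_of_mk_eq hc X (U := U) ?_ (actAt_res_of_mem hc X hV x)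
  rw [QuotientGroup.out_eq', ← smul_eq_mul, ← MulAction.Quotient.smul_coe, QuotientGroup.out_eq']

theorem yonedaTr_conj {U V : Subgroup G} (g : G) (hV : U ≤ V) (h : V = conjSubgroup g V)
    (x : X.obj U) (f : ofSubgroup R V ⟶ ofSubgroup R U) :
    yonedaTr hc X hV x (conjHom R g V V h ≫ f) = actAt hc X g V (yonedaTr hc X hV x f) := by
  rw [yonedaTr_apply, yonedaTr_apply, map_sum]
  symm
  refine Fintype.sum_equiv (MulAction.toPerm g) _ _ fun z => ?_
  have hz : ((g * z.out : G) : G ⧸ V) = ((g • z).out : G) := by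
    rw [QuotientGroup.out_eq', ← smul_eq_mul, ← MulAction.Quotient.smul_coe, QuotientGroup.out_eq']
  rw [map_smul, ← actAt_mul, coef_conjHom, MulAction.toPerm_apply, MulAction.Quotient.smul_coe,
    smul_eq_mul, actAt_eq_of_mk_eq hc X hz fun a ha => actAt_of_mem hc X ha _]
  congr 1
  refine coef_mk_eq_of_mk_eq hc f ?_
  rw [← smul_eq_mul, ← MulAction.Quotient.smul_coe, ← hz, MulAction.Quotient.smul_coe, smul_eq_mul,
    inv_mul_cancel_left]

theorem yonedaRes_eq_yonedaTr {U : Subgroup G} (h h' : U ≤ U) (x : X.obj U) :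
    yonedaRes hc X h x = yonedaTr hc X h' x := LinearMap.ext fun f => by
  rw [yonedaRes_apply, yonedaTr_apply]
  refine Finset.sum_congr rfl fun z _ => ?_
  rw [QuotientGroup.out_eq', res_self_apply, tr_self_apply]

variable (hchain : ∀ U V : Subgroup G, U ≤ V ∨ V ≤ U)

open Classical in
/-- The components of the homomorphism `perm R U ⟶ X` given by an element of `X_U`. -/
noncomputable def yonedaApp (U : Subgroup G) (x : X.obj U) (V : Subgroup G) :
    (ofSubgroup R V ⟶ ofSubgroup R U) →ₗ[R] X.obj V :=
  if h : V ≤ U then yonedaRes hc X h x else yonedaTr hc X ((hchain U V).resolve_right h) x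

theorem yonedaApp_of_le {U V : Subgroup G} (h : V ≤ U) (x : X.obj U) :
    yonedaApp hc X hchain U x V = yonedaRes hc X h x := dif_pos h

theorem yonedaApp_of_ge {U V : Subgroup G} (h : U ≤ V) (x : X.obj U) :
    yonedaApp hc X hchain U x V = yonedaTr hc X h x := by
  by_cases h' : V ≤ U
  · obtain rfl := le_antisymm h h'
    rw [yonedaApp_of_le hc X hchain h', yonedaRes_eq_yonedaTr]
  · exact dif_neg h'

include hc hchain in
/-- Yoneda's lemma, existence: every element of `X_U` is the image of the identity of `R[G/U]` under
a homomorphism `perm R U ⟶ X`. -/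
theorem exists_perm_hom {X : CohMackey.{max u v} R G} (U : Subgroup G) (x : X.obj U) :
    ∃ φ : perm R U ⟶ X, component φ U (permMk (𝟙 _)) = x := by
  refine ⟨homMk (yonedaApp hc X hchain U x) ?_ ?_ ?_, ?_⟩
  · intro V V' h f
    change yonedaApp hc X hchain U x V' (proj R h ≫ permHom f) = _
    rcases hchain V U with h1 | h1
    · rw [yonedaApp_of_le hc X hchain h1, yonedaApp_of_le hc X hchain (h.trans h1)]
      exact yonedaRes_res hc X h h1 x f
    rcases hchain U V' with h2 | h2
    · rw [yonedaApp_of_ge hc X hchain h1, yonedaApp_of_ge hc X hchain h2]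
      exact yonedaTr_res hc X h h2 x f
    · rw [yonedaApp_of_ge hc X hchain h1, yonedaApp_of_le hc X hchain h2,
        ← proj_proj h2 h1, Category.assoc, yonedaRes_res hc X h2 le_rfl,
        yonedaRes_eq_yonedaTr hc X le_rfl le_rfl, yonedaTr_res hc X h1 le_rfl, res_res_apply]
      rfl
  · intro V V' h f
    change yonedaApp hc X hchain U x V (transfer R h ≫ permHom f) = _
    rcases hchain V U with h1 | h1
    · rw [yonedaApp_of_le hc X hchain h1, yonedaApp_of_le hc X hchain (h.trans h1)]
      exact yonedaRes_tr hc X h h1 x f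
    rcases hchain U V' with h2 | h2
    · rw [yonedaApp_of_ge hc X hchain h1, yonedaApp_of_ge hc X hchain h2]
      exact yonedaTr_tr hc X h h2 x f
    · rw [yonedaApp_of_ge hc X hchain h1, yonedaApp_of_le hc X hchain h2,
        ← transfer_transfer h2 h1, Category.assoc, yonedaTr_tr hc X h1 le_rfl,
        ← yonedaRes_eq_yonedaTr hc X le_rfl le_rfl, yonedaRes_tr hc X h2 le_rfl, tr_tr_apply]
      rfl
  · intro g V V' h f
    obtain rfl : V' = V := h.trans (conjSubgroup_eq_self hc g V).symm
    change yonedaApp hc X hchain U x V' (conjHom R g V' V' h ≫ permHom f) = _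
    rcases hchain V' U with h1 | h1
    · rw [yonedaApp_of_le hc X hchain h1]
      exact yonedaRes_conj hc X g h1 h x f
    · rw [yonedaApp_of_ge hc X hchain h1]
      exact yonedaTr_conj hc X g h1 h x f
  · classical
    change yonedaApp hc X hchain U x U (𝟙 _) = x
    rw [yonedaApp_of_le hc X hchain le_rfl, yonedaRes_apply, Finset.sum_eq_single ((1 : G) : G ⧸ U)]
    · rw [coef, entry_id, if_pos rfl, one_smul, res_self_apply, actAt_of_mem]
      have : (1 : G)⁻¹ * ((1 : G) : G ⧸ U).out ∈ U := by
        rw [← QuotientGroup.eq, QuotientGroup.out_eq']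
      simpa using this
    · intro z _ hz
      rw [coef, entry_id, if_neg (Ne.symm hz), zero_smul]
    · intro h
      exact absurd (Finset.mem_univ _) h

open Classical in
theorem coef_proj {U V : Subgroup G} (h : V ≤ U) (y : G ⧸ U) :
    coef (proj R h) y = if ((1 : G) : G ⧸ U) = y then 1 else 0 := entry_mapHom _ _ _ _

open Classical in
theorem coef_transfer {U V : Subgroup G} (h : U ≤ V) (y : G ⧸ U) :
    coef (transfer R h) y = if Subgroup.quotientMapOfLE h y = ((1 : G) : G ⧸ V) then 1 else 0 :=
  entry_transferHom _ _ _ _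

/-- The identity of `R[G/U]` generates `perm R U`. -/
theorem yonedaApp_permMk_id (U V : Subgroup G) (f : ofSubgroup R V ⟶ ofSubgroup R U) :
    yonedaApp hc (perm R U) hchain U (permMk (𝟙 _)) V f = permMk f := by
  classical
  refine coef_ext (f := permHom (yonedaApp hc (perm R U) hchain U (permMk (𝟙 _)) V f)) fun y => ?_
  have hsum : ∀ {ι : Type v} [Fintype ι] (F : ι → (perm R U).obj V),
      coef (permHom (∑ i, F i)) y = ∑ i, coef (permHom (F i)) y := fun F =>
    map_sum (entryₗ ((1 : G) : G ⧸ V) y) _ _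
  change _ = coef f y
  rcases hchain V U with h1 | h1
  · have hterm : ∀ z : G ⧸ U, coef (permHom (coef f z •
        actAt hc (perm R U) z.out V ((perm R U).res h1 (permMk (𝟙 _))))) y =
          coef f z * if y = z then 1 else 0 := fun z => by
      change coef f z * coef (conjHom R z.out V V _ ≫ proj R h1 ≫ 𝟙 _) y = _
      rw [coef_conjHom, Category.comp_id, coef_proj]
      simp only [eq_comm (a := ((1 : G) : G ⧸ U)), inv_out_smul_eq_iff]
    rw [yonedaApp_of_le hc _ hchain h1, yonedaRes_apply, hsum]
    simp [hterm]
  · have hterm : ∀ z : G ⧸ V, coef (permHom (coef f (z.out : G ⧸ U) •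
        actAt hc (perm R U) z.out V ((perm R U).tr h1 (permMk (𝟙 _))))) y =
          coef f (z.out : G ⧸ U) * if Subgroup.quotientMapOfLE h1 y = z then 1 else 0 := fun z => by
      change coef f (z.out : G ⧸ U) * coef (conjHom R z.out V V _ ≫ transfer R h1 ≫ 𝟙 _) y = _
      rw [coef_conjHom, Category.comp_id, coef_transfer, quotientMapOfLE_smul]
      simp only [inv_out_smul_eq_iff]
    rw [yonedaApp_of_ge hc _ hchain h1, yonedaTr_apply, hsum]
    simp only [hterm, mul_ite, mul_one, mul_zero, Finset.sum_ite_eq, Finset.mem_univ, if_true]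
    induction y using QuotientGroup.induction_on with | _ a =>
    exact coef_mk_eq_of_mk_eq hc f (QuotientGroup.out_eq' _)

theorem component_yonedaApp {X Y : CohMackey.{w} R G} (φ : X ⟶ Y) (U : Subgroup G) (x : X.obj U)
    (V : Subgroup G) (f : ofSubgroup R V ⟶ ofSubgroup R U) :
    component φ V (yonedaApp hc X hchain U x V f) =
      yonedaApp hc Y hchain U (component φ U x) V f := by
  rcases hchain V U with h | h
  · rw [yonedaApp_of_le hc X hchain h, yonedaApp_of_le hc Y hchain h, yonedaRes_apply,
      yonedaRes_apply, map_sum]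
    exact Finset.sum_congr rfl fun z _ => by rw [map_smul, component_actAt, component_res]
  · rw [yonedaApp_of_ge hc X hchain h, yonedaApp_of_ge hc Y hchain h, yonedaTr_apply,
      yonedaTr_apply, map_sum]
    exact Finset.sum_congr rfl fun z _ => by rw [map_smul, component_actAt, component_tr]

theorem component_perm {X : CohMackey.{max u v} R G} {U : Subgroup G} (φ : perm R U ⟶ X)
    (V : Subgroup G) (f : (perm R U).obj V) :
    component φ V f = yonedaApp hc X hchain U (component φ U (permMk (𝟙 _))) V (permHom f) := by
  rw [← component_yonedaApp hc hchain φ, yonedaApp_permMk_id]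
  rfl

include hc hchain in
/-- Yoneda's lemma, uniqueness. -/
theorem perm_hom_ext {X : CohMackey.{max u v} R G} {U : Subgroup G} {φ ψ : perm R U ⟶ X}
    (h : component φ U (permMk (𝟙 _)) = component ψ U (permMk (𝟙 _))) : φ = ψ :=
  hom_ext fun V f => by
    rw [component_perm hc hchain φ, component_perm hc hchain ψ, h]

include hc hchain in
theorem projective_perm (U : Subgroup G) : Projective (perm R U) where
  factors {E X} f e he := by
    obtain ⟨y, hy⟩ := surjective_of_epi e U (component f U (permMk (𝟙 _)))
    obtain ⟨φ, hφ⟩ := exists_perm_hom hc hchain U y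
    exact ⟨φ, perm_hom_ext hc hchain (by rw [component_comp, hφ, hy])⟩

end Commutative

end CohMackey

/-! ### Subgroups of cyclic `p`-groups -/

theorem pow_mem_iff_index_dvd {G : Type v} [Group G] [Finite G] {σ : G}
    (hσ : ∀ g : G, ∃ k : ℕ, g = σ ^ k) (U : Subgroup G) (k : ℕ) : σ ^ k ∈ U ↔ U.index ∣ k := by
  have hc : ∀ a b : G, a * b = b * a := fun a b => by
    obtain ⟨k, rfl⟩ := hσ a
    obtain ⟨l, rfl⟩ := hσ b
    rw [← pow_add, ← pow_add, add_comm]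
  have : U.Normal := ⟨fun x hx g => by rwa [hc g x, mul_inv_cancel_right]⟩
  have h : orderOf (σ : G ⧸ U) = U.index := by
    refine orderOf_eq_card_of_forall_mem_zpowers fun y => ?_
    induction y using QuotientGroup.induction_on with | _ a =>
    obtain ⟨k, rfl⟩ := hσ a
    exact ⟨k, by simp⟩
  rw [← h, orderOf_dvd_iff_pow_eq_one, ← QuotientGroup.mk_pow, QuotientGroup.eq_one_iff]

/-- The subgroups of a cyclic `p`-group form a chain. -/
theorem le_or_le_of_card_eq_pow {G : Type v} [Group G] [Finite G] {p n : ℕ} {σ : G}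
    (hp : p.Prime) (hσ : ∀ g : G, ∃ k : ℕ, g = σ ^ k) (hn : Nat.card G = p ^ n)
    (U V : Subgroup G) : U ≤ V ∨ V ≤ U := by
  have key : ∀ U V : Subgroup G, U.index ∣ V.index → V ≤ U := fun U V h x hx => by
    obtain ⟨k, rfl⟩ := hσ x
    rw [pow_mem_iff_index_dvd hσ] at hx ⊢
    exact h.trans hx
  obtain ⟨a, _, ha⟩ := (Nat.dvd_prime_pow hp).1 (hn ▸ U.index_dvd_card)
  obtain ⟨b, _, hb⟩ := (Nat.dvd_prime_pow hp).1 (hn ▸ V.index_dvd_card)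
  rcases le_total a b with h | h
  · exact Or.inr (key _ _ (ha ▸ hb ▸ pow_dvd_pow p h))
  · exact Or.inl (key _ _ (ha ▸ hb ▸ pow_dvd_pow p h))

/-! ### Periodic sequences -/

/-- A sequence whose sums along arithmetic progressions of length `q` and difference `m` vanish is
the difference of a sequence of period `m * q`. -/
theorem exists_sub_eq_of_sum_eq_zero {M : Type*} [AddCommGroup M] {A : ℕ → M} {m q : ℕ} (hm : 0 < m)
    (hA : ∀ k, ∑ l ∈ Finset.range q, A (k + m * l) = 0) :
    ∃ B : ℕ → M, (∀ k, B (k + m) - B k = A k) ∧ ∀ k, B (k + m * q) = B k := by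
  refine ⟨fun k => ∑ l ∈ Finset.range (k / m), A (k % m + m * l), fun k => ?_, fun k => ?_⟩
  · dsimp only
    rw [Nat.add_div_right _ hm, Nat.add_mod_right, Finset.sum_range_succ, add_sub_cancel_left,
      Nat.mod_add_div]
  · dsimp only
    rw [Nat.add_mul_div_left _ _ hm, Nat.add_mul_mod_self_left, Finset.sum_range_add,
      add_eq_left]
    refine (Finset.sum_congr rfl fun l _ => ?_).trans (hA k)
    congr 1
    conv_rhs => rw [← Nat.mod_add_div k m]
    ring

theorem sum_range_mul_of_periodic {M : Type*} [AddCommMonoid M] {A : ℕ → M} {q : ℕ}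
    (hA : Function.Periodic A q) (c : ℕ) :
    ∑ l ∈ Finset.range (c * q), A l = c • ∑ l ∈ Finset.range q, A l := by
  induction c with
  | zero => simp
  | succ c ih =>
    rw [add_mul, one_mul, Finset.sum_range_add, ih, succ_nsmul]
    congr 1
    refine Finset.sum_congr rfl fun l _ => ?_
    have := hA.nat_mul c l
    rwa [Nat.cast_id, add_comm] at this

/-! ### The represented functors are functors of fixed points of coflasque modules -/

namespace CohMackey

attribute [local instance] cosetFintype

open MackeyCat

variable {R : Type u} {G : Type v} [CommRing R] [Group G] [Finite G]

theorem coef_proj_comp {U V V' : Subgroup G} (h : V' ≤ V) (f : ofSubgroup R V ⟶ ofSubgroup R U)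
    (y : G ⧸ U) : coef (proj R h ≫ f) y = coef f y := entry_mapHom_comp _ _ _ _ _

theorem coef_permHom_act {U : Subgroup G} (g : G) (f : (perm R U).obj ⊥) (y : G ⧸ U) :
    coef (permHom ((perm R U).act g f)) y = coef (permHom f) (g⁻¹ • y) :=
  coef_conjHom ..

theorem perm_ext {U V : Subgroup G} {f f' : (perm R U).obj V}
    (h : ∀ y, coef (permHom f) y = coef (permHom f') y) : f = f' :=
  coef_ext (f := permHom f) (f' := permHom f') h

theorem exists_coef_eq {U V : Subgroup G} (c : G ⧸ U → R) (hc : ∀ g ∈ V, ∀ y, c (g • y) = c y) :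
    ∃ f : (perm R U).obj V, ∀ y, coef (permHom f) y = c y := by
  have hm : ∀ (g : G) (w : G ⧸ V) (y : G ⧸ U), c ((g • w).out⁻¹ • g • y) = c (w.out⁻¹ • y) := by
    intro g w y
    have h : (g • w).out⁻¹ * g * w.out ∈ V := by
      rw [mul_assoc, ← QuotientGroup.eq, QuotientGroup.out_eq', ← smul_eq_mul,
        ← MulAction.Quotient.smul_coe, QuotientGroup.out_eq']
    rw [← hc _ h (w.out⁻¹ • y), smul_smul, smul_smul, mul_inv_cancel_right]
  refine ⟨permMk (ofEntry (fun w y => c (w.out⁻¹ • y)) hm), fun y => ?_⟩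
  refine (entry_ofEntry (fun w y => c (w.out⁻¹ • y)) hm _ y).trans (hc _ (V.inv_mem ?_) y)
  have : (1 : G)⁻¹ * ((1 : G) : G ⧸ V).out ∈ V := by
    rw [← QuotientGroup.eq, QuotientGroup.out_eq']
  simpa using this

theorem isFixed_perm (U : Subgroup G) : (perm R U).IsFixed := fun V => by
  refine ⟨fun f f' h => perm_ext fun y => ?_, fun a ha => ?_⟩
  · have := congrArg (fun f => coef (permHom f) y) h
    simpa only [permHom_res, coef_proj_comp] using this
  · obtain ⟨b, hb⟩ := exists_coef_eq (V := V) (coef (permHom a)) fun g hg y => by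
      rw [← inv_inv g, ← coef_permHom_act, ha _ (V.inv_mem hg)]
    exact ⟨b, perm_ext fun y => by rw [permHom_res, coef_proj_comp, hb]⟩

variable (R) in
theorem free_perm [IsDomain R] [IsPrincipalIdealRing R] (U : Subgroup G) :
    Module.Free R ((perm R U).obj ⊥) := by
  let c : (perm R U).obj ⊥ →ₗ[R] (G ⧸ U → R) := LinearMap.pi fun y => entryₗ ((1 : G) : G ⧸ _) y
  exact Module.Free.of_injective_of_projective c fun f f' h => perm_ext fun y => congrFun h y

variable (R) in
/-- The represented functors are functors of fixed points of coflasque modules: a function on `G/U`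
whose sums over the orbits of a subgroup vanish is a coboundary for that subgroup. -/
theorem isCoflasqueFixed_perm [IsDomain R] [IsPrincipalIdealRing R] [CharZero R] {p n : ℕ} {σ : G}
    (hp : p.Prime) (hσ : ∀ g : G, ∃ k : ℕ, g = σ ^ k) (hn : Nat.card G = p ^ n) (U : Subgroup G) :
    (perm R U).IsCoflasqueFixed p n σ := by
  refine ⟨isFixed_perm U, free_perm R U, fun j hj x hx => ?_⟩
  obtain ⟨i, hi, hU⟩ := (Nat.dvd_prime_pow hp).1 (hn ▸ U.index_dvd_card)
  -- the coefficients of `x`, as a sequence of period `p ^ i`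
  let A : ℕ → R := fun k => coef (permHom x) ((σ ^ k : G) : G ⧸ U)
  have hmk : ∀ k l : ℕ, ((σ ^ k : G) : G ⧸ U) = ((σ ^ l : G) : G ⧸ U) ↔ k ≡ l [MOD p ^ i] := by
    have key : ∀ k l : ℕ, k ≤ l →
        (((σ ^ k : G) : G ⧸ U) = ((σ ^ l : G) : G ⧸ U) ↔ k ≡ l [MOD p ^ i]) := fun k l h => by
      rw [QuotientGroup.eq, ← Nat.add_sub_of_le h, pow_add, inv_mul_cancel_left,
        pow_mem_iff_index_dvd hσ, hU, Nat.add_sub_of_le h, Nat.modEq_iff_dvd' h]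
    intro k l
    rcases le_total k l with h | h
    · exact key k l h
    · rw [eq_comm, key l k h, Nat.ModEq.comm]
  have hper : ∀ k l, k ≡ l [MOD p ^ i] → A k = A l := fun k l h =>
    congrArg (coef (permHom x)) ((hmk k l).2 h)
  have hsum : ∀ k, ∑ l ∈ Finset.range (p ^ (n - j)), A (k + p ^ j * l) = 0 := by
    intro k
    have h := congrArg (fun f => coef (permHom f)
      ((σ ^ (k + p ^ j * (p ^ (n - j) - 1)) : G) : G ⧸ U)) hx
    have h0 : ∀ y, coef (permHom (0 : (perm R U).obj ⊥)) y = 0 := fun y => rfl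
    have h1 : ∀ (F : ℕ → (perm R U).obj ⊥) s y,
        coef (permHom (∑ l ∈ s, F l)) y = ∑ l ∈ s, coef (permHom (F l)) y := fun F s y =>
      map_sum (entryₗ ((1 : G) : G ⧸ (⊥ : Subgroup G)) y) _ _
    rw [h0, h1, ← Finset.sum_range_reflect] at h
    refine (Finset.sum_congr rfl fun l hl => ?_).trans h
    have hl := Finset.mem_range.1 hl
    rw [coef_permHom_act, MulAction.Quotient.smul_coe, smul_eq_mul, ← pow_mul]
    refine congrArg (fun g : G => coef (permHom x) (g : G ⧸ U)) ?_
    rw [eq_inv_mul_iff_mul_eq, ← pow_add]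
    congr 1
    have : p ^ (n - j) - 1 = (p ^ (n - j) - 1 - l) + l := by omega
    conv_rhs => rw [this]
    ring
  have hp0 : (p : R) ≠ 0 := Nat.cast_ne_zero.2 hp.ne_zero
  rcases le_or_gt i j with hij | hij
  · refine ⟨0, ?_⟩
    rw [map_zero, sub_zero]
    refine (perm_ext fun y => ?_).symm
    induction y using QuotientGroup.induction_on with | _ a =>
    obtain ⟨k, rfl⟩ := hσ a
    have h := hsum k
    rw [Finset.sum_congr rfl fun l _ => hper (k + p ^ j * l) k ?_, Finset.sum_const,
      Finset.card_range, nsmul_eq_mul, Nat.cast_pow] at h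
    · exact (mul_eq_zero.1 h).resolve_left (pow_ne_zero _ hp0)
    · exact Nat.add_modEq_left_iff.2 ((pow_dvd_pow p hij).mul_right l)
  · have hsum' : ∀ k, ∑ l ∈ Finset.range (p ^ (i - j)), A (k + p ^ j * l) = 0 := by
      intro k
      have hq : Function.Periodic (fun l => A (k + p ^ j * l)) (p ^ (i - j)) := fun l => by
        refine hper _ _ ?_
        rw [mul_add, ← pow_add, Nat.add_sub_of_le hij.le, ← add_assoc]
        exact Nat.add_modEq_right
      have h := hsum k
      rw [show p ^ (n - j) = p ^ (n - i) * p ^ (i - j) by rw [← pow_add]; congr 1; omega,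
        sum_range_mul_of_periodic hq, nsmul_eq_mul, Nat.cast_pow] at h
      exact (mul_eq_zero.1 h).resolve_left (pow_ne_zero _ hp0)
    obtain ⟨B, hB, hB'⟩ := exists_sub_eq_of_sum_eq_zero (pow_pos hp.pos j) hsum'
    rw [← pow_add, Nat.add_sub_of_le hij.le] at hB'
    have hBper : ∀ k l, k ≡ l [MOD p ^ i] → B k = B l := fun k l h => by
      rw [← Function.Periodic.map_mod_nat hB' k, ← Function.Periodic.map_mod_nat hB' l, h]
    have hlog : ∀ y : G ⧸ U, ∃ k : ℕ, ((σ ^ k : G) : G ⧸ U) = y := fun y => by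
      induction y using QuotientGroup.induction_on with | _ a =>
      obtain ⟨k, rfl⟩ := hσ a
      exact ⟨k, rfl⟩
    choose log hlog using hlog
    have hb : ∀ k, B (log ((σ ^ k : G) : G ⧸ U)) = B k := fun k =>
      hBper _ _ ((hmk _ _).1 (hlog _))
    obtain ⟨f, hf⟩ := exists_coef_eq (V := ⊥) (fun y : G ⧸ U => -B (log (σ ^ p ^ j • y)))
      fun g hg y => by rw [Subgroup.mem_bot.1 hg, one_smul]
    refine ⟨f, perm_ext fun y => ?_⟩
    have hsub : coef (permHom ((perm R U).act (σ ^ p ^ j) f - f)) y =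
        coef (permHom ((perm R U).act (σ ^ p ^ j) f)) y - coef (permHom f) y :=
      map_sub (entryₗ ((1 : G) : G ⧸ (⊥ : Subgroup G)) y) _ _
    rw [hsub, coef_permHom_act, hf, hf, smul_inv_smul]
    obtain ⟨k, rfl⟩ : ∃ k : ℕ, ((σ ^ k : G) : G ⧸ U) = y := ⟨_, hlog y⟩
    rw [MulAction.Quotient.smul_coe, smul_eq_mul, ← pow_add, hb, hb, add_comm (p ^ j), neg_sub_neg,
      hB]

end CohMackey

/-- `σ` generates the group `G` of order `p ^ n`, where `p` is prime. -/
structure IsCyclicPGenerator {G : Type v} [Group G] (p n : ℕ) (σ : G) : Prop where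
  prime : p.Prime
  exists_pow : ∀ g : G, ∃ k : ℕ, g = σ ^ k
  card_eq : Nat.card G = p ^ n

namespace IsCyclicPGenerator

variable {G : Type v} [Group G] {p n : ℕ} {σ : G} (h : IsCyclicPGenerator p n σ)

include h

theorem mul_comm (a b : G) : a * b = b * a := by
  obtain ⟨k, rfl⟩ := h.exists_pow a
  obtain ⟨l, rfl⟩ := h.exists_pow b
  rw [← pow_add, ← pow_add, add_comm]

theorem pow_eq_one : σ ^ p ^ n = 1 := by rw [← h.card_eq, pow_card_eq_one']

variable [Finite G]

theorem le_or_le (U V : Subgroup G) : U ≤ V ∨ V ≤ U :=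
  le_or_le_of_card_eq_pow h.prime h.exists_pow h.card_eq U V

theorem exists_eq_zpowers (U : Subgroup G) : ∃ j ≤ n, U = Subgroup.zpowers (σ ^ p ^ j) := by
  obtain ⟨j, hj, hU⟩ := (Nat.dvd_prime_pow h.prime).1 (h.card_eq ▸ U.index_dvd_card)
  refine ⟨j, hj, le_antisymm (fun x hx => ?_) ?_⟩
  · obtain ⟨k, rfl⟩ := h.exists_pow x
    rw [pow_mem_iff_index_dvd h.exists_pow, hU] at hx
    obtain ⟨c, rfl⟩ := hx
    rw [pow_mul]
    exact Subgroup.npow_mem_zpowers _ _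
  · rw [Subgroup.zpowers_le, pow_mem_iff_index_dvd h.exists_pow, hU]

end IsCyclicPGenerator

theorem exists_isCyclicPGenerator {G : Type v} [Group G] [Finite G] [IsCyclic G] {p : ℕ}
    (hp : p.Prime) (hG : IsPGroup p G) : ∃ (n : ℕ) (σ : G), IsCyclicPGenerator p n σ := by
  have : Fact p.Prime := ⟨hp⟩
  obtain ⟨n, hn⟩ := IsPGroup.iff_card.1 hG
  obtain ⟨σ, hσ⟩ := IsCyclic.exists_monoid_generator (α := G)
  exact ⟨n, σ, hp, fun g => by
    obtain ⟨k, hk⟩ := Submonoid.mem_powers_iff _ _ |>.1 (hσ g)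
    exact ⟨k, hk.symm⟩, hn⟩

namespace CohMackey

attribute [local instance] cosetFintype

variable {R : Type u} {G : Type v} [CommRing R] [Group G]

/-! ### Projective functors over a cyclic `p`-group -/

theorem IsLattice.of_injective [IsDomain R] [IsPrincipalIdealRing R] {K P : CohMackey.{w} R G}
    (hP : P.IsLattice) (κ : K ⟶ P) (hκ : ∀ U, Function.Injective (component κ U)) :
    K.IsLattice := fun U => by
  obtain ⟨h1, h2⟩ := hP U
  have := Module.Free.of_injective_of_projective (component κ U) (hκ U)
  exact ⟨Module.Finite.of_injective (component κ U) (hκ U), inferInstance⟩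

section Cover

variable [Finite G] {p n : ℕ} {σ : G} [IsDomain R] [IsPrincipalIdealRing R] [CharZero R]

/-- Every functor is covered by a direct sum of functors represented by subgroups. -/
theorem exists_cover (h : IsCyclicPGenerator p n σ) (X : CohMackey.{max u v} R G) :
    ∃ (Q : CohMackey.{max u v} R G) (π : Q ⟶ X), Projective Q ∧ Q.IsCoflasqueFixed p n σ ∧
      ∀ U, Function.Surjective (component π U) := by
  classical
  have hex : ∀ i : Σ U, X.obj U, ∃ φ : perm R i.1 ⟶ X, component φ i.1 (permMk (𝟙 _)) = i.2 :=
    fun i => exists_perm_hom h.mul_comm h.le_or_le i.1 i.2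
  choose φ hφ using hex
  refine ⟨directSum fun i : Σ U, X.obj U => perm R i.1, directSumDesc φ,
    projective_directSum fun i => projective_perm h.mul_comm h.le_or_le i.1,
    IsCoflasqueFixed.directSum _ fun i =>
      isCoflasqueFixed_perm R h.prime h.exists_pow h.card_eq i.1, fun U x => ?_⟩
  refine ⟨component (directSumι (fun i : Σ U, X.obj U => perm R i.1) ⟨U, x⟩) U (permMk (𝟙 _)), ?_⟩
  rw [← component_comp, directSumι_desc]
  exact hφ ⟨U, x⟩

/-- Projective functors are functors of fixed points of coflasque modules. -/
theorem isCoflasqueFixed_of_projective (h : IsCyclicPGenerator p n σ) (P : CohMackey.{max u v} R G)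
    [Projective P] : P.IsCoflasqueFixed p n σ := by
  obtain ⟨Q, π, _, hQ, hπ⟩ := exists_cover h P
  obtain ⟨s, hs⟩ := exists_lift_of_projective π hπ (𝟙 P)
  exact hQ.of_retract s π hs

end Cover

section Dimension

variable [Finite G] {p n : ℕ} {σ : G} [IsDomain R] [IsDiscreteValuationRing R] [CharZero R]

/-- Functors of fixed points of coflasque modules are projective. -/
theorem IsCoflasqueFixed.projective_of_generator (h : IsCyclicPGenerator p n σ)
    (hR : IsLocalRing.maximalIdeal R = Ideal.span {(p : R)}) {K : CohMackey.{max u v} R G}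
    (hK : K.IsCoflasqueFixed p n σ) : Projective K := by
  obtain ⟨Q, π, _, hQ, hπ⟩ := exists_cover h K
  exact hK.projective h.prime hR h.exists_pow h.pow_eq_one π hπ hQ.isFixed

/-- On lattices, restriction maps are injective because their composite with transfer is
multiplication by an index. -/
theorem IsLattice.isIInjective {X : CohMackey.{w} R G} (hX : X.IsLattice) : X.IsIInjective := by
  intro U V hV x y hxy
  obtain ⟨_, _⟩ := hX U
  have : Module.Free R (X.obj U) := Module.free_of_flat_of_isLocalRing
  have h1 := X.tr_res_apply hV x
  rw [hxy, X.tr_res_apply, ← Nat.cast_smul_eq_nsmul R, ← Nat.cast_smul_eq_nsmul R] at h1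
  refine (smul_right_injective _ ?_ h1).symm
  have : V.relIndex U ≠ 0 := Subgroup.index_ne_zero_of_finite
  exact_mod_cast this

section Kernels

variable (h : IsCyclicPGenerator p n σ) (hR : IsLocalRing.maximalIdeal R = Ideal.span {(p : R)})
  {K P Y Z X : CohMackey.{max u v} R G}

include h hR

/-- Syzygies of functors of fixed points are projective. -/
theorem projective_of_exact_of_isFixed [Projective P] (κ : K ⟶ P) (ε : P ⟶ X)
    (hκ : ∀ U, Function.Injective (component κ U))
    (hex : ∀ U, Function.Exact (component κ U) (component ε U))
    (hε : ∀ U, Function.Surjective (component ε U)) (hX : X.IsFixed) : Projective K :=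
  ((isCoflasqueFixed_of_projective h P).of_exact_of_surjective κ ε hκ hex hε
    hX).projective_of_generator h hR

/-- Second syzygies of functors with injective restriction maps are projective. -/
theorem projective_of_exact_of_injective [Projective P] [Projective Y] (κ : K ⟶ P) (δ : P ⟶ Y)
    (ε : Y ⟶ X) (hκ : ∀ U, Function.Injective (component κ U))
    (hex : ∀ U, Function.Exact (component κ U) (component δ U))
    (hex' : ∀ U, Function.Exact (component δ U) (component ε U))
    (hX : ∀ U : Subgroup G, Function.Injective (X.res (bot_le : ⊥ ≤ U))) : Projective K :=
  ((isCoflasqueFixed_of_projective h P).of_exact_of_exact κ δ ε hκ hex hex'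
    (isCoflasqueFixed_of_projective h Y).isFixed hX).projective_of_generator h hR

/-- Third syzygies are projective. -/
theorem projective_of_exact [Projective P] [Projective Y] [Projective Z] (κ : K ⟶ P) (δ : P ⟶ Y)
    (ε : Y ⟶ Z) (hκ : ∀ U, Function.Injective (component κ U))
    (hex : ∀ U, Function.Exact (component κ U) (component δ U))
    (hex' : ∀ U, Function.Exact (component δ U) (component ε U)) : Projective K :=
  projective_of_exact_of_injective h hR κ δ ε hκ hex hex'
    fun U => ((isCoflasqueFixed_of_projective h Z).isFixed U).1

end Kernels

end Dimension

/-! ### Projective resolutions -/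

section Resolutions

variable {X K P : CohMackey.{w} R G}

theorem projective_of_subsingleton (h : ∀ U, Subsingleton (X.obj U)) : Projective X where
  factors {E Y} f e _ := by
    refine ⟨homMk (fun U => 0) (fun h x => ?_) (fun h x => ?_) (fun g U U' h x => ?_),
      hom_ext fun U x => ?_⟩
    · simp
    · simp
    · simp
    · rw [Subsingleton.elim x 0, map_zero, map_zero]

theorem hasProjectiveResolutionOfLength_zero [Projective X] :
    HasProjectiveResolutionOfLength (CohMackey.ev (R := R) (G := G)) X 0 := by
  have h0 : ∀ U, Subsingleton ((ker (𝟙 X)).obj U) := fun U => ⟨fun a b =>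
    component_kerι_injective (𝟙 X) U
      (((exact_kerι (𝟙 X) U _).2 ⟨a, rfl⟩).trans ((exact_kerι (𝟙 X) U _).2 ⟨b, rfl⟩).symm)⟩
  have hz : ∀ U (x : (ker (𝟙 X)).obj U), x = 0 := fun U x => (h0 U).elim _ _
  let Q : ℕ → CohMackey.{w} R G := fun k => k.casesOn X fun _ => ker (𝟙 X)
  let δ : ∀ k, Q (k + 1) ⟶ Q k := fun k => k.casesOn (kerι (𝟙 X)) fun _ => 𝟙 _
  refine ⟨Q, δ, 𝟙 X, fun k => ?_, fun U x => ⟨x, rfl⟩, fun U => exact_kerι (𝟙 X) U, fun k U => ?_,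
    fun k hk U => ?_⟩
  · cases k with
    | zero => exact ‹Projective X›
    | succ k => exact projective_of_subsingleton h0
  · intro x
    refine ⟨fun _ => ⟨x, rfl⟩, fun _ => ?_⟩
    rw [hz U x]
    cases k <;> exact map_zero _
  · cases k with
    | zero => exact absurd hk (lt_irrefl 0)
    | succ k => exact h0 U

theorem hasProjectiveResolutionOfLength_succ [Projective P] (κ : K ⟶ P) (ε : P ⟶ X)
    (hκ : ∀ U, Function.Injective (component κ U))
    (hex : ∀ U, Function.Exact (component κ U) (component ε U))
    (hε : ∀ U, Function.Surjective (component ε U)) {d : ℕ}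
    (hK : HasProjectiveResolutionOfLength (CohMackey.ev (R := R) (G := G)) K d) :
    HasProjectiveResolutionOfLength (CohMackey.ev (R := R) (G := G)) X (d + 1) := by
  obtain ⟨Q, δ, π, h1, h2, h3, h4, h5⟩ := hK
  let Q' : ℕ → CohMackey.{w} R G := fun k => k.casesOn P Q
  let δ' : ∀ k, Q' (k + 1) ⟶ Q' k := fun k => k.casesOn (π ≫ κ) δ
  refine ⟨Q', δ', ε, fun k => ?_, hε, fun U x => ?_, fun k U => ?_, fun k hk U => ?_⟩
  · cases k with
    | zero => assumption
    | succ k => exact h1 k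
  · refine (hex U x).trans ⟨?_, ?_⟩
    · rintro ⟨y, rfl⟩
      obtain ⟨z, rfl⟩ := h2 U y
      exact ⟨z, rfl⟩
    · rintro ⟨z, rfl⟩
      exact ⟨component π U z, rfl⟩
  · cases k with
    | zero =>
      intro x
      refine Iff.trans ?_ (h3 U x)
      change component κ U (component π U x) = 0 ↔ component π U x = 0
      rw [map_eq_zero_iff _ (hκ U)]
    | succ k => exact h4 k U
  · cases k with
    | zero => omega
    | succ k => exact h5 k (by omega) U

end Resolutions

section UpperBounds

variable [Finite G] {p n : ℕ} {σ : G} [IsDomain R] [IsDiscreteValuationRing R] [CharZero R]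
  (h : IsCyclicPGenerator p n σ) (hR : IsLocalRing.maximalIdeal R = Ideal.span {(p : R)})

include h hR

theorem hasProjectiveResolutionOfLength_one {X : CohMackey.{max u v} R G} (hX : X.IsFixed) :
    HasProjectiveResolutionOfLength (CohMackey.ev (R := R) (G := G)) X 1 := by
  obtain ⟨P, ε, _, _, hε⟩ := exists_cover h X
  have := projective_of_exact_of_isFixed h hR (kerι ε) ε (component_kerι_injective ε)
    (exact_kerι ε) hε hX
  exact hasProjectiveResolutionOfLength_succ (kerι ε) ε (component_kerι_injective ε)
    (exact_kerι ε) hε hasProjectiveResolutionOfLength_zero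

theorem hasProjectiveResolutionOfLength_two {X : CohMackey.{max u v} R G}
    (hX : ∀ U : Subgroup G, Function.Injective (X.res (bot_le : ⊥ ≤ U))) :
    HasProjectiveResolutionOfLength (CohMackey.ev (R := R) (G := G)) X 2 := by
  obtain ⟨P, ε, _, hP, hε⟩ := exists_cover h X
  refine hasProjectiveResolutionOfLength_succ (kerι ε) ε (component_kerι_injective ε)
    (exact_kerι ε) hε (hasProjectiveResolutionOfLength_one h hR fun U => ⟨fun x y hxy => ?_,
      fun a ha => ?_⟩)
  · apply component_kerι_injective
    apply (hP.isFixed U).1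
    rw [← component_res, ← component_res, hxy]
  -- the kernel of a homomorphism from a functor of fixed points to a functor with injective
  -- restriction maps is again a functor of fixed points
  · obtain ⟨b, hb⟩ := (hP.isFixed U).2 (component (kerι ε) ⊥ a) fun x hx => by
      rw [← component_act, ha x hx]
    obtain ⟨c, rfl⟩ := (exact_kerι ε U b).1 (hX U (by
      rw [← component_res, hb, map_zero]
      exact (exact_kerι ε ⊥).apply_apply_eq_zero a))
    exact ⟨c, component_kerι_injective ε ⊥ (by rw [component_res, hb])⟩

theorem hasProjectiveResolutionOfLength_three (X : CohMackey.{max u v} R G) :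
    HasProjectiveResolutionOfLength (CohMackey.ev (R := R) (G := G)) X 3 := by
  obtain ⟨P, ε, _, hP, hε⟩ := exists_cover h X
  refine hasProjectiveResolutionOfLength_succ (kerι ε) ε (component_kerι_injective ε)
    (exact_kerι ε) hε (hasProjectiveResolutionOfLength_two h hR fun U x y hxy => ?_)
  apply component_kerι_injective
  apply (hP.isFixed U).1
  rw [← component_res, ← component_res, hxy]

end UpperBounds

end CohMackey

/-! ### Lower bounds for projective dimensions -/

namespace CohMackey

attribute [local instance] cosetFintype

variable {R : Type u} {G : Type v} [CommRing R] [Group G] [Finite G] {p n : ℕ} {σ : G}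

/-- If the kernel of a homomorphism between functors of fixed points is coflasque, then the elements
of the image that are fixed by `U` come from elements fixed by `U`. -/
theorem exists_lift_of_fixed (h : IsCyclicPGenerator p n σ) {A B D : CohMackey.{w} R G}
    (κ : A ⟶ B) (δ : B ⟶ D) (hA : A.IsCoflasqueFixed p n σ) (hB : B.IsFixed)
    (hκ : Function.Injective (component κ ⊥))
    (hex : Function.Exact (component κ ⊥) (component δ ⊥)) (U : Subgroup G) (b : B.obj ⊥)
    (hb : ∀ g ∈ U, D.act g (component δ ⊥ b) = component δ ⊥ b) :
    ∃ b' : B.obj U, D.res bot_le (component δ U b') = component δ ⊥ b := by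
  obtain ⟨j, hj, rfl⟩ := h.exists_eq_zpowers U
  obtain ⟨a, ha⟩ := (hex (B.act (σ ^ p ^ j) b - b)).1 (by
    rw [map_sub, component_act, hb _ (Subgroup.mem_zpowers _), sub_self])
  have hnorm : ∑ i ∈ Finset.range (p ^ (n - j)), A.act ((σ ^ p ^ j) ^ i) a = 0 := by
    apply hκ
    rw [map_sum, map_zero]
    simp only [component_act, ha, map_sub, ← act_mul, ← pow_succ]
    rw [Finset.sum_range_sub fun i => B.act ((σ ^ p ^ j) ^ i) b, ← pow_mul, ← pow_add,
      Nat.add_sub_of_le hj, h.pow_eq_one, pow_zero, act_one, sub_self]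
  obtain ⟨y, hy⟩ := hA.coflasque j hj a hnorm
  have hfix : B.act (σ ^ p ^ j) (b - component κ ⊥ y) = b - component κ ⊥ y := by
    have h1 := congrArg (component κ ⊥) hy
    rw [ha, map_sub, component_act, sub_eq_sub_iff_add_eq_add] at h1
    rw [map_sub, sub_eq_sub_iff_add_eq_add, add_comm b, ← h1, add_comm]
  obtain ⟨b', hb'⟩ := (hB (Subgroup.zpowers (σ ^ p ^ j))).2 _ fun x hx =>
    B.act_eq_of_mem_zpowers hx hfix
  exact ⟨b', by rw [← component_res, hb', map_sub, hex.apply_apply_eq_zero, sub_zero]⟩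

section Resolutions

variable [IsDomain R] [IsPrincipalIdealRing R] [CharZero R]

/-- A functor of projective dimension at most one is a functor of fixed points, if its restriction
maps are injective. -/
theorem isFixed_of_hasProjectiveResolutionOfLength_one (h : IsCyclicPGenerator p n σ)
    {X : CohMackey.{max u v} R G} (hX : X.IsIInjective)
    (hres : HasProjectiveResolutionOfLength (CohMackey.ev (R := R) (G := G)) X 1) : X.IsFixed := by
  obtain ⟨P, δ, ε, h1, h2, h3, h4, h5⟩ := hres
  have hinj : Function.Injective (component (δ 0) ⊥) := by
    rw [injective_iff_map_eq_zero]
    intro x hx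
    obtain ⟨y, rfl⟩ := (h4 0 ⊥ x).1 hx
    rw [(h5 2 (by norm_num) ⊥).elim y 0]
    exact map_zero _
  refine fun U => ⟨hX U ⊥ bot_le, fun a ha => ?_⟩
  obtain ⟨b, rfl⟩ := h2 ⊥ a
  obtain ⟨b', hb'⟩ := exists_lift_of_fixed h (δ 0) ε (isCoflasqueFixed_of_projective h (P 1))
    (isCoflasqueFixed_of_projective h (P 0)).isFixed hinj (h3 ⊥) U b ha
  exact ⟨_, hb'⟩

/-- A functor of projective dimension at most two vanishes if its value at the trivial subgroup
does. -/
theorem eq_zero_of_hasProjectiveResolutionOfLength_two (h : IsCyclicPGenerator p n σ)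
    {X : CohMackey.{max u v} R G} (hX : Subsingleton (X.obj ⊥))
    (hres : HasProjectiveResolutionOfLength (CohMackey.ev (R := R) (G := G)) X 2)
    (U : Subgroup G) (x : X.obj U) : x = 0 := by
  obtain ⟨P, δ, ε, h1, h2, h3, h4, h5⟩ := hres
  have hinj : Function.Injective (component (δ 1) ⊥) := by
    rw [injective_iff_map_eq_zero]
    intro x hx
    obtain ⟨y, rfl⟩ := (h4 1 ⊥ x).1 hx
    rw [(h5 3 (by norm_num) ⊥).elim y 0]
    exact map_zero _
  obtain ⟨y, rfl⟩ := h2 U x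
  have hfix : ∀ k, (P k).IsFixed := fun k => (isCoflasqueFixed_of_projective h (P k)).isFixed
  obtain ⟨b, hb⟩ := (h3 ⊥ ((P 0).res bot_le y)).1 (hX.elim _ _)
  change component (δ 0) ⊥ b = _ at hb
  obtain ⟨b', hb'⟩ := exists_lift_of_fixed h (δ 1) (δ 0) (isCoflasqueFixed_of_projective h (P 2))
    (hfix 1) hinj (h4 0 ⊥) U b fun g hg => by
    rw [hb]
    exact act_res _ hg y
  refine (h3 U y).2 ⟨b', (hfix 0 U).1 ?_⟩
  exact hb'.trans hb

end Resolutions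

section Examples

open MackeyCat

variable (R G) in
/-- The values of the subfunctor of the constant functor `perm R ⊤` that is divisible by `p` at `G`
and agrees with it at all proper subgroups. -/
def divisibleSubmodule (p : ℕ) (U : Subgroup G) :
    Submodule R ((perm R (⊤ : Subgroup G)).obj U) where
  carrier := {x | U = ⊤ → ∃ y, x = (p : R) • y}
  zero_mem' _ := ⟨0, by rw [smul_zero]⟩
  add_mem' {x x'} hx hx' hU := by
    obtain ⟨y, rfl⟩ := hx hU
    obtain ⟨y', rfl⟩ := hx' hU
    exact ⟨y + y', by rw [smul_add]⟩
  smul_mem' r x hx hU := by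
    obtain ⟨y, rfl⟩ := hx hU
    exact ⟨r • y, by rw [smul_comm]⟩

theorem res_perm_top_surjective {U V : Subgroup G} (h : V ≤ U) :
    Function.Surjective ((perm R (⊤ : Subgroup G)).res h) := fun f => by
  obtain ⟨f', hf'⟩ := exists_coef_eq (V := U) (coef (permHom f)) fun g _ y => by
    have : Subsingleton (G ⧸ (⊤ : Subgroup G)) := QuotientGroup.subsingleton_quotient_top
    rw [Subsingleton.elim (g • y) y]
  exact ⟨f', perm_ext fun y => by rw [permHom_res, coef_proj_comp, hf']⟩

theorem res_mem_divisibleSubmodule {U V : Subgroup G} (hVU : V ≤ U) (x)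
    (hx : x ∈ divisibleSubmodule R G p U) :
    (perm R (⊤ : Subgroup G)).res hVU x ∈ divisibleSubmodule R G p V := fun hV => by
  obtain rfl : U = ⊤ := top_le_iff.1 (hV ▸ hVU)
  obtain ⟨y, rfl⟩ := hx rfl
  exact ⟨_, map_smul _ _ _⟩

theorem tr_mem_divisibleSubmodule (h : IsCyclicPGenerator p n σ) {U V : Subgroup G} (hVU : V ≤ U)
    (x) (hx : x ∈ divisibleSubmodule R G p V) :
    (perm R (⊤ : Subgroup G)).tr hVU x ∈ divisibleSubmodule R G p U := fun hU => by
  subst hU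
  by_cases hV : V = ⊤
  · obtain ⟨y, rfl⟩ := hx hV
    exact ⟨_, map_smul _ _ _⟩
  -- the transfer of a restriction is a multiple of the index, a positive power of `p`
  · obtain ⟨z, rfl⟩ := res_perm_top_surjective hVU x
    obtain ⟨i, _, hi⟩ := (Nat.dvd_prime_pow h.prime).1 (h.card_eq ▸ V.index_dvd_card)
    have hi0 : i ≠ 0 := fun h0 => hV (Subgroup.index_eq_one.1 (by rw [hi, h0, pow_zero]))
    obtain ⟨c, hc⟩ := dvd_pow_self p hi0
    refine ⟨(c : R) • z, ?_⟩
    rw [tr_res_apply, Subgroup.relIndex_top_right, hi, hc, ← Nat.cast_smul_eq_nsmul R, smul_smul,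
      Nat.cast_mul]

theorem conj_mem_divisibleSubmodule (g : G) (U U' : Subgroup G) (hU : U' = conjSubgroup g U) (x)
    (hx : x ∈ divisibleSubmodule R G p U) :
    (perm R (⊤ : Subgroup G)).conj g U U' hU x ∈ divisibleSubmodule R G p U' := fun hU' => by
  have hUtop : U = ⊤ := by
    rw [eq_top_iff]
    intro y _
    have : g * y * g⁻¹ ∈ U' := hU' ▸ Subgroup.mem_top _
    rw [hU, mem_conjSubgroup] at this
    simpa [mul_assoc] using this
  obtain ⟨y, rfl⟩ := hx hUtop
  exact ⟨_, map_smul _ _ _⟩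

variable (R) in
theorem isLattice_perm [IsDomain R] [IsPrincipalIdealRing R] (U : Subgroup G) :
    (perm R U).IsLattice := fun V => by
  let c : (perm R U).obj V →ₗ[R] (G ⧸ U → R) := LinearMap.pi fun y => entryₗ ((1 : G) : G ⧸ _) y
  have hc : Function.Injective c := fun f f' h => perm_ext fun y => congrFun h y
  have := Module.Free.of_injective_of_projective c hc
  exact ⟨Module.Finite.of_injective c hc, inferInstance⟩

theorem permMk_id_ne_smul (hp : ¬ IsUnit (p : R)) (U : Subgroup G) (y : (perm R U).obj U) :
    permMk (𝟙 (ofSubgroup R U)) ≠ (p : R) • y := fun h => by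
  refine hp (IsUnit.of_mul_eq_one (coef (permHom y) ((1 : G) : G ⧸ U)) ?_)
  have h1 : coef (permHom (permMk (𝟙 (ofSubgroup R U)))) ((1 : G) : G ⧸ U) =
      coef (permHom ((p : R) • y)) ((1 : G) : G ⧸ U) := by rw [h]
  classical
  have h2 : coef (permHom (permMk (𝟙 (ofSubgroup R U)))) ((1 : G) : G ⧸ U) = 1 :=
    (entry_id _ _).trans (if_pos rfl)
  exact h1.symm.trans h2

/-- The subfunctor of the constant functor that is divisible by `p` at `G` misses the invariant
element `1` at `G`. -/
theorem exists_isLattice_not_isFixed [IsDomain R] [IsPrincipalIdealRing R] [Nontrivial G]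
    (h : IsCyclicPGenerator p n σ) (hp : ¬ IsUnit (p : R)) :
    ∃ X : CohMackey.{max u v} R G, X.IsLattice ∧ ¬ X.IsFixed := by
  let P := perm R (⊤ : Subgroup G)
  let ι := P.subι (divisibleSubmodule R G p) res_mem_divisibleSubmodule
    (tr_mem_divisibleSubmodule h) conj_mem_divisibleSubmodule
  have hι : ∀ U, Function.Injective (component ι U) := P.component_subι_injective _ _ _ _
  have hrange : ∀ {U} {x : P.obj U}, (U = ⊤ → ∃ y, x = (p : R) • y) ↔ ∃ a, component ι U a = x :=
    fun {U x} => (SetLike.ext_iff.1 (P.range_component_subι (divisibleSubmodule R G p)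
      res_mem_divisibleSubmodule (tr_mem_divisibleSubmodule h) conj_mem_divisibleSubmodule U)
      x).symm
  refine ⟨_, (isLattice_perm R ⊤).of_injective ι hι, fun hfix => ?_⟩
  obtain ⟨a, ha⟩ := hrange.1 (fun hbot => absurd hbot bot_ne_top :
    (⊥ : Subgroup G) = ⊤ → ∃ y, P.res bot_le (permMk (𝟙 _)) = (p : R) • y)
  obtain ⟨b, hb⟩ := (hfix ⊤).2 a fun x hx => hι ⊥ (by rw [component_act, ha, act_res _ hx])
  have hb' : component ι ⊤ b = permMk (𝟙 _) := by
    apply (isFixed_perm (R := R) (⊤ : Subgroup G) ⊤).1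
    rw [← component_res, hb, ha]
  obtain ⟨y, hy⟩ := hrange.2 ⟨b, hb'⟩ rfl
  exact permMk_id_ne_smul hp _ y hy

/-- The quotient of the constant functor by the subfunctor that is divisible by `p` at `G` is
concentrated at `G`. -/
theorem exists_subsingleton_obj_bot [Nontrivial G] (h : IsCyclicPGenerator p n σ)
    (hp : ¬ IsUnit (p : R)) :
    ∃ X : CohMackey.{max u v} R G, Subsingleton (X.obj ⊥) ∧ ∃ x : X.obj ⊤, x ≠ 0 := by
  let P := perm R (⊤ : Subgroup G)
  let π := P.quotπ (divisibleSubmodule R G p) res_mem_divisibleSubmodule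
    (tr_mem_divisibleSubmodule h) conj_mem_divisibleSubmodule
  have hπ : ∀ {U} {x : P.obj U}, component π U x = 0 ↔ (U = ⊤ → ∃ y, x = (p : R) • y) :=
    P.component_quotπ_eq_zero _ _ _ _ _
  refine ⟨_, subsingleton_of_forall_eq 0 fun x => ?_, component π ⊤ (permMk (𝟙 _)), fun h0 => ?_⟩
  · obtain ⟨x, rfl⟩ := P.component_quotπ_surjective _ _ _ _ ⊥ x
    exact hπ.2 fun hbot => absurd hbot bot_ne_top
  · obtain ⟨y, hy⟩ := hπ.1 h0 rfl
    exact permMk_id_ne_smul hp _ y hy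

end Examples

end CohMackey

/-! ### Cohomological Mackey functors as linear functors on the Mackey category -/

namespace CohMackey

attribute [local instance] cosetFintype

open MackeyCat

variable {R : Type u} {G : Type v} [CommRing R] [Group G] [Finite G]

section Yoneda

variable (hc : ∀ a b : G, a * b = b * a) (hchain : ∀ U V : Subgroup G, U ≤ V ∨ V ≤ U)
  (X : CohMackey.{max u v} R G)

theorem yonedaApp_add (U : Subgroup G) (x y : X.obj U) (V : Subgroup G)
    (f : ofSubgroup R V ⟶ ofSubgroup R U) :
    yonedaApp hc X hchain U (x + y) V f =
      yonedaApp hc X hchain U x V f + yonedaApp hc X hchain U y V f := by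
  rcases hchain V U with h | h
  · simp only [yonedaApp_of_le hc X hchain h, yonedaRes_apply, map_add, smul_add,
      Finset.sum_add_distrib]
  · simp only [yonedaApp_of_ge hc X hchain h, yonedaTr_apply, map_add, smul_add,
      Finset.sum_add_distrib]

theorem yonedaApp_smul (U : Subgroup G) (r : R) (x : X.obj U) (V : Subgroup G)
    (f : ofSubgroup R V ⟶ ofSubgroup R U) :
    yonedaApp hc X hchain U (r • x) V f = r • yonedaApp hc X hchain U x V f := by
  rcases hchain V U with h | h
  · simp only [yonedaApp_of_le hc X hchain h, yonedaRes_apply, map_smul, Finset.smul_sum,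
      smul_comm r]
  · simp only [yonedaApp_of_ge hc X hchain h, yonedaTr_apply, map_smul, Finset.smul_sum,
      smul_comm r]

variable {X} in
/-- The homomorphism `perm R U ⟶ X` given by an element of `X_U`. -/
noncomputable def yonedaHom {U : Subgroup G} (x : X.obj U) : perm R U ⟶ X :=
  (exists_perm_hom hc hchain U x).choose

theorem component_yonedaHom {U : Subgroup G} (x : X.obj U) (V : Subgroup G)
    (f : ofSubgroup R V ⟶ ofSubgroup R U) :
    component (yonedaHom hc hchain x) V (permMk f) = yonedaApp hc X hchain U x V f := by
  have h : component (yonedaHom hc hchain x) U (permMk (𝟙 _)) = x :=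
    (exists_perm_hom hc hchain U x).choose_spec
  rw [component_perm hc hchain, h]
  rfl

theorem yonedaApp_id {U : Subgroup G} (x : X.obj U) :
    yonedaApp hc X hchain U x U (𝟙 _) = x := by
  rw [← component_yonedaHom]
  exact (exists_perm_hom hc hchain U x).choose_spec

/-- The homomorphism of represented functors induced by `R[G/U] → R[G/V]`. -/
noncomputable def permMap {U V : Subgroup G} (f : ofSubgroup R U ⟶ ofSubgroup R V) :
    perm R U ⟶ perm R V :=
  homMk (fun _ => Linear.rightComp R _ f)
    (fun h a => Category.assoc (proj R h) (permHom a) f)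
    (fun h a => Category.assoc (transfer R h) (permHom a) f)
    (fun g U U' h a => Category.assoc (conjHom R g U U' h) (permHom a) f)

theorem yonedaApp_comp {U V W : Subgroup G} (x : X.obj W) (f : ofSubgroup R U ⟶ ofSubgroup R V)
    (g : ofSubgroup R V ⟶ ofSubgroup R W) :
    yonedaApp hc X hchain W x U (f ≫ g) =
      yonedaApp hc X hchain V (yonedaApp hc X hchain W x V g) U f := by
  have h := component_perm hc hchain (permMap g ≫ yonedaHom hc hchain x) U (permMk f)
  rw [component_comp, component_comp] at h
  have h1 : component (permMap g) U (permMk f) = permMk (f ≫ g) := rfl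
  have h2 : component (permMap g) V (permMk (𝟙 _)) = permMk g := Category.id_comp g
  rw [h1, h2, component_yonedaHom, component_yonedaHom] at h
  exact h

theorem yonedaApp_proj {U V : Subgroup G} (h : V ≤ U) (x : X.obj U) :
    yonedaApp hc X hchain U x V (proj R h) = X.res h x := by
  have h1 : (perm R U).res h (permMk (𝟙 _)) = permMk (proj R h) := Category.comp_id (proj R h)
  rw [← component_yonedaHom, ← h1, component_res, component_yonedaHom, yonedaApp_id]

theorem yonedaApp_transfer {U V : Subgroup G} (h : U ≤ V) (x : X.obj U) :
    yonedaApp hc X hchain U x V (transfer R h) = X.tr h x := by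
  have h1 : (perm R U).tr h (permMk (𝟙 _)) = permMk (transfer R h) :=
    Category.comp_id (transfer R h)
  rw [← component_yonedaHom, ← h1, component_tr, component_yonedaHom, yonedaApp_id]

theorem yonedaApp_conjHom (g : G) {U U' : Subgroup G} (h : U' = conjSubgroup g U) (x : X.obj U) :
    yonedaApp hc X hchain U x U' (conjHom R g U U' h) = X.conj g U U' h x := by
  have h1 : (perm R U).conj g U U' h (permMk (𝟙 _)) = permMk (conjHom R g U U' h) :=
    Category.comp_id (conjHom R g U U' h)
  rw [← component_yonedaHom, ← h1, component_conj, component_yonedaHom, yonedaApp_id]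

/-- The `R`-linear functor on the Mackey category defined by a cohomological Mackey functor. -/
noncomputable def toLinearPresheafObj : LinearPresheaf.{max u v} R (MackeyCat R G) where
  obj :=
    { obj := fun U => ModuleCat.of R (X.obj U.unop)
      map := fun {U _} f => ModuleCat.ofHom
        { toFun := fun x => yonedaApp hc X hchain U.unop x _ f.unop
          map_add' := fun x y => yonedaApp_add hc hchain X _ x y _ _
          map_smul' := fun r x => yonedaApp_smul hc hchain X _ r x _ _ }
      map_id := fun _ => ModuleCat.hom_ext (LinearMap.ext fun x => yonedaApp_id hc hchain X x)
      map_comp := fun f g => ModuleCat.hom_ext (LinearMap.ext fun x =>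
        yonedaApp_comp hc hchain X x g.unop f.unop) }
  property := ⟨fun A B f g => ModuleCat.hom_ext (LinearMap.ext fun x =>
      (yonedaApp hc X hchain B x A).map_add f g),
    fun A B r f => ModuleCat.hom_ext (LinearMap.ext fun x =>
      (yonedaApp hc X hchain B x A).map_smul r f)⟩

variable (R) in
/-- The functor from cohomological Mackey functors to `R`-linear functors on the Mackey category. -/
noncomputable def toLinearPresheaf :
    CohMackey.{max u v} R G ⥤ LinearPresheaf.{max u v} R (MackeyCat R G) where
  obj X := toLinearPresheafObj hc hchain X
  map φ := ObjectProperty.homMk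
    { app := fun U => ModuleCat.ofHom (component φ U.unop)
      naturality := fun U V f => ModuleCat.hom_ext (LinearMap.ext fun x =>
        component_yonedaApp hc hchain φ U.unop x V.unop f.unop) }
  map_id _ := rfl
  map_comp _ _ := rfl

theorem yonedaApp_toCohMackeyObj (F : LinearPresheaf.{max u v} R (MackeyCat R G)) {U V : Subgroup G}
    (x : F.obj.obj (Opposite.op (ofSubgroup R U))) (f : ofSubgroup R V ⟶ ofSubgroup R U) :
    yonedaApp hc (F.toCohMackeyObj) hchain U x V f = F.mapₗ f x := by
  let φ : perm R U ⟶ F.toCohMackeyObj := homMk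
    (fun V => (F.mapₗ (A := ofSubgroup R V) (B := ofSubgroup R U)).flip x)
    (fun h a => LinearMap.congr_fun (F.mapₗ_comp (proj R h) (permHom a)) x)
    (fun h a => LinearMap.congr_fun (F.mapₗ_comp (transfer R h) (permHom a)) x)
    (fun g U U' h a => LinearMap.congr_fun (F.mapₗ_comp (conjHom R g U U' h) (permHom a)) x)
  have h := component_perm hc hchain φ V (permMk f)
  have h1 : component φ U (permMk (𝟙 _)) = x :=
    LinearMap.congr_fun (F.mapₗ_id (ofSubgroup R U)) x
  rw [h1] at h
  exact h.symm

/-- Passing from linear functors to Mackey functors and back changes nothing. -/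
noncomputable def toLinearPresheafIso (F : LinearPresheaf.{max u v} R (MackeyCat R G)) :
    F ≅ toLinearPresheafObj hc hchain F.toCohMackeyObj where
  hom := ObjectProperty.homMk
    { app := fun _ => ModuleCat.ofHom LinearMap.id
      naturality := fun _ _ f => ModuleCat.hom_ext (LinearMap.ext fun x =>
        (yonedaApp_toCohMackeyObj hc hchain F x f.unop).symm) }
  inv := ObjectProperty.homMk
    { app := fun _ => ModuleCat.ofHom LinearMap.id
      naturality := fun _ _ f => ModuleCat.hom_ext (LinearMap.ext fun x =>
        yonedaApp_toCohMackeyObj hc hchain F x f.unop) }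
  hom_inv_id := rfl
  inv_hom_id := rfl

/-- Passing from Mackey functors to linear functors and back changes nothing. -/
noncomputable def toCohMackeyIso :
    (toLinearPresheafObj hc hchain X).toCohMackeyObj ≅ X where
  hom := homMk (fun _ => LinearMap.id) (fun h x => yonedaApp_proj hc hchain X h x)
    (fun h x => yonedaApp_transfer hc hchain X h x)
    (fun g _ _ h x => yonedaApp_conjHom hc hchain X g h x)
  inv := homMk (fun _ => LinearMap.id) (fun h x => (yonedaApp_proj hc hchain X h x).symm)
    (fun h x => (yonedaApp_transfer hc hchain X h x).symm)
    (fun g _ _ h x => (yonedaApp_conjHom hc hchain X g h x).symm)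
  hom_inv_id := rfl
  inv_hom_id := rfl

variable (R) in
/-- If the subgroups of the commutative group `G` form a chain, then cohomological Mackey functors
are the same as `R`-linear functors on the Mackey category. -/
noncomputable def equivLinearPresheaf :
    CohMackey.{max u v} R G ≌ LinearPresheaf.{max u v} R (MackeyCat R G) :=
  CategoryTheory.Equivalence.mk (toLinearPresheaf R hc hchain) (LinearPresheaf.toCohMackey R G)
    (NatIso.ofComponents (fun X => (toCohMackeyIso hc hchain X).symm) fun _ => rfl)
    (NatIso.ofComponents (fun F => (toLinearPresheafIso hc hchain F).symm) fun _ => rfl)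

end Yoneda

end CohMackey

/-! ### Projective dimensions of linear functors on the Mackey category -/

section ProjDim

variable {R : Type u} [CommRing R] {A : Type*} [Category A] {ι : Type*}
  {ev : ι → A ⥤ ModuleCat.{w} R} {X : A}

theorem projDim_le {d : ℕ} (h : HasProjectiveResolutionOfLength ev X d) : projDim ev X ≤ d :=
  iInf₂_le d h

theorem HasProjectiveResolutionOfLength.mono {d d' : ℕ}
    (h : HasProjectiveResolutionOfLength ev X d) (hd : d ≤ d') :
    HasProjectiveResolutionOfLength ev X d' := by
  obtain ⟨P, δ, ε, h1, h2, h3, h4, h5⟩ := h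
  exact ⟨P, δ, ε, h1, h2, h3, h4, fun k hk => h5 k (hd.trans_lt hk)⟩

theorem le_projDim {d : ℕ} (h : ¬ HasProjectiveResolutionOfLength ev X d) :
    ((d + 1 : ℕ) : ℕ∞) ≤ projDim ev X :=
  le_iInf₂ fun d' hd' => by
    rw [Nat.cast_le]
    by_contra hlt
    exact h (hd'.mono (by omega))

end ProjDim

namespace CohMackey

variable {R : Type u} {G : Type v} [CommRing R] [Group G] [Finite G]
  (hc : ∀ a b : G, a * b = b * a) (hchain : ∀ U V : Subgroup G, U ≤ V ∨ V ≤ U)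

include hc hchain

theorem hasProjectiveResolutionOfLength_of_toCohMackeyObj
    {F : LinearPresheaf.{max u v} R (MackeyCat R G)} {d : ℕ}
    (h : HasProjectiveResolutionOfLength (CohMackey.ev (R := R) (G := G)) F.toCohMackeyObj d) :
    HasProjectiveResolutionOfLength (LinearPresheaf.ev.{max u v} R (MackeyCat R G)) F d := by
  obtain ⟨P, δ, ε, h1, h2, h3, h4, h5⟩ := h
  let e := equivLinearPresheaf R hc hchain
  exact ⟨fun k => e.functor.obj (P k), fun k => e.functor.map (δ k),
    e.functor.map ε ≫ (toLinearPresheafIso hc hchain F).inv,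
    fun k => (e.map_projective_iff _).2 (h1 k), h2, h3, h4, h5⟩

theorem hasProjectiveResolutionOfLength_of_toLinearPresheafObj {X : CohMackey.{max u v} R G} {d : ℕ}
    (h : HasProjectiveResolutionOfLength (LinearPresheaf.ev.{max u v} R (MackeyCat R G))
      (toLinearPresheafObj hc hchain X) d) :
    HasProjectiveResolutionOfLength (CohMackey.ev (R := R) (G := G)) X d := by
  obtain ⟨P, δ, ε, h1, h2, h3, h4, h5⟩ := h
  let e := (equivLinearPresheaf R hc hchain).symm
  exact ⟨fun k => e.functor.obj (P k), fun k => e.functor.map (δ k),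
    e.functor.map ε ≫ (toCohMackeyIso hc hchain X).hom,
    fun k => (e.map_projective_iff _).2 (h1 k), h2, h3, h4, h5⟩

end CohMackey

section GlobalDimension

variable {R : Type u} {G : Type v} [CommRing R] [IsDomain R] [IsDiscreteValuationRing R]
  [CharZero R] [Group G] [Finite G] [Nontrivial G] {p n : ℕ} {σ : G}
  (h : IsCyclicPGenerator p n σ) (hR : IsLocalRing.maximalIdeal R = Ideal.span {(p : R)})

open CohMackey

include h hR

theorem globalLatticeDim_eq_two :
    globalLatticeDim.{max u v} R (MackeyCat R G) = 2 := by
  have hp : ¬ IsUnit (p : R) := by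
    rw [← mem_nonunits_iff, ← IsLocalRing.mem_maximalIdeal, hR]
    exact Ideal.mem_span_singleton_self _
  refine le_antisymm (iSup₂_le fun F hF => projDim_le
    (hasProjectiveResolutionOfLength_of_toCohMackeyObj h.mul_comm h.le_or_le
      (hasProjectiveResolutionOfLength_two h hR fun U =>
        IsLattice.isIInjective (X := F.toCohMackeyObj) hF U ⊥ bot_le))) ?_
  obtain ⟨X, hX, hX'⟩ := exists_isLattice_not_isFixed (R := R) h hp
  exact (le_projDim fun hres => hX' (isFixed_of_hasProjectiveResolutionOfLength_one h
    hX.isIInjective (hasProjectiveResolutionOfLength_of_toLinearPresheafObj h.mul_comm h.le_or_le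
      hres))).trans (le_iSup₂_of_le (toLinearPresheafObj h.mul_comm h.le_or_le X) hX le_rfl)

theorem globalDim_eq_three : globalDim.{max u v} R (MackeyCat R G) = 3 := by
  have hp : ¬ IsUnit (p : R) := by
    rw [← mem_nonunits_iff, ← IsLocalRing.mem_maximalIdeal, hR]
    exact Ideal.mem_span_singleton_self _
  refine le_antisymm (iSup_le fun F => projDim_le
    (hasProjectiveResolutionOfLength_of_toCohMackeyObj h.mul_comm h.le_or_le
      (hasProjectiveResolutionOfLength_three h hR _))) ?_
  obtain ⟨X, hX, x, hx⟩ := exists_subsingleton_obj_bot (R := R) h hp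
  exact (le_projDim fun hres => hx (eq_zero_of_hasProjectiveResolutionOfLength_two h hX
    (hasProjectiveResolutionOfLength_of_toLinearPresheafObj h.mul_comm h.le_or_le hres) ⊤
      x)).trans (le_iSup_of_le (toLinearPresheafObj h.mul_comm h.le_or_le X) le_rfl)

end GlobalDimension

theorem theoremE (R : Type u) [CommRing R] [IsDomain R] [IsDiscreteValuationRing R] [CharZero R]
    (p : ℕ) (hp : p.Prime) (hR : IsLocalRing.maximalIdeal R = Ideal.span {(p : R)})
    (G : Type v) [Group G] [Finite G] [IsCyclic G] (hG : IsPGroup p G) :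
    -- (a)
    (∀ X : CohMackey.{max u v} R G, X.IsFG →
      (∀ (K P₂ P₁ P₀ : CohMackey.{max u v} R G)
        (κ : K ⟶ P₂) (δ₂ : P₂ ⟶ P₁) (δ₁ : P₁ ⟶ P₀) (ε : P₀ ⟶ X),
        P₂.IsProjectiveLattice → P₁.IsProjectiveLattice → P₀.IsProjectiveLattice →
        (∀ U, Function.Surjective (CohMackey.component ε U)) →
        (∀ U, Function.Exact (CohMackey.component δ₁ U) (CohMackey.component ε U)) →
        (∀ U, Function.Exact (CohMackey.component δ₂ U) (CohMackey.component δ₁ U)) →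
        (∀ U, Function.Exact (CohMackey.component κ U) (CohMackey.component δ₂ U)) →
        (∀ U, Function.Injective (CohMackey.component κ U)) →
        K.IsProjectiveLattice) ∧
      projDim CohMackey.ev X ≤ 3) ∧
    -- (b)
    (∀ X : CohMackey.{max u v} R G, X.IsFG → X.IsIInjective →
      (∀ (K P₁ P₀ : CohMackey.{max u v} R G)
        (κ : K ⟶ P₁) (δ₁ : P₁ ⟶ P₀) (ε : P₀ ⟶ X),
        P₁.IsProjectiveLattice → P₀.IsProjectiveLattice →
        (∀ U, Function.Surjective (CohMackey.component ε U)) →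
        (∀ U, Function.Exact (CohMackey.component δ₁ U) (CohMackey.component ε U)) →
        (∀ U, Function.Exact (CohMackey.component κ U) (CohMackey.component δ₁ U)) →
        (∀ U, Function.Injective (CohMackey.component κ U)) →
        K.IsProjectiveLattice) ∧
      projDim CohMackey.ev X ≤ 2) ∧
    -- (c)
    (∀ X : CohMackey.{max u v} R G, X.IsFG → X.IsTypeH0 →
      (∀ (K P₀ : CohMackey.{max u v} R G) (κ : K ⟶ P₀) (ε : P₀ ⟶ X),
        P₀.IsProjectiveLattice →
        (∀ U, Function.Surjective (CohMackey.component ε U)) →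
        (∀ U, Function.Exact (CohMackey.component κ U) (CohMackey.component ε U)) →
        (∀ U, Function.Injective (CohMackey.component κ U)) →
        K.IsProjectiveLattice) ∧
      projDim CohMackey.ev X ≤ 1) ∧
    -- the global dimensions of the Mackey category
    (Nontrivial G →
      globalLatticeDim.{max u v} R (MackeyCat R G) = 2 ∧
      globalDim.{max u v} R (MackeyCat R G) = 3) := by
  obtain ⟨n, σ, h⟩ := exists_isCyclicPGenerator hp hG
  refine ⟨fun X _ => ⟨fun K P₂ P₁ P₀ κ δ₂ δ₁ ε h2 h1 h0 _ _ hδ hκ hκ' => ?_, ?_⟩,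
    fun X _ hX => ⟨fun K P₁ P₀ κ δ₁ ε h1 h0 _ hδ hκ hκ' => ?_, ?_⟩,
    fun X _ hX => ⟨fun K P₀ κ ε h0 hε hκ hκ' => ?_, ?_⟩,
    fun _ => ⟨globalLatticeDim_eq_two h hR, globalDim_eq_three h hR⟩⟩
  · have := h2.1
    have := h1.1
    have := h0.1
    exact ⟨CohMackey.projective_of_exact h hR κ δ₂ δ₁ hκ' hκ hδ, h2.2.of_injective κ hκ'⟩
  · exact projDim_le (CohMackey.hasProjectiveResolutionOfLength_three h hR X)
  · have := h1.1
    have := h0.1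
    exact ⟨CohMackey.projective_of_exact_of_injective h hR κ δ₁ ε hκ' hκ hδ fun U =>
      hX U ⊥ bot_le, h1.2.of_injective κ hκ'⟩
  · exact projDim_le (CohMackey.hasProjectiveResolutionOfLength_two h hR fun U => hX U ⊥ bot_le)
  · have := h0.1
    exact ⟨CohMackey.projective_of_exact_of_isFixed h hR κ ε hκ' hκ hε hX.isFixed,
      h0.2.of_injective κ hκ'⟩
  · exact projDim_le (CohMackey.hasProjectiveResolutionOfLength_one h hR hX.isFixed)
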